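/- **Setting.** Let $K,L$ be integers with $5\le K\le L$, let $\Lambda=\{1,\dots,K\}\times\{1,\dots,L\}\subset\mathbb Z^2$ with open boundary conditions, and write $x\sim y$ for $x,y\in\Lambda$ with $|x-y|=1$. For spin configurations $\sigma\in\mathcal X=\{-1,0,+1\}^{\Lambda}$ let $$H(\sigma)=\sum_{\{x,y\}:\,x\sim y}\bigl(\sigma(x)-\sigma(y)\bigr)^2$$ (the Blume–Capel Hamiltonian with zero chemical potential and zero external field). For $\beta>0$ let $(\sigma_\beta(t))_{t\ge0}$ be the continuous-time Markov chain on $\mathcal X$ with rates $c_\beta(\sigma,\zeta)=e^{-\beta\max\{H(\zeta)-H(\sigma),0\}}$ if $\zeta\neq\sigma$ differs from $\sigma$ at exactly one site, and $c_\beta(\sigma,\zeta)=0$ otherwise. Let $\mathbf{-1},\mathbf 0,\mathbf{+1}$ be the constant configurations, $\mathbb E^\beta_\sigma$ the expectation for the chain started at $\sigma$, $\tau_{\mathcal A}$ the hitting time of $\mathcal A\subseteq\mathcal X$ (with $\tau_\sigma=\tau_{\{\sigma\}}$), and $\Gamma=K+1$. Write $a_\beta\simeq b_\beta$ if $a_\beta/b_\beta\to1$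 as $\beta\to\infty$ (with $K,L$ fixed). **Theorem 2.4 (Eyring–Kramers law).** There exist constants $\kappa=\kappa(K,L)>0$, $5\le K\le L$, depending only on $K$ and $L$, such that for all $5\le K\le L$ the following hold, where the equalities are for every $\beta>0$: 1. $\mathbb E^\beta_{\mathbf{-1}}[\tau_{\{\mathbf 0,\mathbf{+1}\}}]=\mathbb E^\beta_{\mathbf{+1}}[\tau_{\{\mathbf{-1},\mathbf 0\}}]\simeq\kappa e^{\beta\Gamma}$ and $\mathbb E^\beta_{\mathbf 0}[\tau_{\{\mathbf{-1},\mathbf{+1}\}}]\simeq\frac{\kappa}{2}e^{\beta\Gamma}$; 2. $\mathbb E^\beta_{\mathbf{-1}}[\tau_{\mathbf 0}]=\mathbb E^\beta_{\mathbf{+1}}[\tau_{\mathbf 0}]\simeq\kappa e^{\beta\Gamma}$; 3. $\mathbb E^\beta_{\mathbf 0}[\tau_{\mathbf{-1}}]=\mathbb E^\beta_{\mathbf 0}[\tau_{\mathbf{+1}}]\simeq2\kappa e^{\beta\Gamma}$; 4. $\mathbb E^\beta_{\mathbf{-1}}[\tau_{\mathbf{+1}}]=\mathbb E^\beta_{\mathbf{+1}}[\tau_{\mathbf{-1}}]\simeq3\kappa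 e^{\beta\Gamma}$. Moreover, as $K\to\infty$, $$\frac{\kappa(K,L)}{KL}\longrightarrow\begin{cases}1/4&\text{over pairs with }K<L,\text{ uniformly in }L,\\ 1/8&\text{over pairs with }K=L.\end{cases}$$ -/

import Mathlib

open MeasureTheory ProbabilityTheory Filter Topology
open scoped ENNReal NNReal

noncomputable section

/-! ### Continuous-time Markov chains on a finite state space

The chain with transition rates `c x y` (where `c x x = 0`) is realised on the space of sequences
`ω n = (n-th visited state, time spent during this n-th visit)`: from `x` the chain jumps to `y`
with probability `c x y / ∑ z, c x z`, and each visit to `x` lasts, independently of everything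
else, an exponential time of rate `∑ z, c x z`. -/

namespace MarkovChain

/-- Total rate of leaving `x`. -/
def exitRate {V : Type*} [Fintype V] (c : V → V → ℝ≥0) (x : V) : ℝ≥0 := ∑ y, c x y

/-- Law of the next visited state from `x`. It is the Dirac mass at `x` if no transition from `x`
is possible (absorbing state). -/
def jumpLaw {V : Type*} [Fintype V] (c : V → V → ℝ≥0) (x : V) : PMF V :=
  if h : exitRate c x = 0 then PMF.pure x
  else PMF.normalize (fun y => (c x y : ℝ≥0∞))
    (by
      rw [tsum_fintype, ← ENNReal.ofNNReal_finsetSum]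
      exact ENNReal.coe_ne_zero.2 h)
    (by
      rw [tsum_fintype, ← ENNReal.ofNNReal_finsetSum]
      exact ENNReal.coe_ne_top)

/-- Rate of the exponential holding times at `x`. At an absorbing state the value `1` is used: the
chain then "jumps" from `x` to `x` at rate one, so its path stays at `x` forever. -/
def holdingRate {V : Type*} [Fintype V] (c : V → V → ℝ≥0) (x : V) : ℝ :=
  if exitRate c x = 0 then 1 else (exitRate c x : ℝ)

lemma holdingRate_pos {V : Type*} [Fintype V] (c : V → V → ℝ≥0) (x : V) :
    0 < holdingRate c x := by
  unfold holdingRate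
  split_ifs with h
  · exact one_pos
  · exact NNReal.coe_pos.2 (pos_iff_ne_zero.2 h)

/-- Joint law of (visited state, holding time there), given that the visited state is `y`. -/
def visitKernel {V : Type*} [Fintype V] [MeasurableSpace V] [DiscreteMeasurableSpace V]
    (c : V → V → ℝ≥0) : Kernel V (V × ℝ) :=
  Kernel.ofFunOfCountable fun y => (Measure.dirac y).prod (expMeasure (holdingRate c y))

instance {V : Type*} [Fintype V] [MeasurableSpace V] [DiscreteMeasurableSpace V]
    (c : V → V → ℝ≥0) : IsMarkovKernel (visitKernel c) := by
  refine ⟨fun y => ?_⟩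
  have := isProbabilityMeasure_expMeasure (holdingRate_pos c y)
  change IsProbabilityMeasure ((Measure.dirac y).prod (expMeasure (holdingRate c y)))
  infer_instance

/-- The transition kernel of the jump chain of visited states. -/
def jumpKernel {V : Type*} [Fintype V] [MeasurableSpace V] [DiscreteMeasurableSpace V]
    (c : V → V → ℝ≥0) : Kernel V V :=
  Kernel.ofFunOfCountable fun x => (jumpLaw c x).toMeasure

instance {V : Type*} [Fintype V] [MeasurableSpace V] [DiscreteMeasurableSpace V]
    (c : V → V → ℝ≥0) : IsMarkovKernel (jumpKernel c) :=
  ⟨fun x => inferInstanceAs (IsProbabilityMeasure (jumpLaw c x).toMeasure)⟩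

/-- Law of the `(n+1)`-st (state, holding time) given the first `n` ones: it depends on the `n`-th
state only. -/
def stepKernel {V : Type*} [Fintype V] [MeasurableSpace V] [DiscreteMeasurableSpace V]
    (c : V → V → ℝ≥0) (n : ℕ) : Kernel (Π _ : Finset.Iic n, V × ℝ) (V × ℝ) :=
  (visitKernel c ∘ₖ jumpKernel c).comap
    (fun h => (h ⟨n, Finset.mem_Iic.2 le_rfl⟩).1) (by fun_prop)

instance {V : Type*} [Fintype V] [MeasurableSpace V] [DiscreteMeasurableSpace V]
    (c : V → V → ℝ≥0) (n : ℕ) : IsMarkovKernel (stepKernel c n) := by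
  unfold stepKernel
  infer_instance

/-- The law `ℙ_x` of the chain with rates `c` started from `x`. -/
def law {V : Type*} [Fintype V] [MeasurableSpace V] [DiscreteMeasurableSpace V]
    (c : V → V → ℝ≥0) (x : V) : Measure (ℕ → V × ℝ) :=
  Kernel.trajMeasure (X := fun _ => V × ℝ) (visitKernel c x) (stepKernel c)

/-- Time of the `n`-th jump (and `0` for `n = 0`). -/
def jumpTime {V : Type*} (ω : ℕ → V × ℝ) (n : ℕ) : ℝ := ∑ k ∈ Finset.range n, (ω k).2

/-- Position of the chain at time `t`: the `n`-th visited state for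
`jumpTime ω n ≤ t < jumpTime ω (n + 1)`. (Almost surely the set below is finite and nonempty for
all `t ≥ 0`.) -/
def position {V : Type*} (ω : ℕ → V × ℝ) (t : ℝ) : V := (ω (sSup {n | jumpTime ω n ≤ t})).1

/-- Hitting time `τ_A = inf {t ≥ 0 : position at time t lies in A}`. -/
def hittingTime {V : Type*} (A : Set V) (ω : ℕ → V × ℝ) : ℝ≥0∞ :=
  ⨅ (t : ℝ≥0) (_ : position ω t ∈ A), (t : ℝ≥0∞)

/-- Mean hitting time `𝔼_x[τ_A]`. -/
def meanHittingTime {V : Type*} [Fintype V] [MeasurableSpace V] [DiscreteMeasurableSpace V]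
    (c : V → V → ℝ≥0) (x : V) (A : Set V) : ℝ≥0∞ :=
  ∫⁻ ω, hittingTime A ω ∂(law c x)

end MarkovChain

/-! ### The Blume–Capel model with zero chemical potential and zero external field -/

namespace BlumeCapel

instance : MeasurableSpace SignType := ⊤

instance : DiscreteMeasurableSpace SignType := ⟨fun _ => trivial⟩

/-- The box `⟦1, K⟧ × ⟦1, L⟧` (coordinates are shifted to start from `0`). -/
abbrev Site (K L : ℕ) : Type := Fin K × Fin L

/-- Spin configurations; the spins `-1, 0, +1` are the elements of `SignType`. -/
abbrev Config (K L : ℕ) : Type := Site K L → SignType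

/-- Nearest neighbours in the box with open boundary: `|x - y| = 1` in `ℤ²`. -/
def Adj {K L : ℕ} (x y : Site K L) : Prop :=
  |(x.1 : ℤ) - (y.1 : ℤ)| + |(x.2 : ℤ) - (y.2 : ℤ)| = 1

open Classical in
/-- The Hamiltonian `H(σ) = ∑_{x ∼ y} (σ(x) - σ(y))²`. Each unordered pair of neighbours counts
once, hence the factor `1/2` in front of the sum over ordered pairs. -/
def energy {K L : ℕ} (σ : Config K L) : ℝ :=
  (1 / 2 : ℝ) * ∑ x, ∑ y, if Adj x y then ((σ x : ℝ) - (σ y : ℝ)) ^ 2 else 0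

open Classical in
/-- Metropolis rates `c_β(σ, ζ) = exp (-β [H(ζ) - H(σ)]₊)` if `ζ ≠ σ` is obtained from `σ` by
updating one spin, and `0` otherwise. -/
def rate {K L : ℕ} (β : ℝ) (σ ζ : Config K L) : ℝ≥0 :=
  if ζ ≠ σ ∧ ∃ (x : Site K L) (a : SignType), ζ = Function.update σ x a then
    Real.toNNReal (Real.exp (-β * max (energy ζ - energy σ) 0))
  else 0

/-- The monochromatic configuration with all spins equal to `a`. -/
def mono (K L : ℕ) (a : SignType) : Config K L := fun _ => a

/-- `𝔼_a^β[τ_{b : b ∈ B}]`: mean time in which the Metropolis dynamics at inverse temperature `β`,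
started from the monochromatic configuration of spin `a`, hits the set of the monochromatic
configurations with spins in `B`. -/
def meanTransitionTime (K L : ℕ) (β : ℝ) (a : SignType) (B : Set SignType) : ℝ≥0∞ :=
  MarkovChain.meanHittingTime (rate β) (mono K L a) (mono K L '' B)

/-- The energy barrier `Γ = K + 1` for open boundary conditions. -/
def barrier (K : ℕ) : ℝ := K + 1

/-- `a_β ≃ p e^{βΓ}`: the ratio tends to `1` as `β → ∞`. -/
def AsympEK (K : ℕ) (p : ℝ) (a : ℝ → ℝ≥0∞) : Prop :=
  Tendsto (fun β : ℝ => a β / ENNReal.ofReal (p * Real.exp (β * barrier K))) atTop (𝓝 1)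

end BlumeCapel

end

noncomputable section

set_option linter.unusedSectionVars false

/-! ### Mean hitting times as solutions of a Poisson equation. -/

namespace MarkovChain

/-! The Metropolis chain is reversible, so a mean hitting time solves a Poisson equation on a
symmetric network of configurations. After rescaling by `exp (βΓ)`, an edge has conductance `exp (β
(Γ - height))`, its height being the larger energy of its two ends
(`MarkovChain.meanHittingTime_eq`, `BlumeCapel.meanTransitionTime_eq`). Testing this equation
against the equilibrium potential of a ground state gives exact linear relations between the values
of the mean time at the three ground states. By spin-flip symmetry only two coefficients occur:
`Landscape.cap`, the capacity between -1 and the other two states, and `Landscape.cross`, the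
effective conductance between -1 and +1. The Gibbs masses in these relations tend to 1. Hence all
asymptotics follow once `cap` tends to some C > 0 and `cross` tends to 0: the limit is the walk on
the path -1, 0, +1 with all jump rates C, and κ = 1/C.

The convergence of `cap` is soft (`Landscape.exists_tendsto_cap`). Energies are integers, so edges
above the barrier contribute O(exp (-β)), while the part of the capacity carried by the other edges
increases with β. It stays bounded because some test function is constant along all edges strictly
below the barrier.

For `cross` (`Landscape.tendsto_cross`) it suffices that -1 is outside the well of 0, and that
without entering this well +1 cannot be reached from -1 along edges up to the barrier. The geometric
input is a trichotomy (`Grid.cross_or_nonconst`): an array contains a row and a column of one common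
spin (a cross), or all rows are nonconstant, or all columns are. With M nonconstant rows and energy
at most M + 1, only one unit of energy is left for the columns, so the array is a strip of two spins
that differ by one (`Grid.exists_isStrip`). Following single flips between crosses and strips gives
an explicit set that contains -1, misses +1, and can be left only into the well of 0
(`BlumeCapel.loSide_step`, `BlumeCapel.hi_notMem_side`).

The same classification shows that, away from crosses, the passage from -1 to 0 grows a strip cell
by cell. Up to the two reflections there are four such chains, and eight if K = L, since
transposition is then available. Their edges have conductance at least 1, and exactly 1 where they
reach the barrier. Each chain has between K(L-4) and K(L-2) edges that matter, so C lies between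
4o/(K(L-2)) and 4o/(K(L-4)), with o = 1 or 2 orientations (`BlumeCapel.exists_capacity`). The lower
bound is Cauchy–Schwarz along disjoint chains; the upper bound uses a test function that
interpolates linearly in the number of zeros. The resulting error for κ/(KL) is at most 1/(Lo),
which is uniform because L ≥ K. -/

lemma lintegral_ofReal_expMeasure {r : ℝ} (hr : 0 < r) :
    ∫⁻ t, ENNReal.ofReal t ∂expMeasure r = ENNReal.ofReal r⁻¹ := by
  have h2 := lintegral_gammaPDF_eq_one (a := 2) (r := r) two_pos hr
  have hm : Measurable (gammaPDF 1 r) := (measurable_gammaPDFReal 1 r).ennreal_ofReal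
  rw [expMeasure, gammaMeasure, lintegral_withDensity_eq_lintegral_mul _ hm
    ENNReal.measurable_ofReal]
  -- Multiplying the exponential density by t gives, up to the factor 1/r, the density of the Gamma
  -- law of shape 2, whose total mass is one.
  have : ∀ t, (gammaPDF 1 r * fun t => ENNReal.ofReal t) t
      = ENNReal.ofReal r⁻¹ * gammaPDF 2 r t := by
    intro t
    rw [Pi.mul_apply]
    by_cases ht : 0 ≤ t
    · rw [gammaPDF_of_nonneg ht, gammaPDF_of_nonneg ht, ← ENNReal.ofReal_mul (by positivity),
        ← ENNReal.ofReal_mul (by positivity)]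
      congr 1
      have h2 : Real.Gamma 2 = 1 := Real.Gamma_two
      rw [h2, Real.Gamma_one]
      norm_num
      field_simp
    · rw [gammaPDF_of_neg (not_le.1 ht), gammaPDF_of_neg (not_le.1 ht)]
      simp
  simp_rw [this]
  have hm2 : Measurable (gammaPDF 2 r) := (measurable_gammaPDFReal 2 r).ennreal_ofReal
  rw [lintegral_const_mul _ hm2, h2, mul_one]

lemma ae_pos_expMeasure (r : ℝ) : ∀ᵐ t ∂expMeasure r, 0 < t := by
  have hm : Measurable (gammaPDF 1 r) := (measurable_gammaPDFReal 1 r).ennreal_ofReal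
  rw [expMeasure, gammaMeasure, ae_withDensity_iff hm]
  filter_upwards [compl_mem_ae_iff.2 (measure_singleton (0 : ℝ))] with t ht h
  by_contra hneg
  exact h (gammaPDF_of_neg (lt_of_le_of_ne (not_lt.1 hneg) ht))

variable {V : Type*} [Fintype V] [MeasurableSpace V] [DiscreteMeasurableSpace V]
  (c : V → V → ℝ≥0)

/-- Mean of a function of a visit over the holding time, given the visited state. -/
def visitMean (G : V × ℝ → ℝ≥0∞) (y : V) : ℝ≥0∞ :=
  ∫⁻ t, G (y, t) ∂expMeasure (holdingRate c y)

/-- Mean of a function of the state after one jump. -/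
def jumpMean (ψ : V → ℝ≥0∞) (x : V) : ℝ≥0∞ := ∑ y, ψ y * jumpLaw c x y

lemma lintegral_visitKernel {G : V × ℝ → ℝ≥0∞} (hG : Measurable G) (y : V) :
    ∫⁻ z, G z ∂visitKernel c y = visitMean c G y := by
  have := isProbabilityMeasure_expMeasure (holdingRate_pos c y)
  change ∫⁻ z, G z ∂(Measure.dirac y).prod (expMeasure (holdingRate c y)) = _
  rw [lintegral_prod _ hG.aemeasurable, lintegral_dirac]
  rfl

lemma lintegral_step {G : V × ℝ → ℝ≥0∞} (hG : Measurable G) (x : V) :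
    ∫⁻ z, G z ∂(visitKernel c ∘ₖ jumpKernel c) x = jumpMean c (visitMean c G) x := by
  rw [Kernel.lintegral_comp _ _ _ hG]
  simp_rw [lintegral_visitKernel c hG]
  change ∫⁻ y, visitMean c G y ∂(jumpLaw c x).toMeasure = _
  rw [lintegral_fintype]
  refine Finset.sum_congr rfl fun y _ => ?_
  rw [PMF.toMeasure_apply_singleton _ _ (measurableSet_singleton y)]

lemma law_map_zero (x : V) : (law c x).map (fun ω => ω 0) = visitKernel c x := by
  have h : (fun ω : ℕ → V × ℝ => ω 0)
      = (MeasurableEquiv.piUnique (fun _ : Finset.Iic 0 => V × ℝ)) ∘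
        (Preorder.frestrictLe (π := fun _ => V × ℝ) 0) := by
    ext ω <;> rfl
  rw [h, ← Measure.map_map (by fun_prop) (by fun_prop), law, Kernel.trajMeasure,
    Measure.map_comp _ _ (by fun_prop), Kernel.traj_map_frestrictLe,
    Kernel.partialTraj_self, Measure.id_comp, Measure.map_map (by fun_prop) (by fun_prop)]
  convert Measure.map_id
  exact MeasurableEquiv.self_comp_symm _

/-- Markov property in integrated form, read off from the disintegration of the trajectory measure:
given the visits 0, ..., n, the next one depends only on the state of the last. -/
lemma lintegral_law_succ (x : V) (n : ℕ) {Φ : (Π _ : Finset.Iic n, V × ℝ) → ℝ≥0∞}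
    (hΦ : Measurable Φ) {G : V × ℝ → ℝ≥0∞} (hG : Measurable G) :
    ∫⁻ ω, Φ (Preorder.frestrictLe (π := fun _ => V × ℝ) n ω) * G (ω (n + 1)) ∂law c x =
      ∫⁻ ω, Φ (Preorder.frestrictLe (π := fun _ => V × ℝ) n ω)
        * jumpMean c (visitMean c G) (ω n).1 ∂law c x := by
  have key := Kernel.map_frestrictLe_trajMeasure_compProd_eq_map_trajMeasure
    (X := fun _ => V × ℝ) (μ₀ := visitKernel c x) (κ := stepKernel c) (a := n)
  have h1 : ∫⁻ ω, Φ (Preorder.frestrictLe (π := fun _ => V × ℝ) n ω) * G (ω (n + 1)) ∂law c x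
      = ∫⁻ p, Φ p.1 * G p.2 ∂((law c x).map (fun ω => (Preorder.frestrictLe (π := fun _ => V × ℝ) n ω, ω (n + 1)))) := by
    rw [lintegral_map (by fun_prop) (by fun_prop)]
  rw [h1, law, ← key, Measure.lintegral_compProd (by fun_prop)]
  have hm : Measurable fun h : (Π _ : Finset.Iic n, V × ℝ) =>
      ∫⁻ z, Φ h * G z ∂stepKernel c n h := by
    refine Measurable.lintegral_kernel_prod_right (f := fun h z => Φ h * G z) ?_
    fun_prop
  rw [lintegral_map hm (by fun_prop)]
  refine lintegral_congr fun ω => ?_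
  rw [lintegral_const_mul _ hG]
  congr 1
  exact lintegral_step c hG _

open Classical in
/-- Integral of a function of the `n`-th visit over the event that `A` is not visited before. -/
def killedMean (x : V) (A : Set V) (n : ℕ) (G : V × ℝ → ℝ≥0∞) : ℝ≥0∞ :=
  ∫⁻ ω, (if ∀ k < n, (ω k).1 ∉ A then 1 else 0) * G (ω n) ∂law c x

lemma measurable_of_fst (ψ : V → ℝ≥0∞) : Measurable (fun z : V × ℝ => ψ z.1) :=
  (measurable_of_finite ψ).comp measurable_fst

open Classical in
lemma killedMean_zero (x : V) (A : Set V) {G : V × ℝ → ℝ≥0∞} (hG : Measurable G) :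
    killedMean c x A 0 G = visitMean c G x := by
  rw [← lintegral_visitKernel c hG, ← law_map_zero, lintegral_map hG (by fun_prop)]
  simp [killedMean]

open Classical in
lemma killedMean_succ (x : V) (A : Set V) (n : ℕ) {G : V × ℝ → ℝ≥0∞} (hG : Measurable G) :
    killedMean c x A (n + 1) G = killedMean c x A n
      (fun z => if z.1 ∈ A then 0 else jumpMean c (visitMean c G) z.1) := by
  have hA : MeasurableSet A := MeasurableSet.of_discrete
  have hΦ : Measurable (fun h : (Π _ : Finset.Iic n, V × ℝ) =>
      if ∀ k : Finset.Iic n, (h k).1 ∉ A then (1 : ℝ≥0∞) else 0) := by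
    refine Measurable.ite ?_ measurable_const measurable_const
    rw [Set.ofPred_forall]
    exact MeasurableSet.iInter fun k => (hA.compl).preimage (by fun_prop)
  have h := lintegral_law_succ c x n hΦ hG
  unfold killedMean
  convert h using 1
  · refine lintegral_congr fun ω => ?_
    congr 1
    refine if_congr ?_ rfl rfl
    simp only [Subtype.forall, Finset.mem_Iic, Nat.lt_succ_iff]
    rfl
  · refine lintegral_congr fun ω => ?_
    by_cases h1 : ∀ k < n, (ω k).1 ∉ A
    · by_cases h2 : (ω n).1 ∈ A
      · have : ¬ ∀ k : Finset.Iic n,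
            (Preorder.frestrictLe (π := fun _ => V × ℝ) n ω k).1 ∉ A := by
          intro h
          exact h ⟨n, Finset.mem_Iic.2 le_rfl⟩ h2
        rw [if_pos h1, if_neg this]
        simp only [if_pos h2]
        simp
      · have : ∀ k : Finset.Iic n,
            (Preorder.frestrictLe (π := fun _ => V × ℝ) n ω k).1 ∉ A := by
          rintro ⟨k, hk⟩
          rcases (Finset.mem_Iic.1 hk).lt_or_eq with hk | rfl
          · exact h1 k hk
          · exact h2
        rw [if_pos h1, if_pos this]
        simp only [if_neg h2]
    · have : ¬ ∀ k : Finset.Iic n,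
            (Preorder.frestrictLe (π := fun _ => V × ℝ) n ω k).1 ∉ A := by
        intro h
        exact h1 fun k hk => h ⟨k, Finset.mem_Iic.2 hk.le⟩
      rw [if_neg h1, if_neg this]
      simp

open Classical in
-- The survival event involves earlier visits only, and given the visited state the holding time is
-- independent of them. So a function of the visit may be replaced by any other with the same
-- conditional mean.
lemma killedMean_congr (x : V) (A : Set V) (n : ℕ) {G G' : V × ℝ → ℝ≥0∞} (hG : Measurable G)
    (hG' : Measurable G') (h : ∀ y, visitMean c G y = visitMean c G' y) :
    killedMean c x A n G = killedMean c x A n G' := by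
  have h' : visitMean c G = visitMean c G' := funext h
  cases n with
  | zero => rw [killedMean_zero c x A hG, killedMean_zero c x A hG', h']
  | succ n => rw [killedMean_succ c x A n hG, killedMean_succ c x A n hG', h']

open Classical in
lemma killedMean_mono (x : V) (A : Set V) (n : ℕ) {G G' : V × ℝ → ℝ≥0∞} (h : ∀ z, G z ≤ G' z) :
    killedMean c x A n G ≤ killedMean c x A n G' :=
  lintegral_mono fun _ => mul_le_mul_right (h _) _

open Classical in
lemma measurable_alive (A : Set V) (n : ℕ) :
    Measurable fun ω : ℕ → V × ℝ => if ∀ k < n, (ω k).1 ∉ A then (1 : ℝ≥0∞) else 0 := by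
  have hA : MeasurableSet A := MeasurableSet.of_discrete
  refine Measurable.ite ?_ measurable_const measurable_const
  rw [Set.ofPred_forall]
  refine MeasurableSet.iInter fun k => ?_
  rw [Set.ofPred_forall]
  exact MeasurableSet.iInter fun _ => (hA.compl).preimage (by fun_prop)

open Classical in
lemma measurable_killed (A : Set V) (n : ℕ) {G : V × ℝ → ℝ≥0∞} (hG : Measurable G) :
    Measurable fun ω : ℕ → V × ℝ => (if ∀ k < n, (ω k).1 ∉ A then 1 else 0) * G (ω n) :=
  (measurable_alive A n).mul (hG.comp (measurable_pi_apply n))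

lemma killedMean_add (x : V) (A : Set V) (n : ℕ) {G G' : V × ℝ → ℝ≥0∞} (hG : Measurable G) :
    killedMean c x A n (fun z => G z + G' z) = killedMean c x A n G + killedMean c x A n G' := by
  unfold killedMean
  rw [← lintegral_add_left (measurable_killed A n hG)]
  exact lintegral_congr fun ω => mul_add _ _ _

lemma killedMean_const_mul (x : V) (A : Set V) (n : ℕ) {G : V × ℝ → ℝ≥0∞} (hG : Measurable G)
    (C : ℝ≥0∞) :
    killedMean c x A n (fun z => C * G z) = C * killedMean c x A n G := by
  unfold killedMean
  rw [← lintegral_const_mul _ (measurable_killed A n hG)]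
  exact lintegral_congr fun ω => mul_left_comm _ _ _

lemma visitMean_add {G G' : V × ℝ → ℝ≥0∞} (hG : Measurable G) (y : V) :
    visitMean c (fun z => G z + G' z) y = visitMean c G y + visitMean c G' y := by
  have h : Measurable fun t : ℝ => G (y, t) := hG.comp measurable_prodMk_left
  unfold visitMean
  rw [← lintegral_add_left h]

lemma visitMean_fst (ψ : V → ℝ≥0∞) (y : V) : visitMean c (fun z => ψ z.1) y = ψ y := by
  have := isProbabilityMeasure_expMeasure (holdingRate_pos c y)
  simp [visitMean]

lemma ae_holding_pos (x : V) : ∀ᵐ ω ∂law c x, ∀ n, 0 < (ω n).2 := by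
  classical
  rw [ae_all_iff]
  intro n
  have hS : MeasurableSet {z : V × ℝ | ¬ 0 < z.2} :=
    (measurableSet_lt measurable_const measurable_snd).compl
  have hG : Measurable (Set.indicator {z : V × ℝ | ¬ 0 < z.2} (fun _ => (1 : ℝ≥0∞))) :=
    measurable_const.indicator hS
  have h0 : ∀ y, visitMean c (Set.indicator {z : V × ℝ | ¬ 0 < z.2} (fun _ => (1 : ℝ≥0∞))) y
      = visitMean c (fun _ => 0) y := by
    intro y
    refine lintegral_congr_ae ?_
    filter_upwards [ae_pos_expMeasure (holdingRate c y)] with t ht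
    simp [Set.indicator, ht]
  -- With the empty target nothing is killed, so this computes the plain expectation for the `n`-th
  -- visit.
  have h := killedMean_congr c x ∅ n hG measurable_const h0
  simp only [killedMean, Set.mem_empty_iff_false, not_false_eq_true, implies_true, if_true,
    one_mul, mul_zero, lintegral_zero] at h
  rw [lintegral_eq_zero_iff (by fun_prop)] at h
  filter_upwards [h] with ω hω
  by_contra hneg
  simp [Set.indicator, hneg] at hω

lemma jumpTime_strictMono {ω : ℕ → V × ℝ} (hpos : ∀ n, 0 < (ω n).2) :
    StrictMono (jumpTime ω) :=
  strictMono_nat_of_lt_succ fun n => by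
    simpa [jumpTime, Finset.sum_range_succ] using hpos n

open Classical in
-- Positive holding times make the jump times strictly increasing, so the supremum in `position`
-- picks out the current visit. Only times up to the first visit to `A` matter, and there that
-- supremum is over a bounded set; non-explosion is never needed.
lemma hittingTime_eq (A : Set V) {ω : ℕ → V × ℝ} (hpos : ∀ n, 0 < (ω n).2)
    (hN : ∃ n, (ω n).1 ∈ A) :
    hittingTime A ω = ∑' n, (if ∀ k < n, (ω k).1 ∉ A then 1 else 0)
      * (if (ω n).1 ∈ A then 0 else ENNReal.ofReal (ω n).2) := by
  have hmono := jumpTime_strictMono hpos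
  set N := Nat.find hN with hNdef
  have hNA : (ω N).1 ∈ A := Nat.find_spec hN
  have hlt : ∀ k < N, (ω k).1 ∉ A := fun k hk => Nat.find_min hN hk
  have hnn : 0 ≤ jumpTime ω N := Finset.sum_nonneg fun n _ => (hpos n).le
  have hR : ∑' n, (if ∀ k < n, (ω k).1 ∉ A then (1 : ℝ≥0∞) else 0)
      * (if (ω n).1 ∈ A then 0 else ENNReal.ofReal (ω n).2) = ENNReal.ofReal (jumpTime ω N) := by
    rw [tsum_eq_sum (s := Finset.range N), jumpTime, ENNReal.ofReal_sum_of_nonneg]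
    · refine Finset.sum_congr rfl fun n hn => ?_
      have hn := Finset.mem_range.1 hn
      rw [if_pos fun k hk => hlt k (hk.trans hn), if_neg (hlt n hn), one_mul]
    · exact fun n _ => (hpos n).le
    · intro n hn
      have hn : N ≤ n := by simpa using hn
      rcases hn.eq_or_lt with rfl | hn
      · rw [if_pos hNA, mul_zero]
      · rw [if_neg fun h => h N hn hNA, zero_mul]
  rw [hR]
  refine le_antisymm ?_ ?_
  · refine iInf₂_le_of_le ⟨jumpTime ω N, hnn⟩ ?_ ?_
    · have : {n | jumpTime ω n ≤ jumpTime ω N} = Set.Iic N := by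
        ext n; simp [hmono.le_iff_le]
      change (ω (sSup {n | jumpTime ω n ≤ jumpTime ω N})).1 ∈ A
      rw [this, csSup_Iic]
      exact hNA
    · rw [ENNReal.ofReal_eq_coe_nnreal hnn]
      exact le_rfl
  · refine le_iInf₂ fun t ht => ?_
    by_contra! hlt'
    have htN : (t : ℝ) < jumpTime ω N := by
      rw [← ENNReal.ofReal_coe_nnreal] at hlt'
      exact (ENNReal.ofReal_lt_ofReal_iff'.1 hlt').1
    have hbdd : ∀ n ∈ {n | jumpTime ω n ≤ t}, n < N := fun n hn =>
      hmono.lt_iff_lt.1 (lt_of_le_of_lt hn htN)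
    have hmem : sSup {n | jumpTime ω n ≤ t} ∈ {n | jumpTime ω n ≤ t} :=
      Nat.sSup_mem ⟨0, by simp [jumpTime]⟩ ⟨N, fun n hn => (hbdd n hn).le⟩
    exact hlt _ (hbdd _ hmem) ht

/-- Let `s n` be the mean of `g` at visit `n` and `e n` the mean holding time of that visit, both
before absorption. The equation for `g` says `s n = e n + s (n + 1)`. Telescoping gives the claim
once `s n` tends to 0, which the convergence of the series of the `e n` provides. -/
theorem meanHittingTime_eq (A : Set V) (g : V → ℝ) (hg : ∀ y, 0 ≤ g y) (hgA : ∀ y ∈ A, g y = 0)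
    (heq : ∀ y ∉ A, ∑ z, (c y z : ℝ) * (g y - g z) = 1) (x : V) :
    meanHittingTime c x A = ENNReal.ofReal (g x) := by
  classical
  set G : V → ℝ≥0∞ := fun y => ENNReal.ofReal (g y) with hGdef
  set u : V → ℝ≥0∞ := fun y => ENNReal.ofReal (holdingRate c y)⁻¹ with hudef
  set T : V × ℝ → ℝ≥0∞ := fun z => if z.1 ∈ A then 0 else ENNReal.ofReal z.2 with hTdef
  have hA : MeasurableSet A := MeasurableSet.of_discrete
  have hTm : Measurable T := Measurable.ite (hA.preimage measurable_fst) measurable_const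
    (ENNReal.measurable_ofReal.comp measurable_snd)
  have hGm : Measurable fun z : V × ℝ => G z.1 := measurable_of_fst G
  have hTv : ∀ y, visitMean c T y = if y ∈ A then 0 else u y := by
    intro y
    by_cases hy : y ∈ A
    · simp [visitMean, hTdef, hy]
    · simp only [visitMean, hTdef, hy, if_false]
      exact lintegral_ofReal_expMeasure (holdingRate_pos c y)
  have hstep : ∀ y ∉ A, G y = u y + jumpMean c G y := by
    intro y hy
    have h1 := heq y hy
    -- The equation itself excludes absorbing states outside `A`: its left side would vanish.
    have hr : exitRate c y ≠ 0 := by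
      intro h0
      have : ∀ z, c y z = 0 := fun z =>
        Finset.sum_eq_zero_iff.1 h0 z (Finset.mem_univ z)
      simp [this] at h1
    have hrpos : (0 : ℝ) < exitRate c y := NNReal.coe_pos.2 (pos_iff_ne_zero.2 hr)
    have hJ : ∀ z, jumpLaw c y z = ENNReal.ofReal ((c y z : ℝ) / exitRate c y) := by
      intro z
      rw [jumpLaw, dif_neg hr, PMF.normalize_apply, tsum_fintype, ← ENNReal.ofNNReal_finsetSum,
        ENNReal.ofReal_div_of_pos hrpos, ENNReal.ofReal_coe_nnreal, ENNReal.ofReal_coe_nnreal,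
        div_eq_mul_inv]
      rfl
    have hu : u y = ENNReal.ofReal (exitRate c y : ℝ)⁻¹ := by
      simp only [hudef, holdingRate, if_neg hr]
    have hjm : jumpMean c G y = ENNReal.ofReal (∑ z, g z * ((c y z : ℝ) / exitRate c y)) := by
      rw [jumpMean, ENNReal.ofReal_sum_of_nonneg
        (fun z _ => mul_nonneg (hg z) (div_nonneg (NNReal.coe_nonneg _) hrpos.le))]
      refine Finset.sum_congr rfl fun z _ => ?_
      rw [hJ, ENNReal.ofReal_mul (hg z)]
    rw [hu, hjm, ← ENNReal.ofReal_add (by positivity)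
      (Finset.sum_nonneg fun z _ =>
        mul_nonneg (hg z) (div_nonneg (NNReal.coe_nonneg _) hrpos.le))]
    simp only [hGdef]
    congr 1
    have h2 : (exitRate c y : ℝ) = ∑ z, (c y z : ℝ) := by simp [exitRate]
    have h3 : (exitRate c y : ℝ) * g y - ∑ z, g z * (c y z : ℝ) = 1 := by
      rw [← h1, h2, Finset.sum_mul, ← Finset.sum_sub_distrib]
      exact Finset.sum_congr rfl fun z _ => by ring
    simp_rw [mul_div_assoc']
    rw [← Finset.sum_div]
    field_simp
    linarith
  set e : ℕ → ℝ≥0∞ := fun n => killedMean c x A n T with hedef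
  set s : ℕ → ℝ≥0∞ := fun n => killedMean c x A n (fun z => G z.1) with hsdef
  have hs0 : s 0 = G x := by
    simp only [hsdef]
    rw [killedMean_zero c x A hGm, visitMean_fst]
  have hv : visitMean c (fun z => G z.1) = G := funext fun y => visitMean_fst c G y
  have hss : ∀ n, s n = e n + s (n + 1) := by
    intro n
    have hK : Measurable fun z : V × ℝ =>
        if z.1 ∈ A then 0 else jumpMean c (visitMean c (fun z => G z.1)) z.1 :=
      measurable_of_fst fun y => if y ∈ A then 0 else jumpMean c (visitMean c (fun z => G z.1)) y
    have h1 : killedMean c x A n (fun z => G z.1) = killedMean c x A n (fun z => T z +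
        if z.1 ∈ A then 0 else jumpMean c (visitMean c (fun z => G z.1)) z.1) := by
      refine killedMean_congr c x A n hGm (hTm.add hK) fun y => ?_
      rw [visitMean_add c hTm, hTv, visitMean_fst c G, visitMean_fst c
        (fun y => if y ∈ A then 0 else jumpMean c (visitMean c (fun z => G z.1)) y), hv]
      by_cases hy : y ∈ A
      · simp [hy, hGdef, hgA]
      · simp only [hy, if_false]
        exact hstep y hy
    simp only [hsdef, hedef]
    rw [h1, killedMean_succ c x A n hGm, killedMean_add c x A n hTm]
  have hsum : ∀ n, ∑ k ∈ Finset.range n, e k + s n = G x := by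
    intro n
    induction n with
    | zero => simp [hs0]
    | succ n ih => rw [Finset.sum_range_succ, add_assoc, ← hss, ih]
  have htsum : ∑' n, e n ≤ G x := by
    rw [ENNReal.tsum_eq_iSup_nat]
    exact iSup_le fun n => (hsum n) ▸ le_self_add
  have hGx : G x ≠ ⊤ := ENNReal.ofReal_ne_top
  have he0 : Tendsto e atTop (𝓝 0) := by
    have := ENNReal.tendsto_atTop_zero_of_tsum_ne_top (ne_top_of_le_ne_top hGx htsum)
    exact this
  -- On a finite state space a function vanishing on `A` is dominated by a multiple of the mean
  -- holding time off `A`, so its killed mean is at most `C * e n`. Applied to `G` it kills the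
  -- remainder; applied to the indicator of the complement of `A` it shows that `A` is hit almost
  -- surely.
  have hbound : ∀ ψ : V → ℝ≥0∞, (∀ y, ψ y ≠ ⊤) → (∀ y ∈ A, ψ y = 0) →
      Tendsto (fun n => killedMean c x A n (fun z => ψ z.1)) atTop (𝓝 0) := by
    intro ψ hψ hψA
    set C : ℝ≥0∞ := ∑ y, ψ y * ENNReal.ofReal (holdingRate c y) with hC
    have hCtop : C ≠ ⊤ := ENNReal.sum_ne_top.2 fun y _ =>
      ENNReal.mul_ne_top (hψ y) ENNReal.ofReal_ne_top
    have hle : ∀ n, killedMean c x A n (fun z => ψ z.1) ≤ C * e n := by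
      intro n
      have h1 : e n = killedMean c x A n (fun z => if z.1 ∈ A then 0 else u z.1) := by
        refine killedMean_congr c x A n hTm
          (measurable_of_fst fun y => if y ∈ A then 0 else u y) fun y => ?_
        rw [hTv, visitMean_fst c (fun y => if y ∈ A then 0 else u y)]
      have h2 : C * e n = killedMean c x A n (fun z => C * if z.1 ∈ A then 0 else u z.1) := by
        rw [h1, ← killedMean_const_mul c x A n
          (measurable_of_fst fun y => if y ∈ A then 0 else u y)]
      rw [h2]
      refine killedMean_mono c x A n fun z => ?_
      by_cases hz : z.1 ∈ A
      · simp [hz, hψA]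
      · rw [if_neg hz]
        have hr := holdingRate_pos c z.1
        calc ψ z.1 = ψ z.1 * ENNReal.ofReal (holdingRate c z.1) * u z.1 := by
              simp only [hudef]
              rw [mul_assoc, ← ENNReal.ofReal_mul hr.le, mul_inv_cancel₀ hr.ne']
              simp
          _ ≤ C * u z.1 := by
              refine mul_le_mul_left ?_ _
              exact Finset.single_le_sum (f := fun y => ψ y * ENNReal.ofReal (holdingRate c y))
                (fun _ _ => zero_le) (Finset.mem_univ z.1)
    have h0 : Tendsto (fun n => C * e n) atTop (𝓝 0) := by
      simpa using ENNReal.Tendsto.const_mul he0 (Or.inr hCtop)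
    exact tendsto_of_tendsto_of_tendsto_of_le_of_le tendsto_const_nhds h0 (fun _ => zero_le) hle
  have hsn : Tendsto s atTop (𝓝 0) :=
    hbound G (fun _ => ENNReal.ofReal_ne_top) fun y hy => by simp [hGdef, hgA y hy]
  have htot : ∑' n, e n = G x := by
    have h1 : Tendsto (fun n => ∑ k ∈ Finset.range n, e k + s n) atTop (𝓝 (∑' n, e n + 0)) :=
      (ENNReal.tendsto_nat_tsum e).add hsn
    simp only [hsum, add_zero] at h1
    exact (tendsto_nhds_unique h1 tendsto_const_nhds)
  have hhit : ∀ᵐ ω ∂law c x, ∃ n, (ω n).1 ∈ A := by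
    have h1 := hbound (fun y => if y ∈ A then 0 else 1) (by intro y; split_ifs <;> simp)
      (fun y hy => by simp [hy])
    rw [ae_iff]
    refine le_antisymm (ge_of_tendsto' h1 fun n => ?_) zero_le
    have hm : MeasurableSet {ω : ℕ → V × ℝ | ¬ ∃ n, (ω n).1 ∈ A} := by
      simp only [not_exists]
      rw [Set.ofPred_forall]
      exact MeasurableSet.iInter fun k => (hA.compl).preimage (by fun_prop)
    rw [← lintegral_indicator_one hm]
    refine lintegral_mono fun ω => ?_
    by_cases hω : ∃ n, (ω n).1 ∈ A
    · rw [Set.indicator_of_notMem (by simpa using hω)]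
      exact zero_le
    · have hω' : ∀ n, (ω n).1 ∉ A := not_exists.1 hω
      simp [Set.indicator, hω']
  rw [meanHittingTime]
  have h1 : ∫⁻ ω, hittingTime A ω ∂law c x = ∫⁻ ω, ∑' n,
      (if ∀ k < n, (ω k).1 ∉ A then 1 else 0) * T (ω n) ∂law c x := by
    refine lintegral_congr_ae ?_
    filter_upwards [ae_holding_pos c x, hhit] with ω h1 h2
    exact hittingTime_eq A h1 h2
  rw [h1, lintegral_tsum fun n => (measurable_killed A n hTm).aemeasurable]
  exact htot

end MarkovChain

/-! ### Reversible networks on a finite set -/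

namespace Network

variable {V : Type*} [Fintype V]

/-- Dirichlet form of the conductances `w`. -/
def form (w : V → V → ℝ) (f g : V → ℝ) : ℝ :=
  (1 / 2) * ∑ x, ∑ y, w x y * ((f x - f y) * (g x - g y))

/-- Generator of the conductances `w`, with the sign that makes it nonnegative. -/
def lap (w : V → V → ℝ) (f : V → ℝ) (x : V) : ℝ := ∑ y, w x y * (f x - f y)

lemma form_comm (w : V → V → ℝ) (f g : V → ℝ) : form w f g = form w g f := by
  unfold form
  simp_rw [mul_comm (f _ - f _)]

lemma form_add_left (w : V → V → ℝ) (f f' g : V → ℝ) :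
    form w (f + f') g = form w f g + form w f' g := by
  unfold form
  rw [← mul_add, ← Finset.sum_add_distrib]
  simp_rw [← Finset.sum_add_distrib, Pi.add_apply]
  congr 1
  exact Finset.sum_congr rfl fun x _ => Finset.sum_congr rfl fun y _ => by ring

lemma form_smul_left (w : V → V → ℝ) (a : ℝ) (f g : V → ℝ) :
    form w (a • f) g = a * form w f g := by
  unfold form
  rw [mul_left_comm, Finset.mul_sum]
  simp_rw [Finset.mul_sum, Pi.smul_apply, smul_eq_mul]
  exact Finset.sum_congr rfl fun x _ => Finset.sum_congr rfl fun y _ => by ring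

lemma form_sub_left (w : V → V → ℝ) (f f' g : V → ℝ) :
    form w (f - f') g = form w f g - form w f' g := by
  have := form_add_left w (f - f') f' g
  rw [sub_add_cancel] at this
  linarith

lemma form_sub_right (w : V → V → ℝ) (f g g' : V → ℝ) :
    form w f (g - g') = form w f g - form w f g' := by
  rw [form_comm, form_sub_left, form_comm w g, form_comm w g']

lemma form_self_nonneg {w : V → V → ℝ} (hnn : ∀ x y, 0 ≤ w x y) (f : V → ℝ) :
    0 ≤ form w f f :=
  mul_nonneg (by norm_num) (Finset.sum_nonneg fun x _ => Finset.sum_nonneg fun y _ =>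
    mul_nonneg (hnn x y) (mul_self_nonneg _))

lemma form_le_form {w w' : V → V → ℝ} {f g : V → ℝ}
    (h : ∀ x y, w x y * ((f x - f y) * (f x - f y)) ≤ w' x y * ((g x - g y) * (g x - g y))) :
    form w f f ≤ form w' g g :=
  mul_le_mul_of_nonneg_left (Finset.sum_le_sum fun x _ => Finset.sum_le_sum fun y _ => h x y)
    (by norm_num)

/-- Summation by parts: average the double sum with its copy under exchange of `x` and `y`. -/
lemma sum_mul_lap {w : V → V → ℝ} (hsymm : ∀ x y, w x y = w y x) (f g : V → ℝ) :
    ∑ x, g x * lap w f x = form w f g := by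
  have h1 : ∑ x, g x * lap w f x = ∑ x, ∑ y, w x y * ((f x - f y) * g x) := by
    refine Finset.sum_congr rfl fun x _ => ?_
    rw [lap, Finset.mul_sum]
    exact Finset.sum_congr rfl fun y _ => by ring
  have h2 : ∑ x, g x * lap w f x = ∑ x, ∑ y, w x y * ((f x - f y) * (-g y)) := by
    rw [h1, Finset.sum_comm]
    refine Finset.sum_congr rfl fun x _ => Finset.sum_congr rfl fun y _ => ?_
    rw [hsymm y x]
    ring
  have h3 : ∑ x, ∑ y, w x y * ((f x - f y) * (g x - g y))
      = ∑ x, g x * lap w f x + ∑ x, g x * lap w f x := by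
    nth_rewrite 1 [h1]
    rw [h2, ← Finset.sum_add_distrib]
    refine Finset.sum_congr rfl fun x _ => ?_
    rw [← Finset.sum_add_distrib]
    exact Finset.sum_congr rfl fun y _ => by ring
  rw [form, h3]
  ring

lemma sum_lap {w : V → V → ℝ} (hsymm : ∀ x y, w x y = w y x) (f : V → ℝ) :
    ∑ x, lap w f x = 0 := by
  have := sum_mul_lap hsymm f (fun _ => 1)
  simpa [form] using this

lemma eq_of_form_self_nonpos {w : V → V → ℝ} (hnn : ∀ x y, 0 ≤ w x y)
    (hconn : ∀ x y, Relation.ReflTransGen (fun a b => 0 < w a b) x y) {f : V → ℝ}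
    (h : form w f f ≤ 0) (x y : V) : f x = f y := by
  have h0 : ∑ x, ∑ y, w x y * ((f x - f y) * (f x - f y)) = 0 := by
    refine le_antisymm ?_ (Finset.sum_nonneg fun x _ => Finset.sum_nonneg fun y _ =>
      mul_nonneg (hnn x y) (mul_self_nonneg _))
    unfold form at h
    linarith
  have h1 : ∀ x y, w x y * ((f x - f y) * (f x - f y)) = 0 := by
    intro x y
    have hx := (Finset.sum_eq_zero_iff_of_nonneg fun x _ => Finset.sum_nonneg fun y _ =>
      mul_nonneg (hnn x y) (mul_self_nonneg _)).1 h0 x (Finset.mem_univ x)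
    exact (Finset.sum_eq_zero_iff_of_nonneg fun y _ =>
      mul_nonneg (hnn x y) (mul_self_nonneg _)).1 hx y (Finset.mem_univ y)
  induction hconn x y with
  | refl => rfl
  | tail _ hbc ih =>
    rw [ih]
    rcases mul_eq_zero.1 (h1 _ _) with h | h
    · exact absurd h hbc.ne'
    · exact sub_eq_zero.1 (mul_self_eq_zero.1 h)

/-- Minimum principle through the negative part `n`. Pairing `lap w h` with `n` gives a nonnegative
number, yet it is at most minus the energy of `n`. So `n` has no energy, is constant by
connectedness, and vanishes on `A`. -/
lemma nonneg_of_lap_nonneg {w : V → V → ℝ} (hsymm : ∀ x y, w x y = w y x)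
    (hnn : ∀ x y, 0 ≤ w x y)
    (hconn : ∀ x y, Relation.ReflTransGen (fun a b => 0 < w a b) x y) {A : Set V}
    (hA : A.Nonempty) {h : V → ℝ} (hhA : ∀ x ∈ A, 0 ≤ h x) (hL : ∀ x ∉ A, 0 ≤ lap w h x) (x : V) :
    0 ≤ h x := by
  set n : V → ℝ := fun x => max (-h x) 0 with hn
  have h1 : 0 ≤ form w h n := by
    rw [← sum_mul_lap hsymm]
    refine Finset.sum_nonneg fun x _ => ?_
    by_cases hx : x ∈ A
    · have : n x = 0 := max_eq_right (neg_nonpos.2 (hhA x hx))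
      simp [this]
    · exact mul_nonneg (le_max_right _ _) (hL x hx)
  have h2 : form w h n ≤ - form w n n := by
    unfold form
    rw [← mul_neg, ← Finset.sum_neg_distrib]
    refine mul_le_mul_of_nonneg_left (Finset.sum_le_sum fun x _ => ?_) (by norm_num)
    rw [← Finset.sum_neg_distrib]
    refine Finset.sum_le_sum fun y _ => ?_
    rw [← mul_neg]
    refine mul_le_mul_of_nonneg_left ?_ (hnn x y)
    simp only [hn]
    rcases max_cases (-h x) 0 with ⟨e1, _⟩ | ⟨e1, _⟩ <;>
      rcases max_cases (-h y) 0 with ⟨e2, _⟩ | ⟨e2, _⟩ <;> rw [e1, e2] <;> nlinarith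
  obtain ⟨z, hz⟩ := hA
  have h3 := eq_of_form_self_nonpos hnn hconn (f := n) (by linarith) x z
  have h4 : n z = 0 := max_eq_right (neg_nonpos.2 (hhA z hz))
  have h5 : -h x ≤ n x := le_max_left _ _
  linarith

open Classical in
-- The boundary value problem is a square linear system, so uniqueness, from the energy identity,
-- already yields existence.
lemma exists_lap_eq {w : V → V → ℝ} (hsymm : ∀ x y, w x y = w y x)
    (hnn : ∀ x y, 0 ≤ w x y)
    (hconn : ∀ x y, Relation.ReflTransGen (fun a b => 0 < w a b) x y) {A : Set V}
    (hA : A.Nonempty) (b m : V → ℝ) :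
    ∃ h : V → ℝ, (∀ x ∈ A, h x = b x) ∧ ∀ x ∉ A, lap w h x = m x := by
  let T : (V → ℝ) →ₗ[ℝ] (V → ℝ) :=
    { toFun := fun h x => if x ∈ A then h x else lap w h x
      map_add' := by
        intro f g
        ext x
        simp only [Pi.add_apply]
        split_ifs
        · rfl
        · simp only [lap, ← Finset.sum_add_distrib, Pi.add_apply]
          exact Finset.sum_congr rfl fun y _ => by ring
      map_smul' := by
        intro a f
        ext x
        simp only [Pi.smul_apply, smul_eq_mul, RingHom.id_apply]
        split_ifs
        · rfl
        · simp only [lap, Finset.mul_sum, Pi.smul_apply, smul_eq_mul]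
          exact Finset.sum_congr rfl fun y _ => by ring }
  have hT : ∀ h x, T h x = if x ∈ A then h x else lap w h x := fun _ _ => rfl
  have hinj : Function.Injective T := by
    rw [← LinearMap.ker_eq_bot, LinearMap.ker_eq_bot']
    intro h hh
    have e : ∀ x, T h x = 0 := fun x => congrFun hh x
    have e1 : ∀ x ∈ A, h x = 0 := fun x hx => by simpa [hT, hx] using e x
    have e2 : ∀ x ∉ A, lap w h x = 0 := fun x hx => by simpa [hT, hx] using e x
    have e3 : form w h h = 0 := by
      rw [← sum_mul_lap hsymm]
      refine Finset.sum_eq_zero fun x _ => ?_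
      by_cases hx : x ∈ A
      · simp [e1 x hx]
      · simp [e2 x hx]
    obtain ⟨z, hz⟩ := hA
    ext x
    rw [eq_of_form_self_nonpos hnn hconn e3.le x z, e1 z hz]
    rfl
  obtain ⟨h, hh⟩ := (LinearMap.injective_iff_surjective.1 hinj) fun x => if x ∈ A then b x else m x
  have e : ∀ x, T h x = if x ∈ A then b x else m x := fun x => congrFun hh x
  refine ⟨h, fun x hx => ?_, fun x hx => ?_⟩
  · simpa [hT, hx] using e x
  · simpa [hT, hx] using e x

lemma lap_sub (w : V → V → ℝ) (f g : V → ℝ) (x : V) :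
    lap w (fun y => f y - g y) x = lap w f x - lap w g x := by
  simp only [lap, ← Finset.sum_sub_distrib]
  exact Finset.sum_congr rfl fun y _ => by ring

lemma eq_of_lap_eq {w : V → V → ℝ} (hsymm : ∀ x y, w x y = w y x)
    (hnn : ∀ x y, 0 ≤ w x y)
    (hconn : ∀ x y, Relation.ReflTransGen (fun a b => 0 < w a b) x y) {A : Set V}
    (hA : A.Nonempty) {f g : V → ℝ} (hfg : ∀ x ∈ A, f x = g x)
    (hL : ∀ x ∉ A, lap w f x = lap w g x) : f = g := by
  ext x
  have h1 := nonneg_of_lap_nonneg hsymm hnn hconn hA (h := fun y => f y - g y)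
    (fun x hx => by simp [hfg x hx]) (fun x hx => by rw [lap_sub, hL x hx, sub_self]) x
  have h2 := nonneg_of_lap_nonneg hsymm hnn hconn hA (h := fun y => g y - f y)
    (fun x hx => by simp [hfg x hx]) (fun x hx => by rw [lap_sub, hL x hx, sub_self]) x
  linarith

/-- Dirichlet principle: harmonic functions minimise the energy. -/
lemma form_le_of_lap_eq_zero {w : V → V → ℝ} (hsymm : ∀ x y, w x y = w y x)
    (hnn : ∀ x y, 0 ≤ w x y) {A : Set V} {u f : V → ℝ}
    (hfu : ∀ x ∈ A, f x = u x) (hL : ∀ x ∉ A, lap w u x = 0) :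
    form w u u ≤ form w f f := by
  have h1 : form w u (f - u) = 0 := by
    rw [← sum_mul_lap hsymm]
    refine Finset.sum_eq_zero fun x _ => ?_
    by_cases hx : x ∈ A
    · simp [hfu x hx]
    · simp [hL x hx]
  have h2 := form_self_nonneg hnn (f - u)
  rw [form_sub_left, form_sub_right] at h2
  rw [form_sub_right] at h1
  rw [form_sub_right, form_comm w f u] at h2
  linarith

end Network

/-! ### Energy landscapes with three symmetric ground states -/

/-- A finite energy landscape `lo - mid - hi` with an involutive symmetry exchanging `lo` and `hi`,
together with a reference energy level `barrier`. -/
structure Landscape (V : Type*) where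
  adj : V → V → Prop
  adj_symm : ∀ x y, adj x y → adj y x
  conn : ∀ x y, Relation.ReflTransGen adj x y
  H : V → ℤ
  barrier : ℤ
  neg : V → V
  neg_neg : ∀ x, neg (neg x) = x
  adj_neg : ∀ x y, adj x y → adj (neg x) (neg y)
  H_neg : ∀ x, H (neg x) = H x
  lo : V
  mid : V
  hi : V
  neg_lo : neg lo = hi
  neg_mid : neg mid = mid
  lo_ne_mid : lo ≠ mid
  lo_ne_hi : lo ≠ hi
  H_lo : H lo = 0
  H_mid : H mid = 0
  H_pos : ∀ x, x ≠ lo → x ≠ mid → x ≠ hi → 0 < H x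

namespace Landscape

open Network

variable {V : Type*} [Fintype V] (S : Landscape V)

/-- Height of an edge. -/
def lev (x y : V) : ℤ := max (S.H x) (S.H y)

open Classical in
/-- Conductances, rescaled by `exp (β * barrier)`. -/
def W (β : ℝ) (x y : V) : ℝ :=
  if S.adj x y then Real.exp (β * ((S.barrier : ℝ) - S.lev x y)) else 0

/-- The ground states. -/
def ground : Set V := {S.lo, S.mid, S.hi}

lemma lev_comm (x y : V) : S.lev x y = S.lev y x := max_comm _ _

lemma W_symm (β : ℝ) (x y : V) : S.W β x y = S.W β y x := by
  unfold W
  rw [S.lev_comm x y]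
  by_cases h : S.adj x y
  · rw [if_pos h, if_pos (S.adj_symm _ _ h)]
  · rw [if_neg h, if_neg fun h' => h (S.adj_symm _ _ h')]

lemma W_nonneg (β : ℝ) (x y : V) : 0 ≤ S.W β x y := by
  unfold W; split_ifs <;> positivity

lemma W_conn (β : ℝ) (x y : V) : Relation.ReflTransGen (fun a b => 0 < S.W β a b) x y := by
  refine Relation.ReflTransGen.mono (fun a b hab => ?_) _ _ (S.conn x y)
  simp only [W, if_pos hab]
  positivity

lemma lev_neg (x y : V) : S.lev (S.neg x) (S.neg y) = S.lev x y := by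
  simp only [lev, S.H_neg]

lemma adj_neg_iff (x y : V) : S.adj (S.neg x) (S.neg y) ↔ S.adj x y :=
  ⟨fun h => by simpa only [S.neg_neg] using S.adj_neg _ _ h, S.adj_neg x y⟩

lemma W_neg (β : ℝ) (x y : V) : S.W β (S.neg x) (S.neg y) = S.W β x y := by
  unfold W
  rw [S.lev_neg]
  by_cases h : S.adj x y
  · rw [if_pos h, if_pos (S.adj_neg _ _ h)]
  · rw [if_neg h, if_neg fun h' => h ((S.adj_neg_iff x y).1 h')]

lemma neg_hi : S.neg S.hi = S.lo := by rw [← S.neg_lo, S.neg_neg]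

lemma hi_ne_mid : S.hi ≠ S.mid := fun h => S.lo_ne_mid (by
  rw [← S.neg_hi, h, S.neg_mid])

lemma H_hi : S.H S.hi = 0 := by rw [← S.neg_lo, S.H_neg, S.H_lo]

/-- The symmetry as a permutation. -/
def negPerm : Equiv.Perm V := Function.Involutive.toPerm S.neg S.neg_neg

lemma sum_neg (F : V → ℝ) : ∑ x, F (S.neg x) = ∑ x, F x :=
  Equiv.sum_comp S.negPerm F

lemma lap_neg (β : ℝ) (f : V → ℝ) (x : V) :
    lap (S.W β) (fun y => f (S.neg y)) x = lap (S.W β) f (S.neg x) := by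
  unfold lap
  rw [← S.sum_neg]
  refine Finset.sum_congr rfl fun y _ => ?_
  rw [← S.W_neg]
  simp only [S.neg_neg]

lemma form_neg (β : ℝ) (f g : V → ℝ) :
    form (S.W β) (fun y => f (S.neg y)) (fun y => g (S.neg y)) = form (S.W β) f g := by
  unfold form
  congr 1
  rw [← S.sum_neg fun x => ∑ y, S.W β x y * ((f x - f y) * (g x - g y))]
  refine Finset.sum_congr rfl fun x _ => ?_
  rw [← S.sum_neg fun y => S.W β (S.neg x) y * ((f (S.neg x) - f y) * (g (S.neg x) - g y))]
  exact Finset.sum_congr rfl fun y _ => by rw [S.W_neg]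

lemma neg_mem_ground (x : V) : S.neg x ∈ S.ground ↔ x ∈ S.ground := by
  have e : ∀ y, S.neg x = y ↔ x = S.neg y := fun y =>
    ⟨fun h => by rw [← h, S.neg_neg], fun h => by rw [h, S.neg_neg]⟩
  simp only [ground, Set.mem_insert_iff, Set.mem_singleton_iff, e, S.neg_lo, S.neg_mid, S.neg_hi]
  tauto

lemma sum_eq_ground (F : V → ℝ) (hF : ∀ x ∉ S.ground, F x = 0) :
    ∑ x, F x = F S.lo + F S.mid + F S.hi := by
  classical
  rw [← Finset.sum_subset (Finset.subset_univ {S.lo, S.mid, S.hi})]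
  · rw [Finset.sum_insert, Finset.sum_insert, Finset.sum_singleton, add_assoc]
    · simpa using S.hi_ne_mid.symm
    · simpa using ⟨S.lo_ne_mid, S.lo_ne_hi⟩
  · intro x _ hx
    refine hF x ?_
    simpa [ground] using hx

/-- Boundary data of the equilibrium potential of `lo`. -/
def IsPot (f : V → ℝ) : Prop := f S.lo = 1 ∧ f S.mid = 0 ∧ f S.hi = 0

lemma exists_pot (β : ℝ) : ∃ f : V → ℝ, S.IsPot f ∧ ∀ x ∉ S.ground, lap (S.W β) f x = 0 := by
  classical
  obtain ⟨f, h1, h2⟩ := exists_lap_eq (S.W_symm β) (S.W_nonneg β) (S.W_conn β)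
    (A := S.ground) ⟨S.lo, by simp [ground]⟩ (fun x => if x = S.lo then 1 else 0) (fun _ => 0)
  refine ⟨f, ⟨?_, ?_, ?_⟩, h2⟩
  · rw [h1 _ (by simp [ground])]; simp
  · rw [h1 _ (by simp [ground])]; simp [S.lo_ne_mid.symm]
  · rw [h1 _ (by simp [ground])]; simp [S.lo_ne_hi.symm]

/-- Equilibrium potential: `1` at `lo`, `0` at `mid` and `hi`, harmonic elsewhere. -/
def pot (β : ℝ) : V → ℝ := (S.exists_pot β).choose

lemma pot_isPot (β : ℝ) : S.IsPot (S.pot β) := (S.exists_pot β).choose_spec.1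

lemma lap_pot (β : ℝ) : ∀ x ∉ S.ground, lap (S.W β) (S.pot β) x = 0 :=
  (S.exists_pot β).choose_spec.2

lemma forall_ground {P : V → Prop} (h1 : P S.lo) (h2 : P S.mid) (h3 : P S.hi) :
    ∀ x ∈ S.ground, P x := by
  rintro x (rfl | rfl | rfl) <;> assumption

lemma pot_nonneg (β : ℝ) (x : V) : 0 ≤ S.pot β x := by
  obtain ⟨h1, h2, h3⟩ := S.pot_isPot β
  refine nonneg_of_lap_nonneg (S.W_symm β) (S.W_nonneg β) (S.W_conn β)
    (A := S.ground) ⟨S.lo, by simp [ground]⟩ (S.forall_ground ?_ ?_ ?_)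
    (fun x hx => (S.lap_pot β x hx).ge) x
  · rw [h1]; norm_num
  · rw [h2]
  · rw [h3]

/-- Capacity between `lo` and `{mid, hi}`, rescaled. -/
def cap (β : ℝ) : ℝ := form (S.W β) (S.pot β) (S.pot β)

/-- Effective conductance between `lo` and `hi`, rescaled. -/
def cross (β : ℝ) : ℝ := - form (S.W β) (S.pot β) (fun x => S.pot β (S.neg x))

lemma lap_pot_lo (β : ℝ) : lap (S.W β) (S.pot β) S.lo = S.cap β := by
  obtain ⟨h1, h2, h3⟩ := S.pot_isPot β
  rw [cap, ← sum_mul_lap (S.W_symm β), S.sum_eq_ground _ fun x hx => by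
    rw [S.lap_pot β x hx, mul_zero], h1, h2, h3]
  ring

lemma lap_pot_hi (β : ℝ) : lap (S.W β) (S.pot β) S.hi = - S.cross β := by
  obtain ⟨h1, h2, h3⟩ := S.pot_isPot β
  rw [cross, ← sum_mul_lap (S.W_symm β), S.sum_eq_ground _ fun x hx => by
    rw [S.lap_pot β x hx, mul_zero], S.neg_lo, S.neg_mid, S.neg_hi, h1, h2, h3]
  ring

lemma lap_pot_mid (β : ℝ) : lap (S.W β) (S.pot β) S.mid = S.cross β - S.cap β := by
  have h := sum_lap (S.W_symm β) (S.pot β)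
  rw [S.sum_eq_ground _ (S.lap_pot β), S.lap_pot_lo, S.lap_pot_hi] at h
  linarith

/-- The potential is harmonic off the ground states, so only the fluxes there survive. The network
thereby reduces to a triangle: conductance `cross` between `lo` and `hi`, and `cap - cross` on the
two sides meeting at `mid`. -/
lemma form_pot (β : ℝ) (h : V → ℝ) : form (S.W β) h (S.pot β) =
    S.cap β * h S.lo - S.cross β * h S.hi - (S.cap β - S.cross β) * h S.mid := by
  rw [form_comm, ← sum_mul_lap (S.W_symm β), S.sum_eq_ground _ fun x hx => by
    rw [S.lap_pot β x hx, mul_zero], S.lap_pot_lo, S.lap_pot_hi, S.lap_pot_mid]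
  ring

lemma form_pot_neg (β : ℝ) (h : V → ℝ) : form (S.W β) h (fun x => S.pot β (S.neg x)) =
    S.cap β * h S.hi - S.cross β * h S.lo - (S.cap β - S.cross β) * h S.mid := by
  have := S.form_pot β (fun x => h (S.neg x))
  rw [S.neg_lo, S.neg_hi, S.neg_mid] at this
  rw [← this, ← S.form_neg]
  simp only [S.neg_neg]

lemma cross_nonneg (β : ℝ) : 0 ≤ S.cross β := by
  have h := S.lap_pot_hi β
  have h1 : lap (S.W β) (S.pot β) S.hi ≤ 0 := by
    refine Finset.sum_nonpos fun y _ => ?_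
    rw [(S.pot_isPot β).2.2]
    have := mul_nonneg (S.W_nonneg β S.hi y) (S.pot_nonneg β y)
    linarith
  linarith

/-- One minus the two potentials is harmonic with boundary values 0, 1, 0: it is the equilibrium
potential of `mid`, hence nonnegative. -/
lemma pot_add_pot_neg_le (β : ℝ) (x : V) : S.pot β x + S.pot β (S.neg x) ≤ 1 := by
  obtain ⟨h1, h2, h3⟩ := S.pot_isPot β
  have h := nonneg_of_lap_nonneg (S.W_symm β) (S.W_nonneg β) (S.W_conn β)
    (A := S.ground) ⟨S.lo, by simp [ground]⟩
    (h := fun x => (1 - S.pot β x) - S.pot β (S.neg x)) ?_ ?_ x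
  · linarith
  · refine S.forall_ground ?_ ?_ ?_
    · simp [S.neg_lo, h1, h3]
    · simp [S.neg_mid, h2]
    · simp [S.neg_hi, h1, h3]
  · intro y hy
    rw [lap_sub, S.lap_neg, S.lap_pot β _ (by rwa [S.neg_mem_ground]),
      lap_sub (S.W β) (fun _ => 1), S.lap_pot β y hy]
    simp [lap]

lemma pot_le_one (β : ℝ) (x : V) : S.pot β x ≤ 1 := by
  have := S.pot_add_pot_neg_le β x
  have := S.pot_nonneg β (S.neg x)
  linarith

/-! #### Mean hitting times of sets of ground states -/

/-- Unnormalised Gibbs weights. -/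
def gibbs (β : ℝ) (x : V) : ℝ := Real.exp (-β * S.H x)

/-- Mean hitting time of `A`, rescaled by `exp (-β * barrier)`. -/
def IsMeanTime (β : ℝ) (A : Set V) (h : V → ℝ) : Prop :=
  (∀ x ∈ A, h x = 0) ∧ ∀ x ∉ A, lap (S.W β) h x = S.gibbs β x

lemma exists_isMeanTime (β : ℝ) {A : Set V} (hA : A.Nonempty) : ∃ h, S.IsMeanTime β A h :=
  exists_lap_eq (S.W_symm β) (S.W_nonneg β) (S.W_conn β) hA (fun _ => 0) _

lemma IsMeanTime.nonneg {S : Landscape V} {β : ℝ} {A : Set V} (hA : A.Nonempty) {h : V → ℝ}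
    (hh : S.IsMeanTime β A h) (x : V) : 0 ≤ h x :=
  nonneg_of_lap_nonneg (S.W_symm β) (S.W_nonneg β) (S.W_conn β) hA (fun x hx => (hh.1 x hx).ge)
    (fun x hx => by rw [hh.2 x hx]; exact (Real.exp_pos _).le) x

lemma IsMeanTime.neg {S : Landscape V} {β : ℝ} {A B : Set V} {h : V → ℝ}
    (hh : S.IsMeanTime β A h) (hAB : ∀ x, x ∈ B ↔ S.neg x ∈ A) :
    S.IsMeanTime β B (fun x => h (S.neg x)) := by
  refine ⟨fun x hx => hh.1 _ ((hAB x).1 hx), fun x hx => ?_⟩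
  rw [S.lap_neg, hh.2 _ (fun h' => hx ((hAB x).2 h')), gibbs, S.H_neg]
  rfl

lemma IsMeanTime.eq {S : Landscape V} {β : ℝ} {A : Set V} (hA : A.Nonempty) {h h' : V → ℝ}
    (hh : S.IsMeanTime β A h) (hh' : S.IsMeanTime β A h') : h = h' :=
  eq_of_lap_eq (S.W_symm β) (S.W_nonneg β) (S.W_conn β) hA
    (fun x hx => by rw [hh.1 x hx, hh'.1 x hx]) (fun x hx => by rw [hh.2 x hx, hh'.2 x hx])

/-- Gibbs mass of the equilibrium potential of `lo`. -/
def massLo (β : ℝ) : ℝ := ∑ x, S.pot β x * S.gibbs β x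

/-- Gibbs mass of the equilibrium potential of `mid`. -/
def massMid (β : ℝ) : ℝ := ∑ x, (1 - S.pot β x - S.pot β (S.neg x)) * S.gibbs β x

/-- This tests the Poisson equation against `g`; vanishing on `A`, where the equation fails, is what
is needed of `g`. -/
lemma IsMeanTime.sum_mul {S : Landscape V} {β : ℝ} {A : Set V} {h : V → ℝ}
    (hh : S.IsMeanTime β A h) {g : V → ℝ} (hg : ∀ x ∈ A, g x = 0) :
    ∑ x, g x * S.gibbs β x = form (S.W β) h g := by
  rw [← sum_mul_lap (S.W_symm β)]
  refine Finset.sum_congr rfl fun x _ => ?_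
  by_cases hx : x ∈ A
  · simp [hg x hx]
  · rw [hh.2 x hx]

lemma IsMeanTime.eq_lo {S : Landscape V} {β : ℝ} {A : Set V} {h : V → ℝ}
    (hh : S.IsMeanTime β A h) (hA : A ⊆ {S.mid, S.hi}) :
    S.massLo β = S.cap β * h S.lo - S.cross β * h S.hi - (S.cap β - S.cross β) * h S.mid := by
  rw [← S.form_pot, massLo]
  refine hh.sum_mul fun x hx => ?_
  rcases hA hx with rfl | rfl
  · exact (S.pot_isPot β).2.1
  · exact (S.pot_isPot β).2.2

lemma IsMeanTime.eq_hi {S : Landscape V} {β : ℝ} {A : Set V} {h : V → ℝ}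
    (hh : S.IsMeanTime β A h) (hA : A ⊆ {S.lo, S.mid}) :
    S.massLo β = S.cap β * h S.hi - S.cross β * h S.lo - (S.cap β - S.cross β) * h S.mid := by
  have h1 : S.massLo β = ∑ x, S.pot β (S.neg x) * S.gibbs β x := by
    rw [massLo, ← S.sum_neg]
    exact Finset.sum_congr rfl fun x _ => by rw [gibbs, gibbs, S.H_neg]
  rw [h1, ← S.form_pot_neg]
  refine hh.sum_mul fun x hx => ?_
  rcases hA hx with rfl | rfl
  · rw [S.neg_lo]; exact (S.pot_isPot β).2.2
  · rw [S.neg_mid]; exact (S.pot_isPot β).2.1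

lemma IsMeanTime.eq_mid {S : Landscape V} {β : ℝ} {A : Set V} {h : V → ℝ}
    (hh : S.IsMeanTime β A h) (hA : A ⊆ {S.lo, S.hi}) :
    S.massMid β = (S.cap β - S.cross β) * (2 * h S.mid - h S.lo - h S.hi) := by
  obtain ⟨h1, h2, h3⟩ := S.pot_isPot β
  have e := hh.sum_mul (g := (fun _ => 1) - S.pot β - (fun x => S.pot β (S.neg x))) (fun x hx => by
    rcases hA hx with rfl | rfl
    · simp [S.neg_lo, h1, h3]
    · simp [S.neg_hi, h1, h3])
  rw [form_sub_right, form_sub_right, S.form_pot, S.form_pot_neg] at e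
  have h0 : form (S.W β) h (fun _ => 1) = 0 := by simp [form]
  rw [h0] at e
  simp only [Pi.sub_apply] at e
  rw [massMid, e]
  ring

lemma tendsto_gibbs {x : V} (hx : x ∉ S.ground) : Tendsto (fun β => S.gibbs β x) atTop (𝓝 0) := by
  have h : 0 < S.H x := by
    simp only [ground, Set.mem_insert_iff, Set.mem_singleton_iff, not_or] at hx
    exact S.H_pos x hx.1 hx.2.1 hx.2.2
  have h' : (0 : ℝ) < S.H x := by exact_mod_cast h
  unfold gibbs
  refine Real.tendsto_exp_atBot.comp ?_
  simp only [neg_mul]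
  exact tendsto_neg_atTop_atBot.comp (tendsto_id.atTop_mul_const h')

/-- The Gibbs weight is 1 at the ground states and decays at every other point, so only the three
ground values survive. -/
lemma tendsto_sum_mul_gibbs {f : ℝ → V → ℝ} {c : ℝ} (h0 : ∀ β x, 0 ≤ f β x) (h1 : ∀ β x, f β x ≤ 1)
    (hc : ∀ β, f β S.lo + f β S.mid + f β S.hi = c) :
    Tendsto (fun β => ∑ x, f β x * S.gibbs β x) atTop (𝓝 c) := by
  classical
  have e : ∀ β, ∑ x, f β x * S.gibbs β x =
      (∑ x, if x ∈ S.ground then 0 else f β x * S.gibbs β x) + c := by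
    intro β
    have h2 : ∑ x, (if x ∈ S.ground then f β x * S.gibbs β x else 0) = c := by
      rw [S.sum_eq_ground _ fun x hx => if_neg hx, if_pos (by simp [ground]),
        if_pos (by simp [ground]), if_pos (by simp [ground]), ← hc β]
      simp [gibbs, S.H_lo, S.H_mid, S.H_hi]
    rw [← h2, ← Finset.sum_add_distrib]
    refine Finset.sum_congr rfl fun x _ => ?_
    split_ifs <;> simp
  simp_rw [e]
  have h3 : Tendsto (fun β => ∑ x, if x ∈ S.ground then 0 else f β x * S.gibbs β x) atTop
      (𝓝 (∑ _x : V, 0)) := by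
    refine tendsto_finsetSum _ fun x _ => ?_
    by_cases hx : x ∈ S.ground
    · simp [hx]
    · simp only [hx, if_false]
      refine tendsto_of_tendsto_of_tendsto_of_le_of_le tendsto_const_nhds (S.tendsto_gibbs hx)
        (fun β => mul_nonneg (h0 β x) (Real.exp_pos _).le) fun β => ?_
      exact mul_le_of_le_one_left (Real.exp_pos _).le (h1 β x)
  simpa using h3.add_const c

lemma tendsto_massLo : Tendsto S.massLo atTop (𝓝 1) := by
  refine S.tendsto_sum_mul_gibbs S.pot_nonneg S.pot_le_one fun β => ?_
  obtain ⟨h1, h2, h3⟩ := S.pot_isPot β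
  rw [h1, h2, h3]; norm_num

lemma tendsto_massMid : Tendsto S.massMid atTop (𝓝 1) := by
  refine S.tendsto_sum_mul_gibbs (fun β x => ?_) (fun β x => ?_) fun β => ?_
  · have := S.pot_add_pot_neg_le β x
    linarith
  · have := S.pot_nonneg β x
    have := S.pot_nonneg β (S.neg x)
    linarith
  · obtain ⟨h1, h2, h3⟩ := S.pot_isPot β
    rw [S.neg_lo, S.neg_mid, S.neg_hi, h1, h2, h3]; norm_num

/-! ### The limiting three-state walk. -/

section Asymptotics

variable {S} {C : ℝ} (hC : 0 < C) (hcap : Tendsto S.cap atTop (𝓝 C))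
  (hcross : Tendsto S.cross atTop (𝓝 0))
include hC hcap hcross

lemma tendsto_time_lo_mid_hi {h : ℝ → V → ℝ} (hh : ∀ β, S.IsMeanTime β {S.mid, S.hi} (h β)) :
    Tendsto (fun β => h β S.lo) atTop (𝓝 C⁻¹) := by
  have h1 : Tendsto (fun β => S.massLo β / S.cap β) atTop (𝓝 (1 / C)) :=
    S.tendsto_massLo.div hcap hC.ne'
  rw [one_div] at h1
  refine h1.congr' ?_
  filter_upwards [hcap.eventually_ne hC.ne'] with β hβ
  have e := (hh β).eq_lo (Set.Subset.refl _)
  rw [(hh β).1 S.mid (by simp), (hh β).1 S.hi (by simp)] at e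
  rw [e]
  field_simp
  ring

lemma tendsto_time_mid_lo_hi {h : ℝ → V → ℝ} (hh : ∀ β, S.IsMeanTime β {S.lo, S.hi} (h β)) :
    Tendsto (fun β => h β S.mid) atTop (𝓝 (C⁻¹ / 2)) := by
  have hp : Tendsto (fun β => S.cap β - S.cross β) atTop (𝓝 C) := by simpa using hcap.sub hcross
  have h1 : Tendsto (fun β => S.massMid β / (S.cap β - S.cross β) / 2) atTop (𝓝 (1 / C / 2)) :=
    (S.tendsto_massMid.div hp hC.ne').div_const 2
  rw [one_div] at h1
  refine h1.congr' ?_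
  filter_upwards [hp.eventually_ne hC.ne'] with β hβ
  have e := (hh β).eq_mid (Set.Subset.refl _)
  rw [(hh β).1 S.lo (by simp), (hh β).1 S.hi (by simp)] at e
  rw [e]
  field_simp
  ring

/-- The target is invariant under the symmetry, so by uniqueness the mean times from `lo` and `hi`
agree. One equation then remains. -/
lemma tendsto_time_lo_mid {h : ℝ → V → ℝ} (hh : ∀ β, S.IsMeanTime β {S.mid} (h β)) :
    Tendsto (fun β => h β S.lo) atTop (𝓝 C⁻¹) := by
  have hp : Tendsto (fun β => S.cap β - S.cross β) atTop (𝓝 C) := by simpa using hcap.sub hcross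
  have h1 : Tendsto (fun β => S.massLo β / (S.cap β - S.cross β)) atTop (𝓝 (1 / C)) :=
    S.tendsto_massLo.div hp hC.ne'
  rw [one_div] at h1
  refine h1.congr' ?_
  filter_upwards [hp.eventually_ne hC.ne'] with β hβ
  have e1 := (hh β).eq_lo (by simp)
  have hs : S.IsMeanTime β {S.mid} (fun x => h β (S.neg x)) := (hh β).neg fun x => by
    simp only [Set.mem_singleton_iff]
    exact ⟨fun h => by rw [h, S.neg_mid], fun h => by rw [← S.neg_neg x, h, S.neg_mid]⟩
  have e2 : h β S.hi = h β S.lo := by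
    have := congrFun ((hh β).eq (Set.singleton_nonempty _) hs) S.hi
    rwa [S.neg_hi] at this
  rw [(hh β).1 S.mid (by simp), e2] at e1
  rw [e1]
  field_simp
  ring

/-- With target `lo` there are two unknowns, the times from `mid` and from `hi`. Testing with the
potentials of `hi` and of `mid` gives two equations, solved here by Cramer's rule. -/
lemma tendsto_time_mid_lo {h : ℝ → V → ℝ} (hh : ∀ β, S.IsMeanTime β {S.lo} (h β)) :
    Tendsto (fun β => h β S.mid) atTop (𝓝 (2 * C⁻¹)) ∧
      Tendsto (fun β => h β S.hi) atTop (𝓝 (3 * C⁻¹)) := by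
  have hp : Tendsto (fun β => S.cap β - S.cross β) atTop (𝓝 C) := by simpa using hcap.sub hcross
  have hE : ∀ β, S.massLo β = S.cap β * h β S.hi - (S.cap β - S.cross β) * h β S.mid := by
    intro β
    have e := (hh β).eq_hi (by simp)
    rwa [(hh β).1 S.lo (by simp), mul_zero, sub_zero] at e
  have hE' : ∀ β, S.massMid β = (S.cap β - S.cross β) * (2 * h β S.mid - h β S.hi) := by
    intro β
    have e := (hh β).eq_mid (by simp)
    rwa [(hh β).1 S.lo (by simp), sub_zero] at e
  -- The determinant of the two equations; its limit is C².
  have hden : Tendsto (fun β => 2 * (S.cap β - S.cross β) * S.cap β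
      - (S.cap β - S.cross β) * (S.cap β - S.cross β)) atTop (𝓝 (2 * C * C - C * C)) :=
    ((hp.const_mul 2).mul hcap).sub (hp.mul hp)
  have hne : 2 * C * C - C * C ≠ 0 := by
    have : 0 < C * C := mul_pos hC hC
    linarith
  have h0 : Tendsto (fun β => h β S.mid) atTop (𝓝 (2 * C⁻¹)) := by
    have hnum : Tendsto (fun β => S.massMid β * S.cap β + (S.cap β - S.cross β) * S.massLo β) atTop
        (𝓝 (1 * C + C * 1)) :=
      (S.tendsto_massMid.mul hcap).add (hp.mul S.tendsto_massLo)
    have := hnum.div hden hne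
    have e : (1 * C + C * 1) / (2 * C * C - C * C) = 2 * C⁻¹ := by
      rw [div_eq_iff hne]
      field_simp
      ring
    rw [e] at this
    refine this.congr' ?_
    filter_upwards [hden.eventually_ne hne] with β hβ
    simp only [Pi.div_apply]
    rw [div_eq_iff hβ, hE, hE']
    ring
  refine ⟨h0, ?_⟩
  have h1 : Tendsto (fun β => (S.massLo β + (S.cap β - S.cross β) * h β S.mid) / S.cap β) atTop
      (𝓝 ((1 + C * (2 * C⁻¹)) / C)) :=
    (S.tendsto_massLo.add (hp.mul h0)).div hcap hC.ne'
  have e : (1 + C * (2 * C⁻¹)) / C = 3 * C⁻¹ := by field_simp; norm_num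
  rw [e] at h1
  refine h1.congr' ?_
  filter_upwards [hcap.eventually_ne hC.ne'] with β hβ
  rw [hE]
  field_simp
  ring

end Asymptotics

end Landscape

/-! ### Limits of the capacity and of the cross conductance. -/

namespace Landscape

open Network

variable {V : Type*} [Fintype V] (S : Landscape V)

open Classical in
/-- Conductances of the edges that do not exceed the barrier. -/
def lowW (β : ℝ) (x y : V) : ℝ :=
  if S.lev x y ≤ S.barrier then S.W β x y else 0

lemma lowW_nonneg (β : ℝ) (x y : V) : 0 ≤ S.lowW β x y := by
  unfold lowW; split_ifs; exacts [S.W_nonneg β x y, le_rfl]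

lemma lowW_le_W (β : ℝ) (x y : V) : S.lowW β x y ≤ S.W β x y := by
  unfold lowW; split_ifs; exacts [le_rfl, S.W_nonneg β x y]

/-- Heights are integers, so an edge above the barrier exceeds it by at least one. -/
lemma W_le_of_barrier_lt {β : ℝ} (hβ : 0 ≤ β) {x y : V} (h : S.barrier < S.lev x y) :
    S.W β x y ≤ Real.exp (-β) := by
  unfold W
  split_ifs
  · refine Real.exp_le_exp.2 ?_
    have : (S.barrier : ℝ) + 1 ≤ S.lev x y := by exact_mod_cast h
    nlinarith
  · exact (Real.exp_pos _).le

lemma W_le_lowW_add {β : ℝ} (hβ : 0 ≤ β) (x y : V) :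
    S.W β x y ≤ S.lowW β x y + Real.exp (-β) := by
  by_cases h : S.lev x y ≤ S.barrier
  · rw [lowW, if_pos h]
    linarith [Real.exp_pos (-β)]
  · have := S.W_le_of_barrier_lt hβ (not_le.1 h)
    linarith [S.lowW_nonneg β x y]

lemma lowW_mono (x y : V) : Monotone fun β => S.lowW β x y := by
  intro β β' hβ
  simp only [lowW, W]
  split_ifs with h1 h2
  · refine Real.exp_le_exp.2 (mul_le_mul_of_nonneg_right hβ ?_)
    have : (S.lev x y : ℝ) ≤ S.barrier := by exact_mod_cast h1
    linarith
  · exact le_rfl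
  · exact le_rfl

lemma abs_sub_clip_le (a b : ℝ) :
    (max 0 (min 1 a) - max 0 (min 1 b)) * (max 0 (min 1 a) - max 0 (min 1 b))
      ≤ (a - b) * (a - b) := by
  rw [← sq, ← sq, sq_le_sq]
  calc |max 0 (min 1 a) - max 0 (min 1 b)| ≤ |min 1 a - min 1 b| := by
        rw [max_comm 0, max_comm 0]; exact abs_max_sub_max_le_abs _ _ _
    _ ≤ |a - b| := by
        rw [min_comm 1, min_comm 1]
        exact abs_min_sub_min_le_max a 1 b 1 |>.trans (by simp)

/-- Minimal energy of the edges that do not exceed the barrier. -/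
def lowCap (β : ℝ) : ℝ := ⨅ f : {f : V → ℝ // S.IsPot f}, form (S.lowW β) f.1 f.1

lemma lowCap_bddBelow (β : ℝ) :
    BddBelow (Set.range fun f : {f : V → ℝ // S.IsPot f} => form (S.lowW β) f.1 f.1) :=
  ⟨0, by rintro _ ⟨f, rfl⟩; exact form_self_nonneg (S.lowW_nonneg β) _⟩

lemma lowCap_le (β : ℝ) {f : V → ℝ} (hf : S.IsPot f) : S.lowCap β ≤ form (S.lowW β) f f :=
  ciInf_le (S.lowCap_bddBelow β) ⟨f, hf⟩

lemma lowCap_mono : Monotone S.lowCap := by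
  intro β β' hβ
  refine ciInf_mono (S.lowCap_bddBelow β) fun f => form_le_form fun x y => ?_
  exact mul_le_mul_of_nonneg_right (S.lowW_mono x y hβ) (mul_self_nonneg _)

lemma lowCap_le_cap (β : ℝ) : S.lowCap β ≤ S.cap β :=
  (S.lowCap_le β (S.pot_isPot β)).trans (form_le_form fun x y =>
    mul_le_mul_of_nonneg_right (S.lowW_le_W β x y) (mul_self_nonneg _))

/-- Upper bound for the number of pairs, used for error terms. -/
def pairs (V : Type*) [Fintype V] : ℝ := ∑ _x : V, ∑ _y : V, (1 : ℝ)

lemma form_le_form_add {w w' : V → V → ℝ} {f f' g g' : V → ℝ} {r : ℝ} (hr : 0 ≤ r)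
    (h : ∀ x y, w x y * ((f x - f y) * (f' x - f' y))
      ≤ w' x y * ((g x - g y) * (g' x - g' y)) + r) :
    form w f f' ≤ form w' g g' + pairs V * r := by
  have h1 : ∑ x, ∑ y, w x y * ((f x - f y) * (f' x - f' y))
      ≤ ∑ x, ∑ y, (w' x y * ((g x - g y) * (g' x - g' y)) + r) :=
    Finset.sum_le_sum fun x _ => Finset.sum_le_sum fun y _ => h x y
  simp only [Finset.sum_add_distrib] at h1
  have h2 : ∑ _x : V, ∑ _y : V, r = pairs V * r := by
    simp only [pairs, Finset.sum_mul, one_mul]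
  have h3 : 0 ≤ pairs V * r :=
    mul_nonneg (Finset.sum_nonneg fun _ _ => Finset.sum_nonneg fun _ _ => zero_le_one) hr
  unfold form
  linarith

/-- A competitor for `lowCap` may be huge across edges above the barrier. Clipping it to [0, 1]
keeps the boundary values, does not increase any difference, and bounds the contribution of each
such edge by `exp (-β)`. -/
lemma cap_le_lowCap_add {β : ℝ} (hβ : 0 ≤ β) :
    S.cap β ≤ S.lowCap β + pairs V * Real.exp (-β) := by
  rw [← sub_le_iff_le_add]
  have : Nonempty {f : V → ℝ // S.IsPot f} := ⟨⟨_, S.pot_isPot β⟩⟩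
  refine le_ciInf fun f => ?_
  rw [sub_le_iff_le_add]
  obtain ⟨f, h1, h2, h3⟩ := f
  set g : V → ℝ := fun x => max 0 (min 1 (f x)) with hg
  have hgpot : ∀ x ∈ S.ground, g x = S.pot β x := by
    obtain ⟨k1, k2, k3⟩ := S.pot_isPot β
    refine S.forall_ground ?_ ?_ ?_
    · simp [hg, h1, k1]
    · simp [hg, h2, k2]
    · simp [hg, h3, k3]
  have e1 : S.cap β ≤ form (S.W β) g g :=
    form_le_of_lap_eq_zero (S.W_symm β) (S.W_nonneg β) hgpot (S.lap_pot β)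
  refine e1.trans (form_le_form_add (Real.exp_pos _).le fun x y => ?_)
  have hclip := abs_sub_clip_le (f x) (f y)
  have hone : (g x - g y) * (g x - g y) ≤ 1 := by
    have a1 : 0 ≤ g x := le_max_left _ _
    have a2 : 0 ≤ g y := le_max_left _ _
    have a3 : g x ≤ 1 := max_le zero_le_one (min_le_left _ _)
    have a4 : g y ≤ 1 := max_le zero_le_one (min_le_left _ _)
    nlinarith
  calc S.W β x y * ((g x - g y) * (g x - g y))
      ≤ (S.lowW β x y + Real.exp (-β)) * ((g x - g y) * (g x - g y)) :=
        mul_le_mul_of_nonneg_right (S.W_le_lowW_add hβ x y) (mul_self_nonneg _)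
    _ = S.lowW β x y * ((g x - g y) * (g x - g y))
        + Real.exp (-β) * ((g x - g y) * (g x - g y)) := by ring
    _ ≤ S.lowW β x y * ((f x - f y) * (f x - f y)) + Real.exp (-β) * 1 :=
        add_le_add (mul_le_mul_of_nonneg_left hclip (S.lowW_nonneg β x y))
          (mul_le_mul_of_nonneg_left hone (Real.exp_pos _).le)
    _ = _ := by rw [mul_one]

lemma tendsto_exp_neg : Tendsto (fun β : ℝ => Real.exp (-β)) atTop (𝓝 0) :=
  Real.tendsto_exp_neg_atTop_nhds_zero

open Classical in
/-- Indicator of the edges that do not exceed the barrier. -/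
def flatW (x y : V) : ℝ := if S.adj x y ∧ S.lev x y ≤ S.barrier then 1 else 0

lemma form_lowW_eq {g : V → ℝ} (hlow : ∀ x y, S.adj x y → S.lev x y < S.barrier → g x = g y)
    (β : ℝ) : form (S.lowW β) g g = form S.flatW g g := by
  unfold form
  congr 1
  refine Finset.sum_congr rfl fun x _ => Finset.sum_congr rfl fun y _ => ?_
  unfold lowW W flatW
  by_cases h1 : S.adj x y
  · rcases lt_trichotomy (S.lev x y) S.barrier with h | h | h
    · rw [hlow x y h1 h]; simp
    · simp [h1, h]
    · simp [h1, not_le.2 h]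
  · simp [h1]

/-- `lowCap` is monotone in β, and it is bounded because `g` does not see the edges strictly below
the barrier, the only ones whose low conductance grows. Up to an exponentially small error `cap`
equals `lowCap`. -/
lemma exists_tendsto_cap {g : V → ℝ} (hg : S.IsPot g)
    (hlow : ∀ x y, S.adj x y → S.lev x y < S.barrier → g x = g y) :
    ∃ C, Tendsto S.cap atTop (𝓝 C) ∧ C ≤ form S.flatW g g := by
  have hle : ∀ β, S.lowCap β ≤ form S.flatW g g := fun β => by
    rw [← S.form_lowW_eq hlow β]
    exact S.lowCap_le β hg
  have h1 := tendsto_atTop_ciSup S.lowCap_mono ⟨_, by rintro _ ⟨β, rfl⟩; exact hle β⟩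
  refine ⟨_, ?_, ciSup_le hle⟩
  have h2 : Tendsto (fun β => S.lowCap β + pairs V * Real.exp (-β)) atTop
      (𝓝 ((⨆ β, S.lowCap β) + pairs V * 0)) :=
    h1.add (tendsto_exp_neg.const_mul _)
  rw [mul_zero, add_zero] at h2
  refine tendsto_of_tendsto_of_tendsto_of_le_of_le' h1 h2
    (Eventually.of_forall S.lowCap_le_cap) ?_
  filter_upwards [eventually_ge_atTop 0] with β hβ
  exact S.cap_le_lowCap_add hβ

/-- Single edges below the barrier. -/
def lowAdj (x y : V) : Prop := S.adj x y ∧ S.lev x y < S.barrier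

lemma W_mul_sq_le (β : ℝ) (f : V → ℝ) (x y : V) :
    S.W β x y * ((f x - f y) * (f x - f y)) ≤ 2 * form (S.W β) f f := by
  have hnn : ∀ x y, 0 ≤ S.W β x y * ((f x - f y) * (f x - f y)) := fun x y =>
    mul_nonneg (S.W_nonneg β x y) (mul_self_nonneg _)
  have h1 := Finset.single_le_sum (f := fun y => S.W β x y * ((f x - f y) * (f x - f y)))
    (fun y _ => hnn x y) (Finset.mem_univ y)
  have h2 := Finset.single_le_sum (f := fun x => ∑ y, S.W β x y * ((f x - f y) * (f x - f y)))
    (fun x _ => Finset.sum_nonneg fun y _ => hnn x y) (Finset.mem_univ x)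
  unfold form
  linarith

/-- An edge strictly below the barrier has conductance at least `exp β`, while the total energy
stays bounded; so the potential difference across it tends to zero. -/
lemma tendsto_pot_sub_of_lowConn {C : ℝ} (hcap : Tendsto S.cap atTop (𝓝 C)) {x y : V}
    (h : Relation.ReflTransGen S.lowAdj x y) :
    Tendsto (fun β => S.pot β x - S.pot β y) atTop (𝓝 0) := by
  induction h with
  | refl => simp
  | @tail y z _ hyz ih =>
    have h1 : Tendsto (fun β => (S.pot β y - S.pot β z) ^ 2) atTop (𝓝 0) := by
      have h2 : Tendsto (fun β => 2 * S.cap β * Real.exp (-β)) atTop (𝓝 (2 * C * 0)) :=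
        (hcap.const_mul 2).mul tendsto_exp_neg
      rw [mul_zero] at h2
      refine tendsto_of_tendsto_of_tendsto_of_le_of_le' tendsto_const_nhds h2
        (Eventually.of_forall fun β => sq_nonneg _) ?_
      filter_upwards [eventually_ge_atTop 0] with β hβ
      have h3 := S.W_mul_sq_le β (S.pot β) y z
      have h4 : Real.exp β ≤ S.W β y z := by
        rw [W, if_pos hyz.1]
        refine Real.exp_le_exp.2 ?_
        have : (S.lev y z : ℝ) + 1 ≤ S.barrier := by exact_mod_cast hyz.2
        nlinarith
      have h5 : Real.exp β * (S.pot β y - S.pot β z) ^ 2 ≤ 2 * S.cap β := by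
        refine le_trans ?_ h3
        rw [sq]
        exact mul_le_mul_of_nonneg_right h4 (mul_self_nonneg _)
      rw [Real.exp_neg, ← div_eq_mul_inv, le_div_iff₀ (Real.exp_pos _)]
      linarith
    have h2 : Tendsto (fun β => S.pot β y - S.pot β z) atTop (𝓝 0) := by
      have := (Real.continuous_sqrt.tendsto 0).comp h1
      rw [Real.sqrt_zero] at this
      refine squeeze_zero_norm (fun β => ?_) this
      simp [Real.sqrt_sq_eq_abs]
    have h3 := ih.add h2
    simp only [add_zero] at h3
    exact h3.congr fun β => by ring

/-- The well of `mid`. -/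
def well : Set V := {x | Relation.ReflTransGen S.lowAdj S.mid x}

/-- Edges up to the barrier that avoid the well of `mid`. -/
def sideAdj (x y : V) : Prop :=
  (S.adj x y ∧ S.lev x y ≤ S.barrier) ∧ x ∉ S.well ∧ y ∉ S.well

/-- What `lo` is connected to, up to the barrier and outside of the well of `mid`. -/
def side : Set V := {x | Relation.ReflTransGen S.sideAdj S.lo x}

lemma lowAdj_neg {x y : V} (h : S.lowAdj x y) : S.lowAdj (S.neg x) (S.neg y) :=
  ⟨S.adj_neg _ _ h.1, by rw [S.lev_neg]; exact h.2⟩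

lemma neg_mem_well {x : V} (h : x ∈ S.well) : S.neg x ∈ S.well := by
  have : Relation.ReflTransGen S.lowAdj (S.neg S.mid) (S.neg x) :=
    Relation.ReflTransGen.lift S.neg (p := S.lowAdj) (fun _ _ h => S.lowAdj_neg h) _ _ h
  rwa [S.neg_mid] at this

lemma neg_mem_well_iff {x : V} : S.neg x ∈ S.well ↔ x ∈ S.well :=
  ⟨fun h => by simpa only [S.neg_neg] using S.neg_mem_well h, S.neg_mem_well⟩

lemma sideAdj_symm {x y : V} (h : S.sideAdj x y) : S.sideAdj y x :=
  ⟨⟨S.adj_symm _ _ h.1.1, by rw [S.lev_comm]; exact h.1.2⟩, h.2.2, h.2.1⟩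

lemma sideAdj_neg {x y : V} (h : S.sideAdj x y) : S.sideAdj (S.neg x) (S.neg y) :=
  ⟨⟨S.adj_neg _ _ h.1.1, by rw [S.lev_neg]; exact h.1.2⟩,
    fun h' => h.2.1 (S.neg_mem_well_iff.1 h'), fun h' => h.2.2 (S.neg_mem_well_iff.1 h')⟩

/-- If `x` and its mirror image were both reachable from `lo`, reflecting the path to the latter
would connect `hi` to `x`, and hence to `lo`. -/
lemma notMem_side_of_neg_mem (hsep : S.hi ∉ S.side) {x : V} (hx : x ∈ S.side) :
    S.neg x ∉ S.side := by
  intro hx'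
  refine hsep ?_
  have h1 : Relation.ReflTransGen S.sideAdj x S.hi := by
    have : Relation.ReflTransGen S.sideAdj (S.neg S.lo) (S.neg (S.neg x)) :=
      Relation.ReflTransGen.lift S.neg (p := S.sideAdj) (fun _ _ h => S.sideAdj_neg h) _ _ hx'
    rw [S.neg_lo, S.neg_neg] at this
    have hsymm : ∀ {a b : V}, Relation.ReflTransGen S.sideAdj a b →
        Relation.ReflTransGen S.sideAdj b a := fun h => by
      induction h with
      | refl => exact Relation.ReflTransGen.refl
      | tail _ hbc ih => exact Relation.ReflTransGen.head (S.sideAdj_symm hbc) ih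
    exact hsymm this
  exact Relation.ReflTransGen.trans hx h1

lemma notMem_well_of_mem_side (hlo : S.lo ∉ S.well) {x : V} (hx : x ∈ S.side) : x ∉ S.well := by
  rcases Relation.ReflTransGen.cases_tail hx with h | ⟨y, _, h⟩
  · rwa [h]
  · exact h.2.2

lemma mem_side_of_adj (hlo : S.lo ∉ S.well) {x y : V} (hx : x ∈ S.side) (hy : y ∉ S.well)
    (hadj : S.adj x y) (hlev : S.lev x y ≤ S.barrier) : y ∈ S.side :=
  Relation.ReflTransGen.tail hx ⟨⟨hadj, hlev⟩, S.notMem_well_of_mem_side hlo hx, hy⟩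

lemma lev_eq_of_mem_side (hlo : S.lo ∉ S.well) {x y : V} (hx : x ∈ S.side) (hy : y ∈ S.well)
    (hadj : S.adj x y) : S.barrier ≤ S.lev x y := by
  by_contra! h
  exact S.notMem_well_of_mem_side hlo hx
    (Relation.ReflTransGen.tail hy ⟨S.adj_symm _ _ hadj, by rwa [S.lev_comm]⟩)

open Classical in
/-- The equilibrium potential of `lo`, cut off outside of the side of `lo`. -/
def cutPot (β : ℝ) (x : V) : ℝ := if x ∈ S.side then S.pot β x else 0

lemma cutPot_nonneg (β : ℝ) (x : V) : 0 ≤ S.cutPot β x := by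
  unfold cutPot; split_ifs; exacts [S.pot_nonneg β x, le_rfl]

lemma cutPot_le_one (β : ℝ) (x : V) : S.cutPot β x ≤ 1 := by
  unfold cutPot; split_ifs; exacts [S.pot_le_one β x, zero_le_one]

open Classical in
/-- Mass of the potential on the well of `mid`. -/
def wellPot (β : ℝ) : ℝ := ∑ y, if y ∈ S.well then S.pot β y else 0

lemma wellPot_nonneg (β : ℝ) : 0 ≤ S.wellPot β :=
  Finset.sum_nonneg fun y _ => by split_ifs; exacts [S.pot_nonneg β y, le_rfl]

lemma pot_le_wellPot (β : ℝ) {y : V} (hy : y ∈ S.well) : S.pot β y ≤ S.wellPot β := by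
  classical
  have := Finset.single_le_sum (f := fun y => if y ∈ S.well then S.pot β y else 0)
    (fun y _ => by split_ifs; exacts [S.pot_nonneg β y, le_rfl]) (Finset.mem_univ y)
  simpa [hy, wellPot] using this

lemma tendsto_wellPot {C : ℝ} (hcap : Tendsto S.cap atTop (𝓝 C)) :
    Tendsto S.wellPot atTop (𝓝 0) := by
  classical
  have : Tendsto S.wellPot atTop (𝓝 (∑ _y : V, 0)) := by
    refine tendsto_finsetSum _ fun y _ => ?_
    by_cases hy : y ∈ S.well
    · simp only [hy, if_true]
      have h := S.tendsto_pot_sub_of_lowConn hcap hy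
      simp only [(S.pot_isPot _).2.1, zero_sub] at h
      simpa using h.neg
    · simp [hy]
  simpa using this

/-- Cutting the potential off costs little on each edge leaving the side of `lo`: either the edge
exceeds the barrier, or it ends in the well of `mid` at height exactly the barrier. There the
conductance is 1 and the potential of the far end is at most `wellPot`, which tends to zero. -/
lemma W_mul_boundary_le (hlo : S.lo ∉ S.well) {β : ℝ} (hβ : 0 ≤ β) {x y : V} (hx : x ∈ S.side)
    (hy : y ∉ S.side) : S.W β x y * (S.pot β x * S.pot β x)
      ≤ S.W β x y * ((S.pot β x - S.pot β y) * (S.pot β x - S.pot β y))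
        + (Real.exp (-β) + 2 * S.wellPot β) := by
  have a1 := S.pot_nonneg β x
  have a2 := S.pot_nonneg β y
  have a3 := S.pot_le_one β x
  have a4 := S.pot_le_one β y
  have a5 := S.wellPot_nonneg β
  have a6 := S.W_nonneg β x y
  by_cases hadj : S.adj x y
  · by_cases hlev : S.lev x y ≤ S.barrier
    · have hyw : y ∈ S.well := by
        by_contra hyw
        exact hy (S.mem_side_of_adj hlo hx hyw hadj hlev)
      have heq : S.lev x y = S.barrier := le_antisymm hlev (S.lev_eq_of_mem_side hlo hx hyw hadj)
      have hW : S.W β x y = 1 := by simp [W, hadj, heq]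
      have := S.pot_le_wellPot β hyw
      have := Real.exp_pos (-β)
      rw [hW]
      nlinarith
    · have hW := S.W_le_of_barrier_lt hβ (not_le.1 hlev)
      have h1 : S.W β x y * (S.pot β x * S.pot β x) ≤ Real.exp (-β) := by
        have : S.pot β x * S.pot β x ≤ 1 := by nlinarith
        nlinarith
      have h2 := mul_nonneg a6 (mul_self_nonneg (S.pot β x - S.pot β y))
      linarith
  · have hW : S.W β x y = 0 := by simp [W, hadj]
    rw [hW]
    have := Real.exp_pos (-β)
    nlinarith

lemma form_cutPot_le (hlo : S.lo ∉ S.well) {β : ℝ} (hβ : 0 ≤ β) :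
    form (S.W β) (S.cutPot β) (S.cutPot β)
      ≤ S.cap β + pairs V * (Real.exp (-β) + 2 * S.wellPot β) := by
  have hr : 0 ≤ Real.exp (-β) + 2 * S.wellPot β := by
    have := Real.exp_pos (-β)
    have := S.wellPot_nonneg β
    linarith
  refine form_le_form_add hr fun x y => ?_
  have hnn := mul_nonneg (S.W_nonneg β x y) (mul_self_nonneg (S.pot β x - S.pot β y))
  unfold cutPot
  by_cases hx : x ∈ S.side <;> by_cases hy : y ∈ S.side
  · simp only [hx, hy, if_true]
    linarith
  · simp only [hx, hy, if_true, if_false, sub_zero]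
    exact S.W_mul_boundary_le hlo hβ hx hy
  · simp only [hx, hy, if_true, if_false, zero_sub, neg_mul_neg]
    have := S.W_mul_boundary_le hlo hβ hy hx
    rw [S.W_symm β y x] at this
    linarith
  · simp only [hx, hy, if_false, sub_zero, mul_zero]
    linarith

/-- An edge between the side of `lo` and its mirror image must exceed the barrier, as it would
otherwise put a point and its reflection on the same side. -/
lemma W_mul_cutPot_le (hlo : S.lo ∉ S.well) (hsep : S.hi ∉ S.side) {β : ℝ} (hβ : 0 ≤ β) (x y : V) :
    S.W β x y * (S.cutPot β x * S.cutPot β (S.neg y)) ≤ Real.exp (-β) := by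
  by_cases h : x ∈ S.side ∧ S.neg y ∈ S.side ∧ S.adj x y
  · obtain ⟨hx, hy, hadj⟩ := h
    have hlev : S.barrier < S.lev x y := by
      by_contra! hlev
      have hyw : y ∉ S.well := fun h =>
        S.notMem_well_of_mem_side hlo hy (S.neg_mem_well h)
      exact S.notMem_side_of_neg_mem hsep (S.mem_side_of_adj hlo hx hyw hadj hlev) hy
    have hW := S.W_le_of_barrier_lt hβ hlev
    have h1 := mul_le_one₀ (S.cutPot_le_one β x) (S.cutPot_nonneg β (S.neg y))
      (S.cutPot_le_one β (S.neg y))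
    have h2 := mul_nonneg (S.cutPot_nonneg β x) (S.cutPot_nonneg β (S.neg y))
    have := S.W_nonneg β x y
    nlinarith
  · have h0 : S.W β x y * (S.cutPot β x * S.cutPot β (S.neg y)) = 0 := by
      by_cases h1 : x ∈ S.side
      · by_cases h2 : S.neg y ∈ S.side
        · have h3 : ¬ S.adj x y := fun h3 => h ⟨h1, h2, h3⟩
          simp [W, h3]
        · simp [cutPot, h2]
      · simp [cutPot, h1]
    rw [h0]
    exact (Real.exp_pos _).le

lemma cutPot_mul_neg (hsep : S.hi ∉ S.side) (β : ℝ) (x : V) :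
    S.cutPot β x * S.cutPot β (S.neg x) = 0 := by
  by_cases hx : x ∈ S.side
  · simp [cutPot, S.notMem_side_of_neg_mem hsep hx]
  · simp [cutPot, hx]

lemma neg_form_cutPot_le (hlo : S.lo ∉ S.well) (hsep : S.hi ∉ S.side) {β : ℝ} (hβ : 0 ≤ β) :
    - form (S.W β) (S.cutPot β) (fun x => S.cutPot β (S.neg x))
      ≤ pairs V * (2 * Real.exp (-β)) := by
  have h := form_le_form_add (w := S.W β) (w' := fun _ _ => 0) (f := -S.cutPot β)
    (f' := fun x => S.cutPot β (S.neg x)) (g := 0) (g' := 0) (r := 2 * Real.exp (-β))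
    (by positivity) fun x y => ?_
  · have e : form (S.W β) (-S.cutPot β) (fun x => S.cutPot β (S.neg x))
        = - form (S.W β) (S.cutPot β) (fun x => S.cutPot β (S.neg x)) := by
      have := form_smul_left (S.W β) (-1) (S.cutPot β) (fun x => S.cutPot β (S.neg x))
      simpa using this
    rw [← e]
    refine h.trans (le_of_eq ?_)
    simp [form]
  · have h1 := S.W_mul_cutPot_le hlo hsep hβ x y
    have h2 := S.W_mul_cutPot_le hlo hsep hβ y x
    have h3 := S.cutPot_mul_neg hsep β x
    have h4 := S.cutPot_mul_neg hsep β y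
    rw [S.W_symm β y x] at h2
    simp only [Pi.neg_apply, Pi.zero_apply, sub_self, mul_zero, zero_add]
    have e : S.W β x y * ((-S.cutPot β x - -S.cutPot β y)
        * (S.cutPot β (S.neg x) - S.cutPot β (S.neg y)))
        = S.W β x y * (S.cutPot β x * S.cutPot β (S.neg y))
          + S.W β x y * (S.cutPot β y * S.cutPot β (S.neg x)) -
          S.W β x y * (S.cutPot β x * S.cutPot β (S.neg x))
          - S.W β x y * (S.cutPot β y * S.cutPot β (S.neg y)) := by ring
    rw [e, h3, h4]
    linarith

/-- The difference of the potentials of `lo` and `hi` is harmonic with energy `2 * cap + 2 * cross`.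
The antisymmetrised cut-off potential has the same boundary values and energy at most `2 * cap` plus
a vanishing error, because its two halves hardly interact. The Dirichlet principle then squeezes
`cross`. -/
lemma tendsto_cross {C : ℝ} (hcap : Tendsto S.cap atTop (𝓝 C)) (hlo : S.lo ∉ S.well)
    (hsep : S.hi ∉ S.side) : Tendsto S.cross atTop (𝓝 0) := by
  have hlim : Tendsto (fun β => pairs V * (Real.exp (-β) + 2 * S.wellPot β)
      + pairs V * (2 * Real.exp (-β))) atTop (𝓝 (pairs V * (0 + 2 * 0) + pairs V * (2 * 0))) :=
    ((tendsto_exp_neg.add ((S.tendsto_wellPot hcap).const_mul 2)).const_mul _).add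
      ((tendsto_exp_neg.const_mul 2).const_mul _)
  simp only [mul_zero, add_zero] at hlim
  refine tendsto_of_tendsto_of_tendsto_of_le_of_le' tendsto_const_nhds hlim
    (Eventually.of_forall S.cross_nonneg) ?_
  filter_upwards [eventually_ge_atTop 0] with β hβ
  obtain ⟨k1, k2, k3⟩ := S.pot_isPot β
  set f₂ : V → ℝ := fun x => S.cutPot β (S.neg x) with hf₂
  set u₂ : V → ℝ := fun x => S.pot β (S.neg x) with hu₂
  have hside : S.lo ∈ S.side := Relation.ReflTransGen.refl
  have hmin : form (S.W β) (S.pot β - u₂) (S.pot β - u₂)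
      ≤ form (S.W β) (S.cutPot β - f₂) (S.cutPot β - f₂) := by
    refine form_le_of_lap_eq_zero (S.W_symm β) (S.W_nonneg β) (A := S.ground) ?_ ?_
    · refine S.forall_ground ?_ ?_ ?_
      · simp [hf₂, hu₂, cutPot, S.neg_lo, hside, k3]
      · simp [hf₂, hu₂, cutPot, S.neg_mid, k2]
      · simp [hf₂, hu₂, cutPot, S.neg_hi, hside, k3]
    · intro x hx
      have := lap_sub (S.W β) (S.pot β) u₂ x
      rw [hu₂, S.lap_neg, S.lap_pot β x hx, S.lap_pot β _ (by rwa [S.neg_mem_ground])] at this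
      rw [sub_zero] at this
      exact this
  have e1 : form (S.W β) u₂ u₂ = S.cap β := S.form_neg β _ _
  have e2 : form (S.W β) f₂ f₂ = form (S.W β) (S.cutPot β) (S.cutPot β) := S.form_neg β _ _
  have e3 : form (S.W β) (S.pot β) u₂ = - S.cross β := (_root_.neg_neg _).symm
  have e4 : form (S.W β) (S.pot β) (S.pot β) = S.cap β := rfl
  simp only [form_sub_left, form_sub_right] at hmin
  rw [form_comm _ u₂ (S.pot β), form_comm _ f₂ (S.cutPot β), e1, e2, e3, e4] at hmin
  have b1 := S.form_cutPot_le hlo hβ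
  have b2 := S.neg_form_cutPot_le hlo hsep hβ
  linarith

/-! #### Bounds from families of edges -/

open Classical in
-- Rayleigh monotonicity: discard all edges but the listed ones, each of conductance at least 1. The
-- hypothesis `hswap` prevents an unordered edge from being listed in both directions.
lemma sum_sq_le_form {ι : Type*} [Fintype ι] {e : ι → V × V} (he : Function.Injective e)
    (hswap : ∀ k l, e k ≠ (e l).swap)
    (hadj : ∀ k, S.adj (e k).1 (e k).2 ∧ S.lev (e k).1 (e k).2 ≤ S.barrier) {β : ℝ} (hβ : 0 ≤ β)
    (f : V → ℝ) : ∑ k, (f (e k).1 - f (e k).2) ^ 2 ≤ form (S.W β) f f := by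
  set F : V × V → ℝ := fun p => S.W β p.1 p.2 * ((f p.1 - f p.2) * (f p.1 - f p.2)) with hF
  have hFnn : ∀ p, 0 ≤ F p := fun p => mul_nonneg (S.W_nonneg β _ _) (mul_self_nonneg _)
  have hFswap : ∀ p, F p.swap = F p := fun p => by
    simp only [hF, Prod.fst_swap, Prod.snd_swap, S.W_symm β p.2 p.1]; ring
  have hle : ∀ k, (f (e k).1 - f (e k).2) ^ 2 ≤ F (e k) := by
    intro k
    have hW : 1 ≤ S.W β (e k).1 (e k).2 := by
      rw [W, if_pos (hadj k).1]
      refine Real.one_le_exp (mul_nonneg hβ ?_)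
      have : (S.lev (e k).1 (e k).2 : ℝ) ≤ S.barrier := by exact_mod_cast (hadj k).2
      linarith
    rw [sq]
    exact le_mul_of_one_le_left (mul_self_nonneg _) hW
  have hdisj : Disjoint (Finset.univ.image e) (Finset.univ.image fun k => (e k).swap) := by
    rw [Finset.disjoint_left]
    intro p hp hp'
    obtain ⟨k, -, rfl⟩ := Finset.mem_image.1 hp
    obtain ⟨l, -, hl⟩ := Finset.mem_image.1 hp'
    exact hswap k l hl.symm
  have htot : 2 * ∑ k, F (e k) ≤ ∑ p, F p := by
    calc 2 * ∑ k, F (e k) = ∑ p ∈ Finset.univ.image e, F p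
          + ∑ p ∈ Finset.univ.image fun k => (e k).swap, F p := by
          rw [Finset.sum_image fun a _ b _ h => he h,
            Finset.sum_image fun a _ b _ h => he (Prod.swap_injective h)]
          simp only [hFswap]
          ring
      _ = ∑ p ∈ Finset.univ.image e ∪ Finset.univ.image fun k => (e k).swap, F p :=
          (Finset.sum_union hdisj).symm
      _ ≤ ∑ p, F p := Finset.sum_le_sum_of_subset_of_nonneg (Finset.subset_univ _)
          fun p _ _ => hFnn p
  have hform : form (S.W β) f f = 1 / 2 * ∑ p, F p := by
    rw [form, Fintype.sum_prod_type]
  have := Finset.sum_le_sum fun k (_ : k ∈ Finset.univ) => hle k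
  rw [hform]
  linarith

open Classical in
lemma form_flatW_le {ι : Type*} [Fintype ι] (e : ι → V × V) {g : V → ℝ} {δ : ℝ}
    (h : ∀ x y, S.adj x y → S.lev x y ≤ S.barrier → g x ≠ g y →
      |g x - g y| ≤ δ ∧ ∃ k, e k = (x, y) ∨ e k = (y, x)) :
    form S.flatW g g ≤ Fintype.card ι * δ ^ 2 := by
  set F : V × V → ℝ := fun p => S.flatW p.1 p.2 * ((g p.1 - g p.2) * (g p.1 - g p.2)) with hF
  have hform : form S.flatW g g = 1 / 2 * ∑ p, F p := by
    rw [form, Fintype.sum_prod_type]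
  set E : Finset (V × V) := Finset.univ.image e ∪ Finset.univ.image fun k => (e k).swap with hE
  have h0 : ∀ p, p ∉ E → F p = 0 := by
    rintro ⟨x, y⟩ hp
    simp only [hF, flatW]
    split_ifs with hxy
    · by_cases hg : g x = g y
      · simp [hg]
      · exfalso
        obtain ⟨-, k, hk | hk⟩ := h x y hxy.1 hxy.2 hg
        · exact hp (Finset.mem_union_left _ (Finset.mem_image.2 ⟨k, Finset.mem_univ _, hk⟩))
        · exact hp (Finset.mem_union_right _ (Finset.mem_image.2
            ⟨k, Finset.mem_univ _, by rw [hk]; rfl⟩))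
    · simp
  have h1 : ∀ p, F p ≤ δ ^ 2 := by
    rintro ⟨x, y⟩
    simp only [hF, flatW]
    split_ifs with hxy
    · by_cases hg : g x = g y
      · simp [hg, sq_nonneg]
      · have := (h x y hxy.1 hxy.2 hg).1
        rw [one_mul, ← sq, sq_le_sq]
        exact this.trans (le_abs_self _)
    · simp [sq_nonneg]
  have h2 : ∑ p, F p ≤ E.card * δ ^ 2 := by
    rw [← Finset.sum_subset (Finset.subset_univ E) fun p _ hp => h0 p hp]
    calc ∑ p ∈ E, F p ≤ ∑ _p ∈ E, δ ^ 2 := Finset.sum_le_sum fun p _ => h1 p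
      _ = E.card * δ ^ 2 := by rw [Finset.sum_const, nsmul_eq_mul]
  have h3 : (E.card : ℝ) ≤ 2 * Fintype.card ι := by
    have a1 : (Finset.univ.image e).card ≤ Fintype.card ι := Finset.card_image_le
    have a2 : (Finset.univ.image fun k => (e k).swap).card ≤ Fintype.card ι := Finset.card_image_le
    have a3 := Finset.card_union_le (Finset.univ.image e) (Finset.univ.image fun k => (e k).swap)
    have : E.card ≤ 2 * Fintype.card ι := by rw [hE]; omega
    exact_mod_cast this
  rw [hform]
  nlinarith [sq_nonneg δ]

end Landscape

/-! ### Energies of arrays of spins -/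

namespace Grid

/-- Energy of a row of length `N`. -/
def cost (N : ℕ) (a : ℕ → ℤ) : ℤ := ∑ j ∈ Finset.range (N - 1), (a (j + 1) - a j) ^ 2

/-- Energy of an array with `M` rows and `N` columns. -/
def en (M N : ℕ) (s : ℕ → ℕ → ℤ) : ℤ :=
  ∑ i ∈ Finset.range M, cost N (s i) + ∑ j ∈ Finset.range N, cost M (fun i => s i j)

lemma en_swap (M N : ℕ) (s : ℕ → ℕ → ℤ) : en N M (fun i j => s j i) = en M N s :=
  add_comm _ _

lemma cost_nonneg (N : ℕ) (a : ℕ → ℤ) : 0 ≤ cost N a :=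
  Finset.sum_nonneg fun _ _ => sq_nonneg _

lemma cost_congr {N : ℕ} {a b : ℕ → ℤ} (h : ∀ j < N, a j = b j) : cost N a = cost N b := by
  refine Finset.sum_congr rfl fun j hj => ?_
  have := Finset.mem_range.1 hj
  rw [h j (by omega), h (j + 1) (by omega)]

lemma en_congr {M N : ℕ} {s t : ℕ → ℕ → ℤ} (h : ∀ i < M, ∀ j < N, s i j = t i j) :
    en M N s = en M N t := by
  unfold en
  congr 1
  · exact Finset.sum_congr rfl fun i hi => cost_congr fun j hj => h i (Finset.mem_range.1 hi) j hj
  · exact Finset.sum_congr rfl fun j hj => cost_congr fun i hi => h i hi j (Finset.mem_range.1 hj)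

/-- For integers |x| ≤ x², so the energy of a row dominates its total variation. All later energy
estimates come from this. -/
lemma natAbs_sub_le_sum_Ico (a : ℕ → ℤ) {j k : ℕ} (hjk : j ≤ k) :
    ((a j - a k).natAbs : ℤ) ≤ ∑ i ∈ Finset.Ico j k, (a (i + 1) - a i) ^ 2 := by
  induction k, hjk using Nat.le_induction with
  | base => simp
  | succ k hk ih =>
    rw [Finset.sum_Ico_succ_top hk]
    have h : ((a (k + 1) - a k).natAbs : ℤ) ≤ (a (k + 1) - a k) ^ 2 := by
      rw [← Int.natAbs_sq, sq]
      exact_mod_cast Nat.le_mul_self _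
    omega

lemma chain_le_cost (a : ℕ → ℤ) {N j₁ j₂ j₃ j₄ : ℕ} (h₁ : j₁ ≤ j₂) (h₂ : j₂ ≤ j₃) (h₃ : j₃ ≤ j₄)
    (h₄ : j₄ < N) : ((a j₁ - a j₂).natAbs : ℤ) + (a j₂ - a j₃).natAbs + (a j₃ - a j₄).natAbs
      ≤ cost N a := by
  have e1 := natAbs_sub_le_sum_Ico a h₁
  have e2 := natAbs_sub_le_sum_Ico a h₂
  have e3 := natAbs_sub_le_sum_Ico a h₃
  have e4 : ∑ i ∈ Finset.Ico j₁ j₄, (a (i + 1) - a i) ^ 2 ≤ cost N a := by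
    refine Finset.sum_le_sum_of_subset_of_nonneg (fun i hi => ?_) fun _ _ _ => sq_nonneg _
    have := Finset.mem_Ico.1 hi
    exact Finset.mem_range.2 (by omega)
  have e5 := Finset.sum_Ico_consecutive (fun i => (a (i + 1) - a i) ^ 2) h₁ h₂
  have e6 := Finset.sum_Ico_consecutive (fun i => (a (i + 1) - a i) ^ 2) (h₁.trans h₂) h₃
  omega

lemma pair_le_cost (a : ℕ → ℤ) {N j k : ℕ} (hj : j < N) (hk : k < N) :
    ((a j - a k).natAbs : ℤ) ≤ cost N a := by
  rcases le_total j k with h | h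
  · have := chain_le_cost a h le_rfl le_rfl hk
    omega
  · have := chain_le_cost a h le_rfl le_rfl hj
    omega

lemma one_le_cost {a : ℕ → ℤ} {N j k : ℕ} (hj : j < N) (hk : k < N) (h : a j ≠ a k) :
    1 ≤ cost N a := by
  have := pair_le_cost a hj hk
  omega

lemma eq_of_cost_le_zero {a : ℕ → ℤ} {N : ℕ} (h : cost N a ≤ 0) {j k : ℕ} (hj : j < N)
    (hk : k < N) : a j = a k := by
  have := pair_le_cost a hj hk
  omega

lemma exists_jump {a : ℕ → ℤ} {N : ℕ} (h : cost N a = 1) :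
    ∃ v, 0 < v ∧ v < N ∧ (∀ j < v, a j = a 0) ∧ (∀ j, v ≤ j → j < N → a j = a (N - 1)) ∧
      (a 0 - a (N - 1)).natAbs = 1 := by
  have h1 : ∃ j ∈ Finset.range (N - 1), (a (j + 1) - a j) ^ 2 ≠ 0 := by
    by_contra! h2
    rw [cost, Finset.sum_eq_zero h2] at h
    omega
  obtain ⟨j, hj, hne⟩ := h1
  have hj := Finset.mem_range.1 hj
  have hne : a (j + 1) ≠ a j := fun h => hne (by rw [h]; ring)
  have key : ∀ k l, k ≤ j → j + 1 ≤ l → l < N → a k = a j ∧ a l = a (j + 1) ∧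
      (a j - a (j + 1)).natAbs = 1 := by
    intro k l hk hl hlN
    have := chain_le_cost a hk (Nat.le_succ j) hl hlN
    simp only [Nat.succ_eq_add_one] at this
    omega
  obtain ⟨k1, k2, k3⟩ := key 0 (N - 1) (by omega) (by omega) (by omega)
  refine ⟨j + 1, by omega, by omega, fun k hk => ?_, fun l hl hlN => ?_, by rw [k1, k2, k3]⟩
  · rw [(key k (N - 1) (by omega) (by omega) (by omega)).1, k1]
  · rw [(key 0 l (by omega) hl hlN).2.1, k2]

/-- All rows are nonconstant. -/
def RowsNC (M N : ℕ) (s : ℕ → ℕ → ℤ) : Prop := ∀ i < M, 1 ≤ cost N (s i)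

/-- There are a row and a column with all spins equal to `a`. -/
def Cross (M N : ℕ) (s : ℕ → ℕ → ℤ) (a : ℤ) : Prop :=
  (∃ i < M, ∀ j < N, s i j = a) ∧ ∃ j < N, ∀ i < M, s i j = a

lemma Cross.swap {M N : ℕ} {s : ℕ → ℕ → ℤ} {a : ℤ} (h : Cross M N s a) :
    Cross N M (fun i j => s j i) a := ⟨h.2, h.1⟩

lemma Cross.unique {M N : ℕ} {s : ℕ → ℕ → ℤ} {a b : ℤ} (h : Cross M N s a) (h' : Cross M N s b) :
    a = b := by
  obtain ⟨⟨i, hi, h1⟩, -⟩ := h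
  obtain ⟨-, j, hj, h2⟩ := h'
  rw [← h1 j hj, h2 i hi]

lemma Cross.not_rowsNC {M N : ℕ} {s : ℕ → ℕ → ℤ} {a : ℤ} (h : Cross M N s a) :
    ¬ RowsNC M N s := by
  obtain ⟨⟨i, hi, h1⟩, -⟩ := h
  intro h2
  have h3 := h2 i hi
  have : cost N (s i) = 0 := Finset.sum_eq_zero fun j hj => by
    have := Finset.mem_range.1 hj
    rw [h1 j (by omega), h1 (j + 1) (by omega)]; ring
  omega

/-- A constant row and a constant column meet, hence carry the same spin. If they do not both exist,
all rows or all columns are nonconstant. -/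
lemma cross_or_nonconst (M N : ℕ) (s : ℕ → ℕ → ℤ) :
    (∃ a, Cross M N s a) ∨ RowsNC M N s ∨ RowsNC N M (fun i j => s j i) := by
  by_contra! h
  obtain ⟨h1, h2, h3⟩ := h
  simp only [RowsNC, not_forall, not_le] at h2 h3
  obtain ⟨i, hi, h2⟩ := h2
  obtain ⟨j, hj, h3⟩ := h3
  refine h1 (s i j) ⟨⟨i, hi, fun k hk => ?_⟩, j, hj, fun k hk => ?_⟩
  · exact eq_of_cost_le_zero (by omega) hk hj
  · exact eq_of_cost_le_zero (a := fun i => s i j) (by omega) hk hi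

lemma RowsNC.le_sum {M N : ℕ} {s : ℕ → ℕ → ℤ} (h : RowsNC M N s) :
    (M : ℤ) ≤ ∑ i ∈ Finset.range M, cost N (s i) := by
  have := Finset.card_nsmul_le_sum (Finset.range M) (fun i => cost N (s i)) 1
    fun i hi => h i (Finset.mem_range.1 hi)
  simpa using this

lemma RowsNC.lt_sum {M N : ℕ} {s : ℕ → ℕ → ℤ} (h : RowsNC M N s) {i : ℕ} (hi : i < M)
    (h2 : 2 ≤ cost N (s i)) : (M : ℤ) + 1 ≤ ∑ i ∈ Finset.range M, cost N (s i) := by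
  have h3 := Finset.single_le_sum (f := fun i => cost N (s i) - 1) (s := Finset.range M)
    (fun k hk => sub_nonneg.2 (h k (Finset.mem_range.1 hk))) (Finset.mem_range.2 hi)
  rw [Finset.sum_sub_distrib] at h3
  simp at h3
  omega

lemma col_le_sum {M N : ℕ} (s : ℕ → ℕ → ℤ) {j : ℕ} (hj : j < N) :
    cost M (fun i => s i j) ≤ ∑ j ∈ Finset.range N, cost M (fun i => s i j) :=
  Finset.single_le_sum (f := fun j => cost M (fun i => s i j)) (fun _ _ => cost_nonneg _ _)
    (Finset.mem_range.2 hj)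

lemma two_cols_le_sum {M N : ℕ} (s : ℕ → ℕ → ℤ) {j k : ℕ} (hj : j < N) (hk : k < N) (hjk : j ≠ k) :
    cost M (fun i => s i j) + cost M (fun i => s i k)
      ≤ ∑ j ∈ Finset.range N, cost M (fun i => s i j) := by
  rw [← Finset.sum_pair (f := fun j => cost M (fun i => s i j)) hjk]
  refine Finset.sum_le_sum_of_subset_of_nonneg (fun i hi => ?_) fun _ _ _ => cost_nonneg _ _
  rcases Finset.mem_insert.1 hi with rfl | hi
  · exact Finset.mem_range.2 hj
  · rw [Finset.mem_singleton.1 hi]; exact Finset.mem_range.2 hk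

/-- In an array with nonconstant rows and energy at most `M + 1`, at most one column is
nonconstant, and only if no row has energy larger than `1`. -/
lemma RowsNC.col_add_le {M N : ℕ} {s : ℕ → ℕ → ℤ} (h : RowsNC M N s) (he : en M N s ≤ M + 1) :
    ∑ j ∈ Finset.range N, cost M (fun i => s i j) ≤ 1 := by
  have := h.le_sum
  unfold en at he
  omega

/-! #### Strips -/

/-- The first `v` columns and the first `h` sites of the next one, up to a reflection of the rows
(`r`) and of the columns (`c`). -/
def Cell (M N : ℕ) (r c : Bool) (v h i j : ℕ) : Prop :=
  (if c then N - 1 - j else j) < v ∨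
    ((if c then N - 1 - j else j) = v ∧ (if r then M - 1 - i else i) < h)

/-- The array with spins `a` on the cells and `b` elsewhere. -/
def IsStrip (M N : ℕ) (s : ℕ → ℕ → ℤ) (a b : ℤ) (r c : Bool) (v h : ℕ) : Prop :=
  ∀ i < M, ∀ j < N, (Cell M N r c v h i j → s i j = a) ∧ (¬ Cell M N r c v h i j → s i j = b)

/-- Admissible sizes of strips. -/
def Size (M N v h : ℕ) : Prop := 1 ≤ v ∧ v + 1 ≤ N ∧ h < M ∧ (0 < h → v + 2 ≤ N)

/-- The rows use at least M of the available M + 1 units. If no column costs anything, all rows are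
equal and make a single step. Otherwise one column `j₀` makes one step and every row exactly one;
the first and last rows agree off `j₀`, which pins the jump of each row to a side of that column. -/
lemma exists_isStrip {M N : ℕ} (hM : 2 ≤ M) (hN : 2 ≤ N) {s : ℕ → ℕ → ℤ} (hs : RowsNC M N s)
    (he : en M N s ≤ M + 1) : ∃ a b r v h, (a - b : ℤ).natAbs = 1 ∧ Size M N v h ∧
      IsStrip M N s a b r false v h := by
  have hcol := hs.col_add_le he
  by_cases hall : ∀ j < N, cost M (fun i => s i j) ≤ 0
  · have heq : ∀ i < M, ∀ j < N, s i j = s 0 j := fun i hi j hj =>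
      eq_of_cost_le_zero (a := fun i => s i j) (hall j hj) hi (by omega)
    have h1 : cost N (s 0) = 1 := by
      by_contra hne
      have h2 : ∀ i < M, 2 ≤ cost N (s i) := fun i hi => by
        rw [cost_congr (heq i hi)]
        have := hs 0 (by omega)
        omega
      have h3 := Finset.card_nsmul_le_sum (Finset.range M) (fun i => cost N (s i)) 2
        fun i hi => h2 i (Finset.mem_range.1 hi)
      have h4 : 0 ≤ ∑ j ∈ Finset.range N, cost M (fun i => s i j) :=
        Finset.sum_nonneg fun _ _ => cost_nonneg _ _
      simp at h3
      unfold en at he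
      omega
    obtain ⟨v, hv0, hvN, ha, hb, hab⟩ := exists_jump h1
    refine ⟨s 0 0, s 0 (N - 1), false, v, 0, hab, ⟨by omega, by omega, by omega, by omega⟩, ?_⟩
    intro i hi j hj
    simp only [Cell, Bool.false_eq_true, if_false, not_lt_zero, and_false, or_false, not_lt]
    exact ⟨fun h => by rw [heq i hi j hj, ha j h], fun h => by rw [heq i hi j hj, hb j h hj]⟩
  · push Not at hall
    obtain ⟨j₀, hj₀, hcj₀⟩ := hall
    have hcone : cost M (fun i => s i j₀) = 1 := by
      have := col_le_sum (M := M) s hj₀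
      omega
    have heq : ∀ i < M, ∀ j < N, j ≠ j₀ → s i j = s 0 j := fun i hi j hj hne => by
      have := two_cols_le_sum (M := M) s hj hj₀ hne
      exact eq_of_cost_le_zero (a := fun i => s i j) (by omega) hi (by omega)
    have hrow : ∀ i < M, cost N (s i) = 1 := fun i hi => by
      by_contra hne
      have h1 := hs i hi
      have := hs.lt_sum hi (by omega)
      have := col_le_sum (M := M) s hj₀
      unfold en at he
      omega
    obtain ⟨h, hh0, hhM, hp, hq, hpq⟩ := exists_jump hcone
    obtain ⟨v, hv0, hvN, ha, hb, hab⟩ := exists_jump (hrow 0 (by omega))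
    obtain ⟨v', hv0', hvN', ha', hb', hab'⟩ := exists_jump (hrow (M - 1) (by omega))
    have hQ : ∀ j < N, j ≠ j₀ → s (M - 1) j = s 0 j := fun j hj => heq (M - 1) (by omega) j hj
    -- Parity: the first and last entries of column `j₀` would differ by one, and both would differ
    -- by one from a common spin at the other end of their rows.
    have hj0 : j₀ ≠ 0 := by
      rintro rfl
      have := hQ (N - 1) (by omega) (by omega)
      omega
    have hjN : j₀ ≠ N - 1 := by
      rintro rfl
      have := hQ 0 (by omega) (by omega)
      omega
    have e0 := hQ 0 (by omega) (by omega)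
    have eN := hQ (N - 1) (by omega) (by omega)
    have hP : (s 0 j₀ = s 0 0 ∨ s 0 j₀ = s 0 (N - 1)) := by
      rcases lt_or_ge j₀ v with h | h
      · exact Or.inl (ha _ h)
      · exact Or.inr (hb _ h hj₀)
    have hQ' : (s (M - 1) j₀ = s 0 0 ∨ s (M - 1) j₀ = s 0 (N - 1)) := by
      rcases lt_or_ge j₀ v' with h | h
      · exact Or.inl ((ha' _ h).trans e0)
      · exact Or.inr ((hb' _ h hj₀).trans eN)
    have hleft : ∀ j < j₀, s 0 j = s 0 0 := by
      intro j hj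
      rcases lt_or_ge j v with h | h
      · exact ha j h
      · exfalso
        have k1 := hb j h (by omega)
        have k2 := hb j₀ (by omega) hj₀
        have k3 := hQ j (by omega) (by omega)
        rcases lt_or_ge j v' with h' | h'
        · have := ha' j h'
          omega
        · have := hb' j₀ (by omega) hj₀
          omega
    have hright : ∀ j, j₀ < j → j < N → s 0 j = s 0 (N - 1) := by
      intro j hj hjN
      rcases lt_or_ge j v with h | h
      · exfalso
        have k1 := ha j h
        have k2 := ha j₀ (by omega)
        have k3 := hQ j (by omega) (by omega)
        rcases lt_or_ge j v' with h' | h'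
        · have := ha' j₀ (by omega)
          omega
        · have := hb' j h' hjN
          omega
      · exact hb j h hjN
    have hsz : ∀ k, 0 < k → k < M → Size M N j₀ k := fun k h1 h2 =>
      ⟨by omega, by omega, h2, fun _ => by omega⟩
    have hval : ∀ i < M, s i j₀ = if i < h then s 0 j₀ else s (M - 1) j₀ := by
      intro i hi
      split_ifs with hih
      · exact hp i hih
      · exact hq i (by omega) hi
    -- The incomplete column is filled from the first row or from the last one; the latter requires
    -- reflecting the rows and counting `M - h` cells.
    by_cases hpa : s 0 j₀ = s 0 0
    · refine ⟨s 0 0, s 0 (N - 1), false, j₀, h, hab, hsz h hh0 hhM, fun i hi j hj => ?_⟩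
      simp only [Cell, Bool.false_eq_true, if_false]
      have hv := hval i hi
      rcases lt_trichotomy j j₀ with hlt | rfl | hgt
      · have := heq i hi j hj (by omega)
        have := hleft j hlt
        constructor <;> intro <;> omega
      · split_ifs at hv <;> constructor <;> intro <;> omega
      · have := heq i hi j hj (by omega)
        have := hright j hgt hj
        constructor <;> intro <;> omega
    · refine ⟨s 0 0, s 0 (N - 1), true, j₀, M - h, hab, hsz _ (by omega) (by omega),
        fun i hi j hj => ?_⟩
      simp only [Cell, Bool.false_eq_true, if_false, if_true]
      have hv := hval i hi
      rcases lt_trichotomy j j₀ with hlt | rfl | hgt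
      · have := heq i hi j hj (by omega)
        have := hleft j hlt
        constructor <;> intro <;> omega
      · split_ifs at hv <;> constructor <;> intro <;> omega
      · have := heq i hi j hj (by omega)
        have := hright j hgt hj
        constructor <;> intro <;> omega

end Grid

namespace Grid

/-! #### Reflections -/

/-- Reflection of the rows (`r`) and of the columns (`c`). -/
def refl (M N : ℕ) (r c : Bool) (s : ℕ → ℕ → ℤ) (i j : ℕ) : ℤ :=
  s (if r then M - 1 - i else i) (if c then N - 1 - j else j)

lemma cost_reflect (N : ℕ) (a : ℕ → ℤ) : cost N (fun j => a (N - 1 - j)) = cost N a := by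
  unfold cost
  rw [← Finset.sum_range_reflect]
  refine Finset.sum_congr rfl fun j hj => ?_
  have := Finset.mem_range.1 hj
  beta_reduce
  rw [show N - 1 - (N - 1 - 1 - j + 1) = j by omega,
    show N - 1 - (N - 1 - 1 - j) = j + 1 by omega]
  ring

lemma cost_cond (N : ℕ) (c : Bool) (a : ℕ → ℤ) :
    cost N (fun j => a (if c then N - 1 - j else j)) = cost N a := by
  cases c
  · simp
  · simpa using cost_reflect N a

lemma sum_cond (M : ℕ) (r : Bool) (F : ℕ → ℤ) :
    ∑ i ∈ Finset.range M, F (if r then M - 1 - i else i) = ∑ i ∈ Finset.range M, F i := by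
  cases r
  · simp
  · simpa using Finset.sum_range_reflect F M

lemma en_refl (M N : ℕ) (r c : Bool) (s : ℕ → ℕ → ℤ) : en M N (refl M N r c s) = en M N s := by
  unfold en refl
  congr 1
  · rw [← sum_cond M r fun i => cost N (s i)]
    exact Finset.sum_congr rfl fun i _ => cost_cond N c _
  · rw [← sum_cond N c fun j => cost M fun i => s i j]
    exact Finset.sum_congr rfl fun j _ =>
      cost_cond M r fun i => s i (if c then N - 1 - j else j)

lemma cond_lt {M i : ℕ} (r : Bool) (hi : i < M) : (if r then M - 1 - i else i) < M := by
  cases r <;> simp <;> omega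

lemma cond_cond {M i : ℕ} (r : Bool) (hi : i < M) :
    (if r then M - 1 - (if r then M - 1 - i else i) else (if r then M - 1 - i else i)) = i := by
  cases r
  · simp
  · simp; omega

lemma refl_refl {M N : ℕ} {r c : Bool} {s : ℕ → ℕ → ℤ} {i j : ℕ} (hi : i < M) (hj : j < N) :
    refl M N r c (refl M N r c s) i j = s i j := by
  simp only [refl, cond_cond r hi, cond_cond c hj]

lemma RowsNC.refl {M N : ℕ} {s : ℕ → ℕ → ℤ} (h : RowsNC M N s) (r c : Bool) :
    RowsNC M N (refl M N r c s) := by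
  intro i hi
  have := h _ (cond_lt r hi)
  unfold Grid.refl
  rwa [cost_cond N c (s (if r then M - 1 - i else i))]

lemma Cross.refl {M N : ℕ} {s : ℕ → ℕ → ℤ} {a : ℤ} (h : Cross M N s a) (r c : Bool) :
    Cross M N (refl M N r c s) a := by
  obtain ⟨⟨i, hi, h1⟩, j, hj, h2⟩ := h
  refine ⟨⟨_, cond_lt r hi, fun k hk => ?_⟩, _, cond_lt c hj, fun k hk => ?_⟩
  · simp only [Grid.refl, cond_cond r hi]; exact h1 _ (cond_lt c hk)
  · simp only [Grid.refl, cond_cond c hj]; exact h2 _ (cond_lt r hk)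

lemma IsStrip.refl {M N : ℕ} {s : ℕ → ℕ → ℤ} {a b : ℤ} {r c : Bool} {v h : ℕ}
    (hs : IsStrip M N s a b r c v h) :
    IsStrip M N (refl M N r c s) a b false false v h := by
  intro i hi j hj
  have := hs _ (cond_lt r hi) _ (cond_lt c hj)
  unfold Cell at this
  rw [cond_cond r hi, cond_cond c hj] at this
  simpa [Grid.refl, Cell] using this

lemma IsStrip.of_refl {M N : ℕ} {s : ℕ → ℕ → ℤ} {a b : ℤ} {r c : Bool} {v h : ℕ}
    (hs : IsStrip M N (Grid.refl M N r c s) a b false false v h) :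
    IsStrip M N s a b r c v h := by
  intro i hi j hj
  have := hs _ (cond_lt r hi) _ (cond_lt c hj)
  unfold Grid.refl at this
  rw [cond_cond r hi, cond_cond c hj] at this
  simpa [Cell] using this

/-- The complement of a strip is a strip seen from the opposite corner. An incomplete column is
shared, so the complete ones number `N - 1 - v` rather than `N - v`. -/
lemma IsStrip.swap {M N : ℕ} {s : ℕ → ℕ → ℤ} {a b : ℤ} {r c : Bool} {v h : ℕ}
    (hs : IsStrip M N s a b r c v h) (hv : Size M N v h) :
    ∃ v' h', Size M N v' h' ∧ IsStrip M N s b a (!r) (!c) v' h' ∧ v * M + h + (v' * M + h') = M * N := by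
  obtain ⟨h1, h2, h3, h4⟩ := hv
  by_cases h0 : 0 < h
  · refine ⟨N - 1 - v, M - h, ⟨by omega, by omega, by omega, by omega⟩, fun i hi j hj => ?_, ?_⟩
    · obtain ⟨k1, k2⟩ := hs i hi j hj
      have hiff : Cell M N (!r) (!c) (N - 1 - v) (M - h) i j ↔ ¬ Cell M N r c v h i j := by
        unfold Cell
        cases r <;> cases c <;> simp <;> omega
      rw [hiff, not_not]
      exact ⟨k2, k1⟩
    · obtain ⟨k, rfl⟩ := Nat.exists_eq_add_of_le h2
      obtain ⟨l, rfl⟩ := Nat.exists_eq_add_of_lt h3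
      rw [show v + 1 + k - 1 - v = k by omega, show h + l + 1 - h = l + 1 by omega]
      ring
  · refine ⟨N - v, 0, ⟨by omega, by omega, by omega, by omega⟩, fun i hi j hj => ?_, ?_⟩
    · obtain ⟨k1, k2⟩ := hs i hi j hj
      have hiff : Cell M N (!r) (!c) (N - v) 0 i j ↔ ¬ Cell M N r c v h i j := by
        unfold Cell
        cases r <;> cases c <;> simp <;> omega
      rw [hiff, not_not]
      exact ⟨k2, k1⟩
    · obtain ⟨k, rfl⟩ := Nat.exists_eq_add_of_le h2
      rw [show v + 1 + k - v = k + 1 by omega, show h = 0 by omega]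
      ring

/-! #### Flips of one spin -/

/-- `t` is obtained from `s` by a flip at `(i₀, j₀)`. -/
def Flip (M N : ℕ) (s t : ℕ → ℕ → ℤ) (i₀ j₀ : ℕ) : Prop :=
  i₀ < M ∧ j₀ < N ∧ t i₀ j₀ ≠ s i₀ j₀ ∧ ∀ i < M, ∀ j < N, i ≠ i₀ ∨ j ≠ j₀ → t i j = s i j

lemma Flip.symm {M N i₀ j₀ : ℕ} {s t : ℕ → ℕ → ℤ} (h : Flip M N s t i₀ j₀) :
    Flip M N t s i₀ j₀ :=
  ⟨h.1, h.2.1, h.2.2.1.symm, fun i hi j hj hij => (h.2.2.2 i hi j hj hij).symm⟩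

lemma Flip.swap {M N i₀ j₀ : ℕ} {s t : ℕ → ℕ → ℤ} (h : Flip M N s t i₀ j₀) :
    Flip N M (fun i j => s j i) (fun i j => t j i) j₀ i₀ :=
  ⟨h.2.1, h.1, h.2.2.1, fun i hi j hj hij => h.2.2.2 j hj i hi hij.symm⟩

lemma Flip.refl {M N i₀ j₀ : ℕ} {s t : ℕ → ℕ → ℤ} (h : Flip M N s t i₀ j₀) (r c : Bool) :
    Flip M N (refl M N r c s) (refl M N r c t) (if r then M - 1 - i₀ else i₀)
      (if c then N - 1 - j₀ else j₀) := by
  obtain ⟨h1, h2, h3, h4⟩ := h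
  refine ⟨cond_lt r h1, cond_lt c h2, ?_, fun i hi j hj hij => ?_⟩
  · simpa only [Grid.refl, cond_cond r h1, cond_cond c h2] using h3
  · refine h4 _ (cond_lt r hi) _ (cond_lt c hj) ?_
    rcases hij with h | h
    · left; rintro rfl; exact h (cond_cond r hi).symm
    · right; rintro rfl; exact h (cond_cond c hj).symm

/-- The constant row of one array meets the constant column of the other outside the flipped row,
unless both constant rows are the flipped row; they then agree off the flipped site. -/
lemma Flip.cross_unique {M N i₀ j₀ : ℕ} {s t : ℕ → ℕ → ℤ} (h : Flip M N s t i₀ j₀) (hN : 2 ≤ N)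
    {a b : ℤ} (hs : Cross M N s a) (ht : Cross M N t b) : a = b := by
  obtain ⟨h1, h2, h3, h4⟩ := h
  obtain ⟨⟨i, hi, hsi⟩, j, hj, hsj⟩ := hs
  obtain ⟨⟨i', hi', hti⟩, j', hj', htj⟩ := ht
  by_cases hii : i = i₀
  · by_cases hii' : i' = i₀
    · obtain ⟨k, hk, hkj⟩ : ∃ k < N, k ≠ j₀ := by
        by_cases h0 : j₀ = 0
        · exact ⟨1, by omega, by omega⟩
        · exact ⟨0, by omega, by omega⟩
      have e1 := hsi k hk
      have e2 := hti k hk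
      have e3 := h4 i hi k hk (Or.inr hkj)
      rw [hii] at e1 e3
      rw [hii'] at e2
      omega
    · have e1 := hsj i' hi'
      have e2 := hti j hj
      have e3 := h4 i' hi' j hj (Or.inl hii')
      omega
  · have e1 := hsi j' hj'
    have e2 := htj i hi
    have e3 := h4 i hi j' hj' (Or.inl hii)
    omega

/-- At most one column of `s` is nonconstant, whereas two columns of `t` untouched by the flip would
have to be. This keeps horizontal and vertical strips apart. -/
lemma Flip.not_rowsNC_colsNC {M N i₀ j₀ : ℕ} {s t : ℕ → ℕ → ℤ} (h : Flip M N s t i₀ j₀)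
    (hN : 3 ≤ N) (hs : RowsNC M N s) (he : en M N s ≤ M + 1)
    (ht : RowsNC N M (fun i j => t j i)) : False := by
  obtain ⟨h1, h2, h3, h4⟩ := h
  have hcol := hs.col_add_le he
  obtain ⟨j, k, hj, hk, hjk, hj0, hk0⟩ : ∃ j k, j < N ∧ k < N ∧ j ≠ k ∧ j ≠ j₀ ∧ k ≠ j₀ := by
    rcases Nat.lt_or_ge j₀ 1 with h | h
    · exact ⟨1, 2, by omega, by omega, by omega, by omega, by omega⟩
    · rcases Nat.lt_or_ge j₀ 2 with h' | h'
      · exact ⟨0, 2, by omega, by omega, by omega, by omega, by omega⟩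
      · exact ⟨0, 1, by omega, by omega, by omega, by omega, by omega⟩
  have e1 : cost M (fun i => t i j) = cost M (fun i => s i j) :=
    cost_congr fun i hi => h4 i hi j hj (Or.inr hj0)
  have e2 : cost M (fun i => t i k) = cost M (fun i => s i k) :=
    cost_congr fun i hi => h4 i hi k hk (Or.inr hk0)
  have e3 := ht j hj
  have e4 := ht k hk
  have e5 := two_cols_le_sum (M := M) s hj hk hjk
  simp only at e3 e4
  omega

/-- A constant row of `t` can only be the flipped one, all other rows being nonconstant rows of `s`.
-/
lemma Flip.cross_row_eq {M N i₀ j₀ : ℕ} {s t : ℕ → ℕ → ℤ} (h : Flip M N s t i₀ j₀)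
    (hs : RowsNC M N s) {x : ℤ} (ht : Cross M N t x) : ∀ j < N, t i₀ j = x := by
  obtain ⟨⟨i, hi, hti⟩, -⟩ := ht
  by_cases hii : i = i₀
  · rwa [hii] at hti
  · exfalso
    have h1 := hs i hi
    have h2 : cost N (s i) = 0 := Finset.sum_eq_zero fun j hj => by
      have := Finset.mem_range.1 hj
      rw [← h.2.2.2 i hi j (by omega) (Or.inl hii), ← h.2.2.2 i hi (j + 1) (by omega) (Or.inl hii),
        hti j (by omega), hti (j + 1) (by omega)]
      ring
    omega

/-- A strip next to an array with a cross of the background spin has one column. -/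
lemma Flip.strip_of_cross {M N i₀ j₀ : ℕ} {s t : ℕ → ℕ → ℤ} (h : Flip M N s t i₀ j₀)
    (hs : RowsNC M N s) {a x : ℤ} (ht : Cross M N t x) (hax : a ≠ x) {v h' : ℕ} (hsz : Size M N v h')
    (hst : IsStrip M N s a x false false v h') : v = 1 ∧ h' ≤ i₀ ∧ j₀ = 0 := by
  have hrow := h.cross_row_eq hs ht
  obtain ⟨h1, h2, h3, h4⟩ := h
  obtain ⟨z1, z2, z3, z4⟩ := hsz
  have key : ∀ j < N, j ≠ j₀ → ¬ Cell M N false false v h' i₀ j := by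
    intro j hj hne hc
    have e1 := (hst i₀ h1 j hj).1 hc
    have e2 := h4 i₀ h1 j hj (Or.inr hne)
    have e3 := hrow j hj
    omega
  simp only [Cell, Bool.false_eq_true, if_false] at key
  have k0 : j₀ = 0 := by
    by_contra hne
    exact key 0 (by omega) (by omega) (Or.inl (by omega))
  have k1 : v = 1 := by
    by_contra hne
    exact key 1 (by omega) (by omega) (Or.inl (by omega))
  refine ⟨k1, ?_, k0⟩
  by_contra hlt
  have := z4 (by omega)
  exact key 1 (by omega) (by omega) (Or.inr ⟨by omega, by omega⟩)

lemma Flip.strip_of_cross' {M N i₀ j₀ : ℕ} {s t : ℕ → ℕ → ℤ} (h : Flip M N s t i₀ j₀)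
    (hs : RowsNC M N s) {a x : ℤ} (ht : Cross M N t x) (hax : a ≠ x) {r c : Bool} {v h' : ℕ}
    (hsz : Size M N v h') (hst : IsStrip M N s a x r c v h') : v = 1 :=
  ((h.refl r c).strip_of_cross (hs.refl r c) (ht.refl r c) hax hsz hst.refl).1

/-- Neighbours of a strip with an incomplete column. -/
lemma Flip.strip_succ_or_pred {M N i₀ j₀ : ℕ} {s t : ℕ → ℕ → ℤ} (h : Flip M N s t i₀ j₀)
    {a b : ℤ} (hab : a ≠ b) {v k : ℕ} (hsz : Size M N v k) (hk : 0 < k)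
    (hst : IsStrip M N s a b false false v k) (ht : RowsNC M N t) (he : en M N t ≤ M + 1) :
    IsStrip M N t a b false false v (k + 1) ∨ IsStrip M N t a b false false v (k - 1) := by
  obtain ⟨h1, h2, h3, h4⟩ := h
  obtain ⟨z1, z2, z3, z4⟩ := hsz
  have z4 := z4 hk
  have hcol := ht.col_add_le he
  have hS : ∀ i < M, ∀ j < N, ((j < v ∨ (j = v ∧ i < k)) → s i j = a) ∧
      (¬ (j < v ∨ (j = v ∧ i < k)) → s i j = b) := by
    intro i hi j hj
    simpa only [Cell, Bool.false_eq_true, if_false] using hst i hi j hj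
  have e0 := (hS 0 (by omega) v (by omega)).1 (by omega)
  have e1 := (hS (M - 1) (by omega) v (by omega)).2 (by omega)
  -- A flip elsewhere makes a second column nonconstant, while the incomplete column still costs
  -- one.
  have ej : j₀ = v := by
    by_contra hne
    have c1 : 1 ≤ cost M (fun i => t i v) :=
      one_le_cost (j := 0) (k := M - 1) (by omega) (by omega) (by
        rw [h4 0 (by omega) v (by omega) (Or.inr (Ne.symm hne)),
          h4 (M - 1) (by omega) v (by omega) (Or.inr (Ne.symm hne)), e0, e1]
        exact hab)
    have hcs : ∀ i < M, s i j₀ = s i₀ j₀ := by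
      intro i hi
      have a1 := hS i hi j₀ h2
      have a2 := hS i₀ h1 j₀ h2
      by_cases hjv : j₀ < v
      · rw [a1.1 (Or.inl hjv), a2.1 (Or.inl hjv)]
      · rw [a1.2 (by omega), a2.2 (by omega)]
    obtain ⟨i', hi', hne'⟩ : ∃ i' < M, i' ≠ i₀ := by
      by_cases h0 : i₀ = 0
      · exact ⟨1, by omega, by omega⟩
      · exact ⟨0, by omega, by omega⟩
    have c2 : 1 ≤ cost M (fun i => t i j₀) :=
      one_le_cost (j := i') (k := i₀) hi' h1 (by
        rw [h4 i' hi' j₀ h2 (Or.inl hne'), hcs i' hi']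
        exact h3.symm)
    have := two_cols_le_sum (M := M) t h2 (show v < N by omega) hne
    omega
  subst ej
  have hcost := col_le_sum (M := M) t h2
  -- A third spin value would put cost two on its row and at least one on its column, giving energy
  -- at least `M + 2`.
  have hrow : (t i₀ j₀ = a ∨ t i₀ j₀ = b) := by
    by_contra! hu
    have r1 := chain_le_cost (t i₀) (N := N) (j₁ := 0) (j₂ := j₀) (j₃ := N - 1) (j₄ := N - 1)
      (by omega) (by omega) le_rfl (by omega)
    have r2 := h4 i₀ h1 0 (by omega) (Or.inr (by omega))
    have r3 := h4 i₀ h1 (N - 1) (by omega) (Or.inr (by omega))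
    rw [(hS i₀ h1 0 (by omega)).1 (by omega)] at r2
    rw [(hS i₀ h1 (N - 1) (by omega)).2 (by omega)] at r3
    have r4 := ht.lt_sum h1 (by omega)
    have r5 : 1 ≤ cost M (fun i => t i j₀) := by
      by_cases hi0 : i₀ = 0
      · refine one_le_cost (j := i₀) (k := M - 1) h1 (by omega) ?_
        rw [h4 (M - 1) (by omega) j₀ h2 (Or.inl (by omega)), e1]
        exact hu.2
      · refine one_le_cost (j := i₀) (k := 0) h1 (by omega) ?_
        rw [h4 0 (by omega) j₀ h2 (Or.inl (by omega)), e0]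
        exact hu.1
    unfold en at he
    omega
  have f1 := (hS (k - 1) (by omega) j₀ h2).1 (by omega)
  have f2 := (hS k (by omega) j₀ h2).2 (by omega)
  by_cases hik : i₀ < k
  · right
    have hu : t i₀ j₀ = b := by
      have := (hS i₀ h1 j₀ h2).1 (by omega)
      omega
    -- A hole inside the filled part of the column would give it variation two.
    have hi : i₀ = k - 1 := by
      by_contra hne
      have := chain_le_cost (fun i => t i j₀) (N := M) (j₁ := i₀) (j₂ := k - 1) (j₃ := k) (j₄ := k)
        (by omega) (by omega) le_rfl (by omega)
      have g1 := h4 (k - 1) (by omega) j₀ h2 (Or.inl (by omega))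
      have g2 := h4 k (by omega) j₀ h2 (Or.inl (by omega))
      omega
    intro i hi' j hj
    simp only [Cell, Bool.false_eq_true, if_false]
    have a1 := hS i hi' j hj
    by_cases hij : i ≠ i₀ ∨ j ≠ j₀
    · rw [h4 i hi' j hj hij]
      exact ⟨fun hc => a1.1 (by omega), fun hc => a1.2 (by omega)⟩
    · have hi1 : i = i₀ := by omega
      have hj1 : j = j₀ := by omega
      subst hi1 hj1
      exact ⟨fun hc => by omega, fun _ => hu⟩
  · left
    have hu : t i₀ j₀ = a := by
      have := (hS i₀ h1 j₀ h2).2 (by omega)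
      omega
    have hi : i₀ = k := by
      by_contra hne
      have := chain_le_cost (fun i => t i j₀) (N := M) (j₁ := k - 1) (j₂ := k) (j₃ := i₀) (j₄ := i₀)
        (by omega) (by omega) le_rfl (by omega)
      have g1 := h4 (k - 1) (by omega) j₀ h2 (Or.inl (by omega))
      have g2 := h4 k (by omega) j₀ h2 (Or.inl (by omega))
      omega
    intro i hi' j hj
    simp only [Cell, Bool.false_eq_true, if_false]
    have a1 := hS i hi' j hj
    by_cases hij : i ≠ i₀ ∨ j ≠ j₀
    · rw [h4 i hi' j hj hij]
      exact ⟨fun hc => a1.1 (by omega), fun hc => a1.2 (by omega)⟩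
    · have hi1 : i = i₀ := by omega
      have hj1 : j = j₀ := by omega
      subst hi1 hj1
      exact ⟨fun _ => hu, fun hc => by omega⟩

lemma Flip.strip_succ_or_pred' {M N i₀ j₀ : ℕ} {s t : ℕ → ℕ → ℤ} (h : Flip M N s t i₀ j₀)
    {a b : ℤ} (hab : a ≠ b) {r c : Bool} {v k : ℕ} (hsz : Size M N v k) (hk : 0 < k)
    (hst : IsStrip M N s a b r c v k) (ht : RowsNC M N t) (he : en M N t ≤ M + 1) :
    IsStrip M N t a b r c v (k + 1) ∨ IsStrip M N t a b r c v (k - 1) :=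
  ((h.refl r c).strip_succ_or_pred hab hsz hk hst.refl (ht.refl r c)
    (by rwa [en_refl])).imp IsStrip.of_refl IsStrip.of_refl

end Grid

namespace Grid

/-! #### Counting spins -/

/-- Number of spins equal to `x`. -/
def cnt (M N : ℕ) (s : ℕ → ℕ → ℤ) (x : ℤ) : ℕ :=
  ∑ i ∈ Finset.range M, ∑ j ∈ Finset.range N, if s i j = x then 1 else 0

lemma cnt_swap (M N : ℕ) (s : ℕ → ℕ → ℤ) (x : ℤ) : cnt N M (fun i j => s j i) x = cnt M N s x :=
  Finset.sum_comm

lemma sum_cond_nat (M : ℕ) (r : Bool) (F : ℕ → ℕ) :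
    ∑ i ∈ Finset.range M, F (if r then M - 1 - i else i) = ∑ i ∈ Finset.range M, F i := by
  cases r
  · simp
  · simpa using Finset.sum_range_reflect F M

lemma cnt_refl (M N : ℕ) (r c : Bool) (s : ℕ → ℕ → ℤ) (x : ℤ) :
    cnt M N (refl M N r c s) x = cnt M N s x := by
  unfold cnt refl
  rw [← sum_cond_nat M r fun i => ∑ j ∈ Finset.range N, if s i j = x then 1 else 0]
  exact Finset.sum_congr rfl fun i _ => sum_cond_nat N c fun j =>
    if s (if r then M - 1 - i else i) j = x then 1 else 0

lemma sum_range_lt {N w : ℕ} (hw : w ≤ N) :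
    ∑ j ∈ Finset.range N, (if j < w then 1 else 0) = w := by
  rw [Finset.sum_boole]
  have : (Finset.range N).filter (· < w) = Finset.range w := by
    ext j; simp; omega
  rw [this]
  simp

lemma IsStrip.cnt_eq {M N : ℕ} {s : ℕ → ℕ → ℤ} {a b : ℤ} {r c : Bool} {v h : ℕ}
    (hs : IsStrip M N s a b r c v h) (hab : a ≠ b) (hv : v + 1 ≤ N) (hh : h ≤ M) :
    cnt M N s a = v * M + h := by
  rw [← cnt_refl M N r c]
  have hs := hs.refl
  have h1 : ∀ i ∈ Finset.range M, (∑ j ∈ Finset.range N,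
      if Grid.refl M N r c s i j = a then 1 else 0) = v + if i < h then 1 else 0 := by
    intro i hi
    have hi := Finset.mem_range.1 hi
    have h2 : ∀ j ∈ Finset.range N, (if Grid.refl M N r c s i j = a then 1 else 0)
        = if j < v + (if i < h then 1 else 0) then 1 else 0 := by
      intro j hj
      have hc := hs i hi j (Finset.mem_range.1 hj)
      simp only [Cell, Bool.false_eq_true, if_false] at hc
      by_cases hcell : j < v ∨ j = v ∧ i < h
      · rw [hc.1 hcell, if_pos rfl, if_pos]
        split_ifs <;> omega
      · rw [hc.2 hcell, if_neg hab.symm, if_neg]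
        split_ifs <;> omega
    rw [Finset.sum_congr rfl h2, sum_range_lt]
    split_ifs <;> omega
  rw [cnt, Finset.sum_congr rfl h1, Finset.sum_add_distrib, sum_range_lt hh]
  simp [mul_comm]

/-! #### Energies of strips -/

lemma IsStrip.rowsNC {M N : ℕ} {s : ℕ → ℕ → ℤ} {a b : ℤ} {r c : Bool} {v h : ℕ}
    (hs : IsStrip M N s a b r c v h) (hab : a ≠ b) (hsz : 1 ≤ v ∧ v + 1 ≤ N ∧ (0 < h → v + 2 ≤ N)) :
    RowsNC M N s := by
  obtain ⟨h1, h2, h3⟩ := hsz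
  have key : RowsNC M N (Grid.refl M N r c s) := by
    intro i hi
    refine one_le_cost (j := 0) (k := N - 1) (by omega) (by omega) ?_
    rw [(hs.refl i hi 0 (by omega)).1, (hs.refl i hi (N - 1) (by omega)).2]
    · exact hab
    · simp only [Cell, Bool.false_eq_true, if_false]; omega
    · simp only [Cell, Bool.false_eq_true, if_false]; omega
  have := key.refl r c
  intro i hi
  rw [← cost_congr fun j hj => refl_refl (r := r) (c := c) hi hj]
  exact this i hi

lemma IsStrip.lt_en {M N : ℕ} {s : ℕ → ℕ → ℤ} {a b : ℤ} {r c : Bool} {v h : ℕ}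
    (hs : IsStrip M N s a b r c v h) (hab : a ≠ b) (hsz : Size M N v h) (hh : 0 < h) :
    (M : ℤ) + 1 ≤ en M N s := by
  obtain ⟨h1, h2, h3, h4⟩ := hsz
  have hr := ((hs.rowsNC hab ⟨h1, h2, h4⟩).refl r c).le_sum
  rw [← en_refl M N r c]
  have hc : 1 ≤ cost M fun i => Grid.refl M N r c s i v := by
    refine one_le_cost (j := 0) (k := M - 1) (by omega) (by omega) ?_
    rw [(hs.refl 0 (by omega) v (by omega)).1 (by simp [Cell, hh]),
      (hs.refl (M - 1) (by omega) v (by omega)).2 (by simp [Cell]; omega)]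
    exact hab
  have := hc.trans (col_le_sum (M := M) (Grid.refl M N r c s) (j := v) (N := N) (by omega))
  unfold en
  omega

lemma cost_jump_le {N : ℕ} {f : ℕ → ℤ} {a b : ℤ} (hab : (a - b).natAbs = 1) (w : ℕ)
    (h1 : ∀ j < N, j < w → f j = a) (h2 : ∀ j < N, w ≤ j → f j = b) :
    cost N f ≤ if 0 < w ∧ w < N then 1 else 0 := by
  have hsq : (b - a) ^ 2 = 1 := by
    have : b - a = 1 ∨ b - a = -1 := by omega
    rcases this with h | h <;> rw [h] <;> norm_num
  have h3 : cost N f = ∑ j ∈ Finset.range (N - 1), if j = w - 1 ∧ 0 < w then 1 else 0 := by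
    refine Finset.sum_congr rfl fun j hj => ?_
    have hj := Finset.mem_range.1 hj
    rcases lt_trichotomy (j + 1) w with h | h | h
    · rw [h1 j (by omega) (by omega), h1 (j + 1) (by omega) h, if_neg (by omega)]; ring
    · rw [h1 j (by omega) (by omega), h2 (j + 1) (by omega) (by omega), if_pos (by omega), hsq]
    · rw [h2 j (by omega) (by omega), h2 (j + 1) (by omega) (by omega), if_neg (by omega)]; ring
  rw [h3]
  split_ifs with hw
  · simp only [hw.1, and_true, Finset.sum_ite_eq']
    split_ifs <;> omega
  · refine (Finset.sum_eq_zero fun j hj => ?_).le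
    have hj := Finset.mem_range.1 hj
    rw [if_neg]
    omega

lemma sum_range_lt_int {N w : ℕ} (hw : w ≤ N) :
    ∑ j ∈ Finset.range N, (if j < w then (1 : ℤ) else 0) = w := by
  exact_mod_cast congrArg (Nat.cast (R := ℤ)) (sum_range_lt hw)

lemma sum_rows_le {M : ℕ} (F : ℕ → ℤ) (hF : ∀ i < M, F i ≤ 1) :
    ∑ i ∈ Finset.range M, F i ≤ M := by
  have := Finset.sum_le_card_nsmul (Finset.range M) F 1 fun i hi => hF i (Finset.mem_range.1 hi)
  simpa using this

/-- Rows contribute at most M and the incomplete column at most one. An incomplete first or last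
column stays within M, because some rows become constant; so the barrier is not reached near the two
ends of the chain of strips. -/
lemma IsStrip.en_le {M N : ℕ} {s : ℕ → ℕ → ℤ} {a b : ℤ} {r c : Bool} {v h : ℕ}
    (hs : IsStrip M N s a b r c v h) (hab : (a - b).natAbs = 1) (hh : h ≤ M) :
    en M N s ≤ M + 1 ∧ ((h = 0 ∨ h = M ∨ v = 0 ∨ v + 1 = N) → en M N s ≤ M) := by
  rw [← en_refl M N r c]
  set u := Grid.refl M N r c s with hu
  have hs : IsStrip M N u a b false false v h := hs.refl
  have hS : ∀ i < M, ∀ j < N, ((j < v ∨ (j = v ∧ i < h)) → u i j = a) ∧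
      (¬ (j < v ∨ (j = v ∧ i < h)) → u i j = b) := by
    intro i hi j hj
    simpa only [Cell, Bool.false_eq_true, if_false] using hs i hi j hj
  have hrow : ∀ i < M, cost N (u i) ≤
      if 0 < v + (if i < h then 1 else 0) ∧ v + (if i < h then 1 else 0) < N then 1 else 0 := by
    intro i hi
    refine cost_jump_le hab _ (fun j hj hjv => (hS i hi j hj).1 ?_)
      fun j hj hjv => (hS i hi j hj).2 ?_
    · split_ifs at hjv <;> omega
    · split_ifs at hjv <;> omega
  have hcol : ∀ j < N, cost M (fun i => u i j) ≤ if j = v ∧ 0 < h ∧ h < M then 1 else 0 := by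
    intro j hj
    rcases lt_trichotomy j v with hlt | rfl | hgt
    · have := cost_jump_le (N := M) (f := fun i => u i j) hab M
        (fun i hi _ => (hS i hi j hj).1 (by omega)) (fun i hi hi' => by omega)
      rw [if_neg (by omega)] at this ⊢
      exact this
    · have := cost_jump_le (N := M) (f := fun i => u i j) hab h
        (fun i hi _ => (hS i hi j hj).1 (by omega)) (fun i hi hi' => (hS i hi j hj).2 (by omega))
      simpa using this
    · have := cost_jump_le (N := M) (f := fun i => u i j) hab 0
        (fun i hi _ => by omega) (fun i hi hi' => (hS i hi j hj).2 (by omega))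
      rw [if_neg (by omega)] at this ⊢
      exact this
  have hcols : ∑ j ∈ Finset.range N, cost M (fun i => u i j) ≤ if 0 < h ∧ h < M then 1 else 0 := by
    refine (Finset.sum_le_sum fun j hj => hcol j (Finset.mem_range.1 hj)).trans ?_
    split_ifs with hc
    · simp only [hc, and_true, Finset.sum_ite_eq']
      split_ifs <;> omega
    · refine (Finset.sum_eq_zero fun j _ => ?_).le
      rw [if_neg]
      omega
  have hrow1 : ∀ i < M, cost N (u i) ≤ 1 := fun i hi => by
    have := hrow i hi
    split_ifs at this <;> omega
  have hrows := sum_rows_le _ hrow1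
  unfold en
  refine ⟨by split_ifs at hcols <;> omega, fun hcase => ?_⟩
  by_cases hc : 0 < h ∧ h < M
  · rw [if_pos hc] at hcols
    suffices ∑ i ∈ Finset.range M, cost N (u i) ≤ M - 1 by omega
    rcases hcase with h0 | h0 | h0 | h0
    · omega
    · omega
    · have : ∑ i ∈ Finset.range M, cost N (u i) ≤ ∑ i ∈ Finset.range M, if i < h then (1 : ℤ) else 0 := by
        refine Finset.sum_le_sum fun i hi => ?_
        have := hrow i (Finset.mem_range.1 hi)
        split_ifs at this ⊢ <;> omega
      rw [sum_range_lt_int hh] at this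
      omega
    · have : ∑ i ∈ Finset.range M, cost N (u i)
          ≤ ∑ i ∈ Finset.range M, (1 - if i < h then (1 : ℤ) else 0) := by
        refine Finset.sum_le_sum fun i hi => ?_
        have := hrow i (Finset.mem_range.1 hi)
        split_ifs at this ⊢ <;> omega
      rw [Finset.sum_sub_distrib, sum_range_lt_int hh] at this
      simp at this
      omega
  · rw [if_neg hc] at hcols
    omega

/-- In both arrays the column of the flip would be constant, though only one of its M ≥ 2 entries
changes. -/
lemma Flip.not_straight {M N i₀ j₀ : ℕ} {s t : ℕ → ℕ → ℤ} (h : Flip M N s t i₀ j₀) (hM : 2 ≤ M)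
    {a b a' b' : ℤ} {r c r' c' : Bool} {v v' : ℕ} (hs : IsStrip M N s a b r c v 0)
    (ht : IsStrip M N t a' b' r' c' v' 0) : False := by
  obtain ⟨h1, h2, h3, h4⟩ := h
  obtain ⟨i', hi', hne'⟩ : ∃ i' < M, i' ≠ i₀ := by
    by_cases h0 : i₀ = 0
    · exact ⟨1, by omega, by omega⟩
    · exact ⟨0, by omega, by omega⟩
  have key : ∀ {u : ℕ → ℕ → ℤ} {a b : ℤ} {r c : Bool} {v : ℕ}, IsStrip M N u a b r c v 0 →
      u i' j₀ = u i₀ j₀ := by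
    intro u a b r c v hu
    have e1 := hu i' hi' j₀ h2
    have e2 := hu i₀ h1 j₀ h2
    simp only [Cell, not_lt_zero, and_false, or_false] at e1 e2
    by_cases hc : (if c then N - 1 - j₀ else j₀) < v
    · rw [e1.1 hc, e2.1 hc]
    · rw [e1.2 hc, e2.2 hc]
  have e1 := key hs
  have e2 := key ht
  have e3 := h4 i' hi' j₀ h2 (Or.inl hne')
  omega

end Grid

/-! ### Recognising strips from a few known spins. -/

namespace Grid

/-- Arrays of spins `-1`, `0`, `1`. -/
def Spins (M N : ℕ) (s : ℕ → ℕ → ℤ) : Prop := ∀ i < M, ∀ j < N, -1 ≤ s i j ∧ s i j ≤ 1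

lemma IsStrip.eq_or_eq {M N : ℕ} {s : ℕ → ℕ → ℤ} {a b : ℤ} {r c : Bool} {v h : ℕ}
    (hs : IsStrip M N s a b r c v h) {i j : ℕ} (hi : i < M) (hj : j < N) :
    s i j = a ∨ s i j = b := by
  by_cases hc : Cell M N r c v h i j
  · exact Or.inl ((hs i hi j hj).1 hc)
  · exact Or.inr ((hs i hi j hj).2 hc)

lemma IsStrip.exists_fst {M N : ℕ} {s : ℕ → ℕ → ℤ} {a b : ℤ} {r c : Bool} {v h : ℕ}
    (hs : IsStrip M N s a b r c v h) (hsz : Size M N v h) {i : ℕ} (hi : i < M) :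
    ∃ j < N, s i j = a := by
  obtain ⟨h1, h2, h3, h4⟩ := hsz
  cases c
  · exact ⟨0, by omega, (hs i hi 0 (by omega)).1 (Or.inl (by simp; omega))⟩
  · exact ⟨N - 1, by omega, (hs i hi (N - 1) (by omega)).1 (Or.inl (by simp; omega))⟩

/-- A low-energy array with nonconstant rows, of which two known spins differ by one, is a
strip with these spins. -/
lemma RowsNC.exists_strip {M N : ℕ} (hM : 2 ≤ M) (hN : 2 ≤ N) {s : ℕ → ℕ → ℤ} (hs : RowsNC M N s)
    (he : en M N s ≤ M + 1) {a b : ℤ} (hab : a ≠ b) {i j i' j' : ℕ} (hi : i < M) (hj : j < N)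
    (hi' : i' < M) (hj' : j' < N) (ha : s i j = a) (hb : s i' j' = b) :
    ∃ r c v h, Size M N v h ∧ IsStrip M N s a b r c v h := by
  obtain ⟨x, y, r, v, h, hxy, hsz, hst⟩ := exists_isStrip hM hN hs he
  have e1 := hst.eq_or_eq hi hj
  have e2 := hst.eq_or_eq hi' hj'
  by_cases hx : x = a
  · have : y = b := by omega
    subst hx this
    exact ⟨r, false, v, h, hsz, hst⟩
  · have e3 : y = a := by omega
    have e4 : x = b := by omega
    subst e3 e4
    obtain ⟨v', h', hsz', hst', -⟩ := hst.swap hsz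
    exact ⟨_, _, v', h', hsz', hst'⟩

/-- A low-energy array with nonconstant rows and a spin `-1` is a strip. -/
lemma RowsNC.exists_strip_neg {M N : ℕ} (hM : 2 ≤ M) (hN : 2 ≤ N) {s : ℕ → ℕ → ℤ}
    (hs : RowsNC M N s) (hsp : Spins M N s) (he : en M N s ≤ M + 1) {i j : ℕ} (hi : i < M)
    (hj : j < N) (ha : s i j = -1) : ∃ r c v h, Size M N v h ∧ IsStrip M N s (-1) 0 r c v h := by
  obtain ⟨x, y, r, v, h, hxy, hsz, hst⟩ := exists_isStrip hM hN hs he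
  obtain ⟨k, hk, hx⟩ := hst.exists_fst hsz hi
  obtain ⟨v', h', hsz', hst', -⟩ := hst.swap hsz
  obtain ⟨k', hk', hy⟩ := hst'.exists_fst hsz' hi
  have e1 := hst.eq_or_eq hi hj
  have b1 := hsp i hi k hk
  have b2 := hsp i hi k' hk'
  have : x = 0 ∨ y = 0 := by omega
  rcases this with h0 | h0
  · exact hs.exists_strip hM hN he (by omega) hi hj hi hk ha (by omega)
  · exact hs.exists_strip hM hN he (by omega) hi hj hi hk' ha (by omega)

lemma RowsNC.exists_strip_zero {M N : ℕ} (hM : 2 ≤ M) (hN : 2 ≤ N) {s : ℕ → ℕ → ℤ}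
    (hs : RowsNC M N s) (hsp : Spins M N s) (he : en M N s ≤ M + 1) {i j : ℕ} (hi : i < M)
    (hj : j < N) (ha : s i j = -1) : ∃ r c v h, Size M N v h ∧ IsStrip M N s 0 (-1) r c v h := by
  obtain ⟨r, c, v, h, hsz, hst⟩ := hs.exists_strip_neg hM hN hsp he hi hj ha
  obtain ⟨v', h', hsz', hst', -⟩ := hst.swap hsz
  exact ⟨_, _, v', h', hsz', hst'⟩

lemma exists_ne {M : ℕ} (hM : 2 ≤ M) (i : ℕ) : ∃ k < M, k ≠ i := by
  by_cases h : i = 0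
  · exact ⟨1, by omega, by omega⟩
  · exact ⟨0, by omega, by omega⟩

/-- Away from the changed row, two neighbouring arrays agree, so that a neighbour of a strip with
nonconstant rows is a strip with the same spins. -/
lemma Flip.exists_strip {M N i₀ j₀ : ℕ} {s t : ℕ → ℕ → ℤ} (h : Flip M N s t i₀ j₀) (hM : 2 ≤ M)
    (hN : 2 ≤ N) {a b : ℤ} (hab : a ≠ b) {r c : Bool} {v k : ℕ} (hsz : Size M N v k)
    (hst : IsStrip M N s a b r c v k) (ht : RowsNC M N t) (he : en M N t ≤ M + 1) :
    ∃ r c v h, Size M N v h ∧ IsStrip M N t a b r c v h := by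
  obtain ⟨i, hi, hne⟩ := exists_ne hM i₀
  obtain ⟨j, hj, ha⟩ := hst.exists_fst hsz hi
  obtain ⟨v', h', hsz', hst', -⟩ := hst.swap hsz
  obtain ⟨j', hj', hb⟩ := hst'.exists_fst hsz' hi
  exact ht.exists_strip hM hN he hab hi hj hi hj' ((h.2.2.2 i hi j hj (Or.inl hne)).trans ha)
    ((h.2.2.2 i hi j' hj' (Or.inl hne)).trans hb)

/-- Neighbouring low-energy strips are obtained from each other by adding one cell to an
incomplete column. -/
lemma Flip.strip_pair {M N i₀ j₀ : ℕ} {s t : ℕ → ℕ → ℤ} (h : Flip M N s t i₀ j₀) (hM : 2 ≤ M)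
    (hN : 2 ≤ N) {a b : ℤ} (hab : a ≠ b) {r c : Bool} {v k : ℕ} (hsz : Size M N v k)
    (hst : IsStrip M N s a b r c v k) (hs : RowsNC M N s) (hes : en M N s ≤ M + 1)
    (ht : RowsNC M N t) (he : en M N t ≤ M + 1) :
    ∃ r c v k, 1 ≤ v ∧ v + 2 ≤ N ∧ k < M ∧
      ((IsStrip M N s a b r c v k ∧ IsStrip M N t a b r c v (k + 1)) ∨
        (IsStrip M N t a b r c v k ∧ IsStrip M N s a b r c v (k + 1))) := by
  have key : ∀ {s t : ℕ → ℕ → ℤ} {r c : Bool} {v k : ℕ}, Flip M N s t i₀ j₀ → Size M N v k →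
      0 < k → IsStrip M N s a b r c v k → RowsNC M N t → en M N t ≤ M + 1 →
      ∃ r c v k, 1 ≤ v ∧ v + 2 ≤ N ∧ k < M ∧
        ((IsStrip M N s a b r c v k ∧ IsStrip M N t a b r c v (k + 1)) ∨
          (IsStrip M N t a b r c v k ∧ IsStrip M N s a b r c v (k + 1))) := by
    intro s t r c v k h hsz hk hst ht he
    have h4 := hsz.2.2.2 hk
    rcases h.strip_succ_or_pred' hab hsz hk hst ht he with h' | h'
    · exact ⟨r, c, v, k, hsz.1, h4, hsz.2.2.1, Or.inl ⟨hst, h'⟩⟩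
    · refine ⟨r, c, v, k - 1, hsz.1, h4, by have := hsz.2.2.1; omega, Or.inr ⟨h', ?_⟩⟩
      rwa [Nat.sub_add_cancel hk]
  -- If `s` consists of complete columns, `t` cannot, so the argument applies with the arrays
  -- exchanged.
  rcases Nat.eq_zero_or_pos k with rfl | hk
  · obtain ⟨r', c', v', k', hsz', ht'⟩ := h.exists_strip hM hN hab hsz hst ht he
    rcases Nat.eq_zero_or_pos k' with rfl | hk'
    · exact (h.not_straight hM hst ht').elim
    · obtain ⟨r, c, v, k, h1, h2, h3, h4⟩ := key h.symm hsz' hk' ht' hs hes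
      exact ⟨r, c, v, k, h1, h2, h3, h4.symm⟩
  · exact key h hsz hk hst ht he

/-! #### Arrays on the side of `-1` -/

/-- Strips of spins `-1` in spins `0`, other than a single column. -/
def Thick (M N : ℕ) (s : ℕ → ℕ → ℤ) : Prop :=
  ∃ r c v h, Size M N v h ∧ IsStrip M N s (-1) 0 r c v h ∧ (v ≠ 1 ∨ h ≠ 0)

/-- A single boundary column of spins `-1` in spins `0`. -/
def Thin (M N : ℕ) (s : ℕ → ℕ → ℤ) : Prop := ∃ r c, IsStrip M N s (-1) 0 r c 1 0

/-- One site of the first column is missing, and the second column contains `h` spins `-1`. -/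
def IsEll (M N : ℕ) (s : ℕ → ℕ → ℤ) (h : ℕ) : Prop :=
  ∀ i < M, ∀ j < N, s i j = if (j = 0 ∧ i + 1 < M) ∨ (j = 1 ∧ i < h) then -1 else 0

def Ell (M N : ℕ) (s : ℕ → ℕ → ℤ) : Prop :=
  ∃ r c h, 1 ≤ h ∧ h + 1 ≤ M ∧ IsEll M N (refl M N r c s) h

lemma sum_ge {M p q : ℕ} {F : ℕ → ℤ} (hp : p < M) (hq : q < M) (hpq : p ≠ q)
    (h : ∀ i < M, i ≠ p → i ≠ q → 1 ≤ F i) : (M : ℤ) - 2 + F p + F q ≤ ∑ i ∈ Finset.range M, F i := by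
  have hsub : ({p, q} : Finset ℕ) ⊆ Finset.range M := by
    intro i hi
    rcases Finset.mem_insert.1 hi with rfl | hi
    · exact Finset.mem_range.2 hp
    · rw [Finset.mem_singleton.1 hi]; exact Finset.mem_range.2 hq
  rw [← Finset.sum_sdiff hsub, Finset.sum_pair hpq]
  have h1 := Finset.card_nsmul_le_sum (Finset.range M \ {p, q}) F 1 fun i hi => by
    simp at hi
    exact h i hi.1 (by tauto) (by tauto)
  rw [Finset.card_sdiff_of_subset hsub, Finset.card_pair hpq, Finset.card_range] at h1
  simp only [nsmul_eq_mul, mul_one] at h1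
  change _ ≤ (Finset.range M \ {p, q}).sum F at h1
  change _ ≤ (Finset.range M \ {p, q}).sum F + _
  omega

lemma three_le_sum {N p q r : ℕ} {F : ℕ → ℤ} (hF : ∀ i, 0 ≤ F i) (hp : p < N) (hq : q < N)
    (hr : r < N) (hpq : p ≠ q) (hpr : p ≠ r) (hqr : q ≠ r) :
    F p + F q + F r ≤ ∑ i ∈ Finset.range N, F i := by
  have : ∑ i ∈ ({p, q, r} : Finset ℕ), F i = F p + F q + F r := by
    rw [Finset.sum_insert (by simp; tauto), Finset.sum_pair hqr]; ring
  rw [← this]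
  refine Finset.sum_le_sum_of_subset_of_nonneg (fun i hi => ?_) fun _ _ _ => hF _
  simp at hi
  rcases hi with rfl | rfl | rfl <;> simpa

/-- All rows but the last are nonconstant, and so are two columns: at least M - 1 + 2. Hence such
arrays matter only if M is the short side. -/
lemma IsEll.lt_en {M N : ℕ} {s : ℕ → ℕ → ℤ} {h : ℕ} (hs : IsEll M N s h) (h1 : 1 ≤ h)
    (h2 : h + 1 ≤ M) (hN : 3 ≤ N) : (M : ℤ) + 1 ≤ en M N s := by
  have hr : ∀ i < M, i + 1 < M → 1 ≤ cost N (s i) := fun i hi hi' =>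
    one_le_cost (j := 0) (k := 2) (by omega) (by omega) (by
      rw [hs i hi 0 (by omega), hs i hi 2 (by omega)]; simp [hi'])
  have hsum := sum_ge (M := M) (p := 0) (q := M - 1) (F := fun i => cost N (s i)) (by omega)
    (by omega) (by omega) fun i hi _ h => hr i hi (by omega)
  have h3 := hr 0 (by omega) (by omega)
  have h4 := cost_nonneg N (s (M - 1))
  have c0 : 1 ≤ cost M fun i => s i 0 := one_le_cost (j := 0) (k := M - 1) (by omega) (by omega) (by
    rw [hs 0 (by omega) 0 (by omega), hs (M - 1) (by omega) 0 (by omega),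
      if_pos (by omega), if_neg (by omega)]; decide)
  have c1 : 1 ≤ cost M fun i => s i 1 := one_le_cost (j := 0) (k := M - 1) (by omega) (by omega) (by
    rw [hs 0 (by omega) 1 (by omega), hs (M - 1) (by omega) 1 (by omega),
      if_pos (by omega), if_neg (by omega)]; decide)
  have := two_cols_le_sum (M := M) (N := N) s (j := 0) (k := 1) (by omega) (by omega) (by omega)
  beta_reduce at hsum
  unfold en
  omega

lemma Ell.lt_en {M N : ℕ} {s : ℕ → ℕ → ℤ} (hs : Ell M N s) (hN : 3 ≤ N) :
    (M : ℤ) + 1 ≤ en M N s := by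
  obtain ⟨r, c, h, h1, h2, hs⟩ := hs
  rw [← en_refl M N r c]
  exact hs.lt_en h1 h2 hN

end Grid

/-! ### One-step moves between crosses, thick strips and single columns. -/

namespace Grid

lemma exists_two_ne {N : ℕ} (hN : 3 ≤ N) (k : ℕ) : ∃ j j', j < N ∧ j' < N ∧ j ≠ j' ∧ j ≠ k ∧ j' ≠ k := by
  rcases Nat.lt_or_ge k 1 with h | h
  · exact ⟨1, 2, by omega, by omega, by omega, by omega, by omega⟩
  · by_cases h1 : k = 1
    · exact ⟨0, 2, by omega, by omega, by omega, by omega, by omega⟩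
    · exact ⟨0, 1, by omega, by omega, by omega, by omega, by omega⟩

/-- The flipped row keeps at least two spins -1 (this needs N ≥ 3), whereas a single column has only
one in each row. -/
lemma Flip.thick_of_cross {M N i₀ j₀ : ℕ} {s t : ℕ → ℕ → ℤ} (h : Flip M N s t i₀ j₀) (hM : 2 ≤ M)
    (hN : 3 ≤ N) (hs : Cross M N s (-1)) (ht : RowsNC M N t) (hsp : Spins M N t)
    (he : en M N t ≤ M + 1) : Thick M N t := by
  have hrow := h.symm.cross_row_eq ht hs
  obtain ⟨j, j', hj, hj', hjj, hjk, hjk'⟩ := exists_two_ne hN j₀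
  have e1 := (h.2.2.2 i₀ h.1 j hj (Or.inr hjk)).trans (hrow j hj)
  have e2 := (h.2.2.2 i₀ h.1 j' hj' (Or.inr hjk')).trans (hrow j' hj')
  obtain ⟨r, c, v, k, hsz, hst⟩ := ht.exists_strip_neg hM (by omega) hsp he h.1 hj e1
  refine ⟨r, c, v, k, hsz, hst, ?_⟩
  by_contra! hc
  obtain ⟨rfl, rfl⟩ := hc
  have c1 : Cell M N r c 1 0 i₀ j := by
    by_contra hn
    have := (hst i₀ h.1 j hj).2 hn
    omega
  have c2 : Cell M N r c 1 0 i₀ j' := by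
    by_contra hn
    have := (hst i₀ h.1 j' hj').2 hn
    omega
  simp only [Cell, not_lt_zero, and_false, or_false] at c1 c2
  split_ifs at c1 c2 <;> omega

lemma Thick.rowsNC {M N : ℕ} {s : ℕ → ℕ → ℤ} (hs : Thick M N s) : RowsNC M N s := by
  obtain ⟨r, c, v, h, hsz, hst, -⟩ := hs
  exact hst.rowsNC (by decide) ⟨hsz.1, hsz.2.1, hsz.2.2.2⟩

lemma Flip.thick_or_thin {M N i₀ j₀ : ℕ} {s t : ℕ → ℕ → ℤ} (h : Flip M N s t i₀ j₀) (hM : 2 ≤ M)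
    (hN : 2 ≤ N) (hs : Thick M N s) (ht : RowsNC M N t) (he : en M N t ≤ M + 1) :
    Thick M N t ∨ Thin M N t := by
  obtain ⟨r, c, v, k, hsz, hst, -⟩ := hs
  obtain ⟨r, c, v, k, hsz, hst⟩ := h.exists_strip hM hN (by decide) hsz hst ht he
  by_cases hc : v ≠ 1 ∨ k ≠ 0
  · exact Or.inl ⟨r, c, v, k, hsz, hst, hc⟩
  · push Not at hc
    obtain ⟨rfl, rfl⟩ := hc
    exact Or.inr ⟨r, c, hst⟩

/-- The two arrays cannot both be strips of complete columns. -/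
lemma Flip.not_thick_thin {M N i₀ j₀ : ℕ} {s t : ℕ → ℕ → ℤ} (h : Flip M N s t i₀ j₀) (hM : 2 ≤ M)
    (hs : Thick M N s) (he : en M N s ≤ M) (ht : Thin M N t) : False := by
  obtain ⟨r, c, v, k, hsz, hst, -⟩ := hs
  obtain ⟨r', c', ht⟩ := ht
  rcases Nat.eq_zero_or_pos k with rfl | hk
  · exact h.not_straight hM hst ht
  · have := hst.lt_en (by decide) hsz hk
    omega

/-- A strip next to a cross of zeros has one full column and part of a second, and the flip erases a
site of the full column beside a zero. At low energy that site must be its extremity. -/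
lemma Flip.ell_of_thick {M N i₀ j₀ : ℕ} {s t : ℕ → ℕ → ℤ} (h : Flip M N s t i₀ j₀) (hM : 2 ≤ M)
    (hN : 3 ≤ N) (hs : Thick M N s) (ht : Cross M N t 0) (he : en M N t ≤ M + 1) : Ell M N t := by
  have hsr := hs.rowsNC
  obtain ⟨r, c, v, k, hsz, hst, hvk⟩ := hs
  have h := h.refl r c
  have hsr := hsr.refl r c
  have ht := ht.refl r c
  have hst := hst.refl
  rw [← en_refl M N r c] at he
  obtain ⟨rfl, hki, hj⟩ := h.strip_of_cross hsr ht (by decide) hsz hst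
  have hrow := h.cross_row_eq hsr ht
  rw [hj] at h
  set i₁ := if r then M - 1 - i₀ else i₀
  set s' := Grid.refl M N r c s
  set t' := Grid.refl M N r c t with htt
  have hk : 1 ≤ k := by omega
  have hkM := hsz.2.2.1
  obtain ⟨h1, h2, h3, h4⟩ := h
  have hst : ∀ i < M, ∀ j < N, s' i j = if j = 0 ∨ (j = 1 ∧ i < k) then -1 else 0 := by
    intro i hi j hj
    have := hst i hi j hj
    simp only [Cell, Bool.false_eq_true, if_false] at this
    split_ifs with hc
    · exact this.1 (by omega)
    · exact this.2 (by omega)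
  by_cases hi1 : i₁ + 1 = M
  · refine ⟨r, c, k, hk, by omega, fun i hi j hj => ?_⟩
    rw [← htt]
    by_cases hij : i = i₁
    · subst hij
      rw [hrow j hj, if_neg (by omega)]
    · rw [h4 i hi j hj (Or.inl hij), hst i hi j hj]
      have : i + 1 < M := by omega
      simp [this]
  -- A hole inside the first column costs two there and one in the second column, on top of M - 1
  -- nonconstant rows.
  · exfalso
    have T : ∀ i < M, i ≠ i₁ → ∀ j < N, t' i j = if j = 0 ∨ (j = 1 ∧ i < k) then -1 else 0 :=
      fun i hi hne j hj => (h4 i hi j hj (Or.inl hne)).trans (hst i hi j hj)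
    have hr : ∀ i < M, i ≠ i₁ → 1 ≤ cost N (t' i) := fun i hi hne =>
      one_le_cost (j := 0) (k := 2) (by omega) (by omega) (by
        rw [T i hi hne 0 (by omega), T i hi hne 2 (by omega)]; simp)
    have hsum := sum_ge (M := M) (p := 0) (q := i₁) (F := fun i => cost N (t' i)) (by omega)
      (by omega) (by omega) fun i hi _ h => hr i hi (by omega)
    have e1 := hr 0 (by omega) (by omega)
    have e2 := cost_nonneg N (t' i₁)
    have c0 := chain_le_cost (fun i => t' i 0) (N := M) (j₁ := 0) (j₂ := i₁) (j₃ := M - 1)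
      (j₄ := M - 1) (by omega) (by omega) (by omega) (by omega)
    have c1 := pair_le_cost (fun i => t' i 1) (N := M) (j := 0) (k := i₁) (by omega) (by omega)
    have := two_cols_le_sum (M := M) (N := N) t' (j := 0) (k := 1) (by omega) (by omega) (by omega)
    beta_reduce at hsum c0 c1
    rw [T 0 (by omega) (by omega) 0 (by omega), T (M - 1) (by omega) (by omega) 0 (by omega),
      hrow 0 (by omega)] at c0
    rw [T 0 (by omega) (by omega) 1 (by omega), hrow 1 (by omega), if_pos (by omega)] at c1
    simp at c0 c1
    unfold en at he
    omega

lemma Thick.eq_or_eq {M N : ℕ} {s : ℕ → ℕ → ℤ} (hs : Thick M N s) {i j : ℕ} (hi : i < M)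
    (hj : j < N) : s i j = -1 ∨ s i j = 0 := by
  obtain ⟨r, c, v, k, hsz, hst, -⟩ := hs
  exact hst.eq_or_eq hi hj

lemma IsEll.cross {M N : ℕ} {s : ℕ → ℕ → ℤ} {h : ℕ} (hs : IsEll M N s h) (h2 : h + 1 ≤ M)
    (hN : 3 ≤ N) : Cross M N s 0 :=
  ⟨⟨M - 1, by omega, fun j hj => by rw [hs _ (by omega) j hj, if_neg (by omega)]⟩,
    2, by omega, fun i hi => by rw [hs i hi 2 (by omega), if_neg (by omega)]⟩

lemma IsEll.en_le {M N : ℕ} {s : ℕ → ℕ → ℤ} (hs : IsEll M N s 0) : en M N s ≤ M := by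
  have : IsStrip M N s (-1) 0 false false 0 (M - 1) := by
    intro i hi j hj
    rw [hs i hi j hj]
    simp only [Cell, Bool.false_eq_true, if_false]
    constructor
    · intro h; rw [if_pos (by omega)]
    · intro h; rw [if_neg (by omega)]
  exact (this.en_le (by decide) (by omega)).2 (by omega)

/-- A rectangle of two columns with one missing corner. -/
lemma en_le_of_corner {M N : ℕ} (hN : 3 ≤ N) {s : ℕ → ℕ → ℤ} {h : ℕ} (hh : h + 2 ≤ M)
    (hs : ∀ i < M, ∀ j < N, s i j = if (j = 0 ∧ i + 2 < M) ∨ (j = 1 ∧ i < h) then -1 else 0) :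
    en M N s ≤ M := by
  have hrow : ∀ i < M, cost N (s i) ≤ if i < M - 2 then 1 else 0 := by
    intro i hi
    by_cases hc : i < M - 2
    · rw [if_pos hc]
      by_cases hih : i < h
      · have := cost_jump_le (N := N) (f := s i) (a := -1) (b := 0) (by decide) 2
          (fun j hj h => by rw [hs i hi j hj, if_pos (by omega)])
          (fun j hj h => by rw [hs i hi j hj, if_neg (by omega)])
        split_ifs at this <;> omega
      · have := cost_jump_le (N := N) (f := s i) (a := -1) (b := 0) (by decide) 1
          (fun j hj h => by rw [hs i hi j hj, if_pos (by omega)])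
          (fun j hj h => by rw [hs i hi j hj, if_neg (by omega)])
        split_ifs at this <;> omega
    · rw [if_neg hc]
      have := cost_jump_le (N := N) (f := s i) (a := -1) (b := 0) (by decide) 0
        (fun j hj h => by omega) (fun j hj h => by rw [hs i hi j hj, if_neg (by omega)])
      simpa using this
  have hcol : ∀ j < N, cost M (fun i => s i j) ≤ if j < 2 then 1 else 0 := by
    intro j hj
    rcases Nat.lt_or_ge j 2 with h2 | h2
    · rw [if_pos h2]
      have : j = 0 ∨ j = 1 := by omega
      rcases this with rfl | rfl
      · have := cost_jump_le (N := M) (f := fun i => s i 0) (a := -1) (b := 0) (by decide) (M - 2)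
          (fun i hi h => by rw [hs i hi 0 hj, if_pos (by omega)])
          (fun i hi h => by rw [hs i hi 0 hj, if_neg (by omega)])
        split_ifs at this <;> omega
      · have := cost_jump_le (N := M) (f := fun i => s i 1) (a := -1) (b := 0) (by decide) h
          (fun i hi h => by rw [hs i hi 1 hj, if_pos (by omega)])
          (fun i hi h => by rw [hs i hi 1 hj, if_neg (by omega)])
        split_ifs at this <;> omega
    · rw [if_neg (by omega)]
      have := cost_jump_le (N := M) (f := fun i => s i j) (a := -1) (b := 0) (by decide) 0
        (fun i hi h => by omega)
        (fun i hi h => by rw [hs i hi j hj, if_neg (by omega)])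
      simpa using this
  have h1 := (Finset.sum_le_sum fun i hi => hrow i (Finset.mem_range.1 hi)).trans_eq
    (sum_range_lt_int (N := M) (w := M - 2) (by omega))
  have h2 := (Finset.sum_le_sum fun j hj => hcol j (Finset.mem_range.1 hj)).trans_eq
    (sum_range_lt_int (N := N) (w := 2) (by omega))
  unfold en
  omega

end Grid

/-! ### Leaving the truncated columns, and closing up the side of -1. -/

namespace Grid

section

variable {M N i₀ j₀ k : ℕ} {s t : ℕ → ℕ → ℤ}

lemma Flip.ell_col_zero_ne (h : Flip M N s t i₀ j₀) (hs : IsEll M N s k) (hM : 3 ≤ M) (hj : j₀ ≠ 0)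
    (hN : 3 ≤ N) : 1 ≤ cost M (fun i => t i 0) :=
  one_le_cost (j := 0) (k := M - 1) (by omega) (by omega) (by
    rw [h.2.2.2 0 (by omega) 0 (by omega) (Or.inr hj.symm),
      h.2.2.2 (M - 1) (by omega) 0 (by omega) (Or.inr hj.symm),
      hs 0 (by omega) 0 (by omega), hs (M - 1) (by omega) 0 (by omega),
      if_pos (by omega), if_neg (by omega)]; decide)

lemma Flip.ell_col_one_ne (h : Flip M N s t i₀ j₀) (hs : IsEll M N s k) (hk : 1 ≤ k)
    (hkM : k + 1 ≤ M) (hM : 3 ≤ M) (hj : j₀ ≠ 1) (hN : 3 ≤ N) : 1 ≤ cost M (fun i => t i 1) :=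
  one_le_cost (j := 0) (k := M - 1) (by omega) (by omega) (by
    rw [h.2.2.2 0 (by omega) 1 (by omega) (Or.inr hj.symm),
      h.2.2.2 (M - 1) (by omega) 1 (by omega) (Or.inr hj.symm),
      hs 0 (by omega) 1 (by omega), hs (M - 1) (by omega) 1 (by omega),
      if_pos (by omega), if_neg (by omega)]; decide)

/-- Changes outside of the first two columns cost too much. -/
lemma Flip.ell_col_lt (h : Flip M N s t i₀ j₀) (hs : IsEll M N s k) (hk : 1 ≤ k) (hkM : k + 1 ≤ M)
    (hM : 3 ≤ M) (hN : 4 ≤ N) (he : en M N t ≤ M + 1) : j₀ < 2 := by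
  by_contra! hj
  have c0 := h.ell_col_zero_ne hs hM (by omega) (by omega)
  have c1 := h.ell_col_one_ne hs hk hkM hM (by omega) (by omega)
  obtain ⟨h1, h2, h3, h4⟩ := h
  obtain ⟨i, hi, hne⟩ := exists_ne (M := M) (by omega) i₀
  have c2 : 1 ≤ cost M (fun i => t i j₀) := one_le_cost (j := i₀) (k := i) h1 hi (by
    rw [h4 i hi j₀ h2 (Or.inl hne)]
    rw [hs i₀ h1 j₀ h2, if_neg (by omega)] at h3
    rwa [hs i hi j₀ h2, if_neg (by omega)])
  obtain ⟨j, hj2, hjN, hjj⟩ : ∃ j, 2 ≤ j ∧ j < N ∧ j ≠ j₀ := by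
    by_cases h : j₀ = 2
    · exact ⟨3, by omega, by omega, by omega⟩
    · exact ⟨2, by omega, by omega, by omega⟩
  have hr : ∀ i < M, i + 1 < M → 1 ≤ cost N (t i) := fun i hi hi' =>
    one_le_cost (j := 0) (k := j) (by omega) (by omega) (by
      rw [h4 i hi 0 (by omega) (by omega), h4 i hi j hjN (by omega), hs i hi 0 (by omega),
        hs i hi j hjN, if_pos (by omega), if_neg (by omega)]; decide)
  have hsum := sum_ge (M := M) (p := 0) (q := M - 1) (F := fun i => cost N (t i)) (by omega)
    (by omega) (by omega) fun i hi _ h => hr i hi (by omega)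
  have e1 := hr 0 (by omega) (by omega)
  have e2 := cost_nonneg N (t (M - 1))
  have := three_le_sum (N := N) (p := 0) (q := 1) (r := j₀) (F := fun j => cost M fun i => t i j)
    (fun _ => cost_nonneg _ _) (by omega) (by omega) h2 (by omega) (by omega) (by omega)
  beta_reduce at hsum this
  unfold en at he
  omega

/-- Since M - 1 rows and the first column already use M units, the second column may vary by one
only: it can grow or shrink by one cell at its end. -/
lemma Flip.ell_of_col_one (h : Flip M N s t i₀ 1) (hs : IsEll M N s k) (hk : 1 ≤ k)
    (hkM : k + 1 ≤ M) (hM : 3 ≤ M) (hN : 4 ≤ N) (hsp : Spins M N t) (he : en M N t ≤ M + 1) :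
    i₀ + 1 < M ∧ (IsEll M N t (k + 1) ∧ k + 2 ≤ M ∨ IsEll M N t (k - 1)) := by
  have c0 := h.ell_col_zero_ne hs hM (by omega) (by omega)
  obtain ⟨h1, h2, h3, h4⟩ := h
  have T : ∀ i < M, ∀ j < N, i ≠ i₀ ∨ j ≠ 1 → t i j =
      if (j = 0 ∧ i + 1 < M) ∨ (j = 1 ∧ i < k) then -1 else 0 := fun i hi j hj hne =>
    (h4 i hi j hj hne).trans (hs i hi j hj)
  have hr : ∀ i < M, i + 1 < M → 1 ≤ cost N (t i) := fun i hi hi' =>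
    one_le_cost (j := 0) (k := 2) (by omega) (by omega) (by
      rw [T i hi 0 (by omega) (by omega), T i hi 2 (by omega) (by omega), if_pos (by omega),
        if_neg (by omega)]; decide)
  have hsum := fun p (hp : p + 1 < M) => sum_ge (M := M) (p := p) (q := M - 1)
    (F := fun i => cost N (t i)) (by omega) (by omega) (by omega) fun i hi _ h => hr i hi (by omega)
  have hr0 := hr 0 (by omega) (by omega)
  have hrM := cost_nonneg N (t (M - 1))
  have hcols := two_cols_le_sum (M := M) (N := N) t (j := 0) (k := 1) (by omega) (by omega)
    (by omega)
  beta_reduce at hsum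
  unfold en at he
  have b := hsp i₀ h1 1 h2
  have T2 := T i₀ h1 2 (by omega) (by omega)
  have T0 := T i₀ h1 0 (by omega) (by omega)
  rw [if_neg (by omega)] at T2
  have R := chain_le_cost (t i₀) (N := N) (j₁ := 0) (j₂ := 1) (j₃ := 2) (j₄ := 2) (by omega)
    (by omega) (by omega) (by omega)
  have C := fun (p q r u : ℕ) => chain_le_cost (fun i => t i 1) (N := M) (j₁ := p) (j₂ := q)
    (j₃ := r) (j₄ := u)
  beta_reduce at C
  rw [hs i₀ h1 1 h2] at h3
  have hi₀ : i₀ + 1 < M := by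
    by_contra hn
    have : i₀ = M - 1 := by omega
    rw [if_neg (by omega)] at T0 h3
    have hM1 := hsum 0 (by omega)
    rw [← this] at hM1
    have := C 0 i₀ i₀ i₀ (by omega) le_rfl le_rfl h1
    have c1 := cost_nonneg M fun i => t i 1
    omega
  rw [if_pos (by omega)] at T0
  have S := hsum i₀ hi₀
  have hlast := T (M - 1) (by omega) 1 h2 (by omega)
  rw [if_neg (by omega)] at hlast
  have CC := cost_nonneg M fun i => t i 1
  have hx : t i₀ 1 ≠ 1 := by
    intro hx
    have := C i₀ (M - 1) (M - 1) (M - 1) (by omega) le_rfl le_rfl (by omega)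
    omega
  refine ⟨hi₀, ?_⟩
  by_cases hik : i₀ < k
  · rw [if_pos (by omega)] at h3
    have hx0 : t i₀ 1 = 0 := by omega
    have hik' : i₀ + 1 = k := by
      by_contra hn
      have e1 := T (k - 1) (by omega) 1 h2 (by omega)
      rw [if_pos (by omega)] at e1
      have := C i₀ (k - 1) (M - 1) (M - 1) (by omega) (by omega) le_rfl (by omega)
      omega
    refine Or.inr fun i hi j hj => ?_
    by_cases hij : i = i₀ ∧ j = 1
    · rw [hij.1, hij.2, hx0, if_neg (by omega)]
    · rw [T i hi j hj (by omega)]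
      split_ifs <;> omega
  · rw [if_neg (by omega)] at h3
    have hx0 : t i₀ 1 = -1 := by omega
    have hik' : i₀ = k := by
      by_contra hn
      have e1 := T k (by omega) 1 h2 (by omega)
      rw [if_neg (by omega)] at e1
      have e2 := T 0 (by omega) 1 h2 (by omega)
      rw [if_pos (by omega)] at e2
      have := C 0 k i₀ (M - 1) (by omega) (by omega) (by omega) (by omega)
      omega
    refine Or.inl ⟨fun i hi j hj => ?_, by omega⟩
    by_cases hij : i = i₀ ∧ j = 1
    · rw [hij.1, hij.2, hx0, if_pos (by omega)]
    · rw [T i hi j hj (by omega)]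
      split_ifs <;> omega

/-- The missing corner is filled in, which restores a strip, or the next site of the first column
disappears too. In the latter case the energy falls to M. -/
lemma Flip.ell_of_col_zero (h : Flip M N s t i₀ 0) (hs : IsEll M N s k) (hk : 1 ≤ k)
    (hkM : k + 1 ≤ M) (hM : 3 ≤ M) (hN : 4 ≤ N) (hsp : Spins M N t) (he : en M N t ≤ M + 1) :
    (IsStrip M N t (-1) 0 false false 1 k) ∨ (Cross M N t 0 ∧ en M N t ≤ M) := by
  have c1 := h.ell_col_one_ne hs hk hkM hM (by omega) (by omega)
  obtain ⟨h1, h2, h3, h4⟩ := h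
  have T : ∀ i < M, ∀ j < N, i ≠ i₀ ∨ j ≠ 0 → t i j =
      if (j = 0 ∧ i + 1 < M) ∨ (j = 1 ∧ i < k) then -1 else 0 := fun i hi j hj hne =>
    (h4 i hi j hj hne).trans (hs i hi j hj)
  have hr : ∀ i < M, i + 1 < M → i ≠ i₀ → 1 ≤ cost N (t i) := fun i hi hi' hne =>
    one_le_cost (j := 0) (k := 2) (by omega) (by omega) (by
      rw [T i hi 0 (by omega) (by omega), T i hi 2 (by omega) (by omega), if_pos (by omega),
        if_neg (by omega)]; decide)
  have hrM := cost_nonneg N (t (M - 1))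
  have hcols := two_cols_le_sum (M := M) (N := N) t (j := 0) (k := 1) (by omega) (by omega)
    (by omega)
  have b := hsp i₀ h1 0 h2
  have T1 := T i₀ h1 1 (by omega) (by omega)
  have T2 := T i₀ h1 2 (by omega) (by omega)
  rw [if_neg (by omega)] at T2
  have R := chain_le_cost (t i₀) (N := N) (j₁ := 0) (j₂ := 1) (j₃ := 2) (j₄ := 2) (by omega)
    (by omega) (by omega) (by omega)
  have C := fun (p q r u : ℕ) => chain_le_cost (fun i => t i 0) (N := M) (j₁ := p) (j₂ := q)
    (j₃ := r) (j₄ := u)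
  beta_reduce at C
  rw [hs i₀ h1 0 h2] at h3
  by_cases hi₀ : i₀ + 1 < M
  · right
    rw [if_pos (by omega)] at h3
    have S := sum_ge (M := M) (p := i₀) (q := M - 1)
      (F := fun i => cost N (t i)) (by omega) (by omega) (by omega)
      fun i hi h h' => hr i hi (by omega) h
    beta_reduce at S
    have hlast := T (M - 1) (by omega) 0 h2 (by omega)
    rw [if_neg (by omega)] at hlast
    have hx0 : t i₀ 0 ≠ 1 := by
      intro hx
      obtain ⟨i, hi, hi'⟩ := exists_ne (M := M - 1) (by omega) i₀
      have e1 := T i (by omega) 0 h2 (by omega)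
      rw [if_pos (by omega)] at e1
      have := pair_le_cost (fun i => t i 0) (N := M) (j := i) (k := i₀) (by omega) h1
      beta_reduce at this
      unfold en at he
      omega
    have hx0 : t i₀ 0 = 0 := by omega
    have hik : k ≤ i₀ := by
      by_contra hn
      rw [if_pos (by omega)] at T1
      obtain ⟨i, hi, hi'⟩ := exists_ne (M := M - 1) (by omega) i₀
      have e1 := T i (by omega) 0 h2 (by omega)
      rw [if_pos (by omega)] at e1
      have := pair_le_cost (fun i => t i 0) (N := M) (j := i) (k := i₀) (by omega) h1
      beta_reduce at this
      unfold en at he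
      omega
    have hiM : i₀ + 2 = M := by
      by_contra hn
      have e1 := T (M - 2) (by omega) 0 h2 (by omega)
      rw [if_pos (by omega)] at e1
      have e2 := T 0 (by omega) 0 h2 (by omega)
      rw [if_pos (by omega)] at e2
      have := C 0 i₀ (M - 2) (M - 1) (by omega) (by omega) (by omega) (by omega)
      have := cost_nonneg N (t i₀)
      unfold en at he
      omega
    refine ⟨⟨⟨M - 1, by omega, fun j hj => ?_⟩, 2, by omega, fun i hi => ?_⟩,
      en_le_of_corner (by omega) (h := k) (by omega) fun i hi j hj => ?_⟩
    · rw [T _ (by omega) j hj (by omega), if_neg (by omega)]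
    · rw [T i hi 2 (by omega) (by omega), if_neg (by omega)]
    by_cases hij : i = i₀ ∧ j = 0
    · rw [hij.1, hij.2, hx0, if_neg (by omega)]
    · rw [T i hi j hj (by omega)]
      split_ifs <;> omega
  · left
    have hi₀' : i₀ = M - 1 := by omega
    rw [if_neg (by omega)] at h3
    have S := sum_ge (M := M) (p := 0) (q := M - 1)
      (F := fun i => cost N (t i)) (by omega) (by omega) (by omega)
      fun i hi h h' => hr i hi (by omega) (by omega)
    have hr0 := hr 0 (by omega) (by omega) (by omega)
    beta_reduce at S
    rw [← hi₀'] at S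
    have hx : t i₀ 0 = -1 := by
      by_contra hn
      have e1 := T 0 (by omega) 0 h2 (by omega)
      rw [if_pos (by omega)] at e1
      have := C 0 i₀ i₀ i₀ (by omega) le_rfl le_rfl h1
      unfold en at he
      omega
    intro i hi j hj
    simp only [Cell, Bool.false_eq_true, if_false]
    by_cases hij : i = i₀ ∧ j = 0
    · rw [hij.1, hij.2, hx]
      omega
    · have := T i hi j hj (by omega)
      split_ifs at this <;> omega

lemma Cross.of_refl {r c : Bool} {a : ℤ} (h : Cross M N (Grid.refl M N r c s) a) :
    Cross M N s a := by
  obtain ⟨⟨i, hi, h1⟩, j, hj, h2⟩ := h.refl r c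
  exact ⟨⟨i, hi, fun k hk => by rw [← h1 k hk, refl_refl hi hk]⟩,
    j, hj, fun k hk => by rw [← h2 k hk, refl_refl hk hj]⟩

lemma Flip.ell_step (h : Flip M N s t i₀ j₀) (hs : Ell M N s) (hM : 3 ≤ M) (hN : 4 ≤ N)
    (hsp : Spins M N t) (he : en M N t ≤ M + 1) : Thick M N t ∨ Ell M N t ∨
      (Cross M N t 0 ∧ en M N t ≤ M) := by
  obtain ⟨r, c, k, h1, h2, hs⟩ := hs
  have h := h.refl r c
  have hsp' : Spins M N (Grid.refl M N r c t) := fun i hi j hj =>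
    hsp _ (cond_lt r hi) _ (cond_lt c hj)
  have he' : en M N (Grid.refl M N r c t) ≤ M + 1 := by rwa [en_refl]
  have hj := h.ell_col_lt hs h1 h2 hM hN he'
  have hj : (if c then N - 1 - j₀ else j₀) = 0 ∨ (if c then N - 1 - j₀ else j₀) = 1 := by omega
  rcases hj with hj | hj
  · rw [hj] at h
    rcases h.ell_of_col_zero hs h1 h2 hM hN hsp' he' with h3 | h3
    · exact Or.inl ⟨r, c, 1, k, ⟨by omega, by omega, by omega, by omega⟩, h3.of_refl,
        Or.inr (by omega)⟩
    · rw [en_refl] at h3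
      exact Or.inr (Or.inr ⟨h3.1.of_refl, h3.2⟩)
  · rw [hj] at h
    obtain ⟨-, h3 | h3⟩ := h.ell_of_col_one hs h1 h2 hM hN hsp' he'
    · exact Or.inr (Or.inl ⟨r, c, k + 1, by omega, by omega, h3.1⟩)
    · by_cases hk : k = 1
      · subst hk
        have := h3.en_le
        rw [en_refl] at this
        exact Or.inr (Or.inr ⟨(h3.cross (by omega) (by omega)).of_refl, this⟩)
      · exact Or.inr (Or.inl ⟨r, c, k - 1, by omega, by omega, h3⟩)

/-- Arrays outside of the well of `0` on the side of `-1`, without crosses of spins `-1`. -/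
def Side (M N : ℕ) (s : ℕ → ℕ → ℤ) : Prop := Thick M N s ∨ Ell M N s

/-- The last two alternatives are the exits into the well of 0: a single column on the short side,
or a cross of zeros below the barrier. If M > K, the bound K + 1 ≤ M forbids incomplete columns and
truncated ones, so no single column can be adjacent. -/
lemma Flip.side_step (h : Flip M N s t i₀ j₀) {K : ℕ} (hK : K ≤ M) (hM : 3 ≤ M) (hN : 4 ≤ N)
    (hsp : Spins M N t) (hs : Side M N s) (hes : en M N s ≤ K + 1) (het : en M N t ≤ K + 1) :
    Cross M N t (-1) ∨ Side M N t ∨ (M = K ∧ Thin M N t) ∨ (Cross M N t 0 ∧ en M N t ≤ K) := by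
  rcases hs with hs | hs
  · rcases cross_or_nonconst M N t with ⟨x, hx⟩ | hr | hc
    · have hx' : x = -1 ∨ x = 0 := by
        obtain ⟨⟨i, hi, hrow⟩, -⟩ := hx
        obtain ⟨j, hj, hne⟩ := exists_ne (M := N) (by omega) j₀
        rw [← hrow j hj, h.2.2.2 i hi j hj (Or.inr hne)]
        exact hs.eq_or_eq hi hj
      rcases hx' with rfl | rfl
      · exact Or.inl hx
      · exact Or.inr (Or.inl (Or.inr (h.ell_of_thick (by omega) (by omega) hs hx (by omega))))
    · rcases h.thick_or_thin (by omega) (by omega) hs hr (by omega) with h1 | h1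
      · exact Or.inr (Or.inl (Or.inl h1))
      · rcases hK.eq_or_lt with rfl | hlt
        · exact Or.inr (Or.inr (Or.inl ⟨rfl, h1⟩))
        · exact (h.not_thick_thin (by omega) hs (by omega) h1).elim
    · exact (h.not_rowsNC_colsNC (by omega) hs.rowsNC (by omega) hc).elim
  · have hlt := hs.lt_en (by omega)
    have : M = K := by omega
    subst this
    rcases h.ell_step hs hM hN hsp het with h1 | h1 | h1
    · exact Or.inr (Or.inl (Or.inl h1))
    · exact Or.inr (Or.inl (Or.inr h1))
    · exact Or.inr (Or.inr (Or.inr h1))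

lemma Flip.cross_neg_step (h : Flip M N s t i₀ j₀) {K : ℕ} (hKM : K ≤ M) (hKN : K ≤ N) (hK : 3 ≤ K)
    (hsp : Spins M N t) (hs : Cross M N s (-1)) (het : en M N t ≤ K + 1) :
    Cross M N t (-1) ∨ Side M N t ∨ Side N M (fun i j => t j i) := by
  rcases cross_or_nonconst M N t with ⟨x, hx⟩ | hr | hc
  · rw [h.cross_unique (by omega) hs hx]
    exact Or.inl hx
  · exact Or.inr (Or.inl (Or.inl (h.thick_of_cross (by omega) (by omega) hs hr hsp (by omega))))
  · exact Or.inr (Or.inr (Or.inl (h.swap.thick_of_cross (by omega) (by omega) hs.swap hc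
      (fun i hi j hj => hsp j hj i hi) (by rw [en_swap]; omega))))

/-! #### Descent to the array of spins `0` -/

/-- The bond to the zero neighbour saves one unit. The other bond, if present, loses at most one,
since b² - (b - a)² ≤ 1 for spins with a = ±1. -/
lemma cost_erase_le {a : ℕ → ℤ} {N j : ℕ} (ha : ∀ k < N, -1 ≤ a k ∧ a k ≤ 1) (hj : j < N)
    (hj0 : a j ≠ 0) (hnear : (0 < j ∧ a (j - 1) = 0) ∨ (j + 1 < N ∧ a (j + 1) = 0)) :
    cost N (fun k => if k = j then 0 else a k) ≤ cost N a := by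
  -- `p` labels the bond towards the zero neighbour and `q` the other one. For `j = 0` the value `q
  -- = N` is a dummy outside the summation range.
  obtain ⟨p, q, hp, hpq, hz⟩ : ∃ p q, p < N - 1 ∧ ((p + 1 = j ∧ q = j) ∨ (p = j ∧ q + 1 = j) ∨
      (p = j ∧ q = N ∧ j = 0)) ∧ (if p = j then a (p + 1) else a p) = 0 := by
    rcases hnear with ⟨h1, h2⟩ | ⟨h1, h2⟩
    · exact ⟨j - 1, j, by omega, by omega, by rwa [if_neg (by omega)]⟩
    · by_cases h0 : j = 0
      · exact ⟨j, N, by omega, by omega, by rwa [if_pos rfl]⟩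
      · exact ⟨j, j - 1, by omega, by omega, by rwa [if_pos rfl]⟩
  have key : ∀ k ∈ Finset.range (N - 1),
      (if k = p then (1 : ℤ) else 0) - (if k = q then 1 else 0) ≤ (a (k + 1) - a k) ^ 2 -
        ((if k + 1 = j then 0 else a (k + 1)) - (if k = j then 0 else a k)) ^ 2 := by
    intro k hk
    have hk := Finset.mem_range.1 hk
    have b1 := ha k (by omega)
    have b2 := ha (k + 1) (by omega)
    by_cases hkp : k = p
    · subst hkp
      rw [if_pos rfl, if_neg (by omega)]
      by_cases hkj : k = j
      · subst hkj
        rw [if_pos rfl] at hz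
        rw [if_neg (by omega), if_pos rfl, hz]
        have : a k = 1 ∨ a k = -1 := by omega
        rcases this with h | h <;> rw [h] <;> norm_num
      · have hkj' : k + 1 = j := by omega
        rw [if_neg hkj] at hz
        subst hkj'
        rw [if_pos rfl, if_neg hkj, hz]
        have : a (k + 1) = 1 ∨ a (k + 1) = -1 := by omega
        rcases this with h | h <;> rw [h] <;> norm_num
    · rw [if_neg hkp]
      by_cases hkq : k = q
      · rw [if_pos hkq]
        by_cases hkj : k = j
        · subst hkj
          rw [if_neg (by omega), if_pos rfl]
          obtain ⟨b1, b1'⟩ := b1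
          obtain ⟨b2, b2'⟩ := b2
          interval_cases a k <;> interval_cases a (k + 1) <;> simp_all
        · have hkj' : k + 1 = j := by omega
          subst hkj'
          rw [if_pos rfl, if_neg hkj]
          obtain ⟨b1, b1'⟩ := b1
          obtain ⟨b2, b2'⟩ := b2
          interval_cases a k <;> interval_cases a (k + 1) <;> simp_all
      · rw [if_neg hkq]
        by_cases hkj : k = j
        · omega
        · by_cases hkj' : k + 1 = j
          · omega
          · rw [if_neg hkj, if_neg hkj', sub_self, sub_self]
  have := Finset.sum_le_sum key
  rw [Finset.sum_sub_distrib, Finset.sum_sub_distrib, Finset.sum_ite_eq', Finset.sum_ite_eq',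
    if_pos (Finset.mem_range.2 hp)] at this
  unfold cost
  beta_reduce
  split_ifs at this <;> linarith

/-- In an array with a cross of spins `0`, a nonzero spin as close as possible to this cross can be
erased without increasing the energy. -/
lemma Cross.exists_erase (hs : Cross M N s 0) (hsp : Spins M N s)
    (hne : ∃ i < M, ∃ j < N, s i j ≠ 0) : ∃ i < M, ∃ j < N, s i j ≠ 0 ∧
      en M N (fun k l => if k = i ∧ l = j then 0 else s k l) ≤ en M N s := by
  obtain ⟨⟨r, hr, hrow⟩, c, hc, hcol⟩ := hs
  -- Minimise the ℓ¹ distance to the point where the zero row and column meet. One step towards it,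
  -- in the row or in the column, then finds a zero, so both line energies can be controlled.
  obtain ⟨⟨i, j⟩, hmem, hmin⟩ := Finset.exists_min_image
    ((Finset.range M ×ˢ Finset.range N).filter fun x => s x.1 x.2 ≠ 0)
    (fun x => ((x.1 : ℤ) - r).natAbs + ((x.2 : ℤ) - c).natAbs) (by
      obtain ⟨i, hi, j, hj, h⟩ := hne
      exact ⟨(i, j), by simp [hi, hj, h]⟩)
  simp only [Finset.mem_filter, Finset.mem_product, Finset.mem_range, Prod.forall] at hmem hmin
  obtain ⟨⟨hi, hj⟩, hij⟩ := hmem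
  have hmin' : ∀ a < M, ∀ b < N, ((a : ℤ) - r).natAbs + ((b : ℤ) - c).natAbs
      < ((i : ℤ) - r).natAbs + ((j : ℤ) - c).natAbs → s a b = 0 := by
    intro a ha b hb h
    by_contra hn
    have := hmin a b ⟨⟨ha, hb⟩, hn⟩
    omega
  have hir : i ≠ r := by rintro rfl; exact hij (hrow j hj)
  have hjc : j ≠ c := by rintro rfl; exact hij (hcol i hi)
  refine ⟨i, hi, j, hj, hij, add_le_add (Finset.sum_le_sum fun k hk => ?_)
    (Finset.sum_le_sum fun l hl => ?_)⟩
  · by_cases hk' : k = i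
    · subst hk'
      simp only [true_and]
      refine cost_erase_le (fun l hl => hsp k hi l hl) hj hij ?_
      rcases lt_or_gt_of_ne hjc with h | h
      · exact Or.inr ⟨by omega, hmin' k hi _ (by omega) (by omega)⟩
      · exact Or.inl ⟨by omega, hmin' k hi _ (by omega) (by omega)⟩
    · simp [hk']
  · by_cases hl' : l = j
    · subst hl'
      simp only [and_true]
      refine cost_erase_le (a := fun k => s k l) (fun k hk => hsp k hk l hj) hi hij ?_
      rcases lt_or_gt_of_ne hir with h | h
      · exact Or.inr ⟨by omega, hmin' _ (by omega) l hj (by omega)⟩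
      · exact Or.inl ⟨by omega, hmin' _ (by omega) l hj (by omega)⟩
    · simp [hl']

end

end Grid

/-! ### Spin configurations as arrays, and the translation to a landscape. -/

namespace BlumeCapel

open Grid

variable {K L : ℕ}

/-- Spin configurations as integer arrays. -/
def arr (σ : Config K L) (i j : ℕ) : ℤ :=
  if h : i < K ∧ j < L then ((σ (⟨i, h.1⟩, ⟨j, h.2⟩) : SignType) : ℤ) else 0

lemma arr_apply (σ : Config K L) (i : Fin K) (j : Fin L) :
    arr σ i j = ((σ (i, j) : SignType) : ℤ) := by
  simp [arr]

lemma arr_eq (σ : Config K L) {i j : ℕ} (hi : i < K) (hj : j < L) :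
    arr σ i j = ((σ (⟨i, hi⟩, ⟨j, hj⟩) : SignType) : ℤ) := arr_apply σ ⟨i, hi⟩ ⟨j, hj⟩

lemma cast_inj {a b : SignType} (h : (a : ℤ) = (b : ℤ)) : a = b := by
  cases a <;> cases b <;> simp_all

lemma arr_spins (σ : Config K L) : Spins K L (arr σ) := by
  intro i hi j hj
  rw [arr_eq σ hi hj]
  cases σ (⟨i, hi⟩, ⟨j, hj⟩) <;> simp

lemma eq_of_arr_eq {σ ζ : Config K L} (h : ∀ i < K, ∀ j < L, arr σ i j = arr ζ i j) : σ = ζ := by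
  funext ⟨i, j⟩
  exact cast_inj (by rw [← arr_apply, ← arr_apply, h i i.2 j j.2])

lemma sum_adj_line (N : ℕ) (a : ℕ → ℤ) :
    ∑ j : Fin N, ∑ k : Fin N, (if |(j : ℤ) - (k : ℤ)| = 1 then (a j - a k) ^ 2 else 0)
      = 2 * cost N a := by
  have h1 : ∀ F : ℕ → ℕ → ℤ, ∑ j ∈ Finset.range N, ∑ k ∈ Finset.range N,
      (if k = j + 1 then F j k else 0) = ∑ j ∈ Finset.range (N - 1), F j (j + 1) := by
    intro F
    cases N with
    | zero => simp
    | succ n =>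
      rw [Finset.sum_range_succ, Nat.add_sub_cancel]
      simp only [Finset.sum_ite_eq', Finset.mem_range]
      rw [if_neg (by omega), add_zero]
      refine Finset.sum_congr rfl fun j hj => ?_
      have := Finset.mem_range.1 hj
      rw [if_pos (by omega)]
  have h2 : ∀ j k : ℕ, (if |(j : ℤ) - (k : ℤ)| = 1 then (a j - a k) ^ 2 else 0)
      = (if k = j + 1 then (a k - a j) ^ 2 else 0) + (if j = k + 1 then (a j - a k) ^ 2 else 0) := by
    intro j k
    by_cases c1 : k = j + 1
    · rw [if_pos (by rw [c1]; simp), if_pos c1, if_neg (by omega)]; ring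
    · by_cases c2 : j = k + 1
      · rw [if_pos (by rw [c2]; simp), if_neg c1, if_pos c2, zero_add]
      · rw [if_neg c1, if_neg c2, if_neg, add_zero]
        intro h
        rcases (abs_eq (zero_le_one' ℤ)).1 h with h | h <;> omega
  rw [Fin.sum_univ_eq_sum_range (fun j => ∑ k : Fin N,
    if |(j : ℤ) - ((k : ℕ) : ℤ)| = 1 then (a j - a k) ^ 2 else 0) N]
  have h3 : ∀ j : ℕ, (∑ k : Fin N, if |(j : ℤ) - ((k : ℕ) : ℤ)| = 1 then (a j - a k) ^ 2 else 0)
      = ∑ k ∈ Finset.range N, ((if k = j + 1 then (a k - a j) ^ 2 else 0)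
        + (if j = k + 1 then (a j - a k) ^ 2 else 0)) := by
    intro j
    rw [Fin.sum_univ_eq_sum_range
      (fun k => if |(j : ℤ) - (k : ℤ)| = 1 then (a j - a k) ^ 2 else 0) N]
    exact Finset.sum_congr rfl fun k _ => h2 j k
  simp only [h3, Finset.sum_add_distrib]
  rw [h1 fun j k => (a k - a j) ^ 2, Finset.sum_comm (f := fun j k =>
    if j = k + 1 then (a j - a k) ^ 2 else 0), h1 fun k j => (a j - a k) ^ 2, cost]
  ring

lemma adj_iff (x y : Site K L) : Adj x y ↔
    (x.1 = y.1 ∧ |(x.2 : ℤ) - (y.2 : ℤ)| = 1) ∨ (x.2 = y.2 ∧ |(x.1 : ℤ) - (y.1 : ℤ)| = 1) := by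
  unfold Adj
  rw [Fin.ext_iff, Fin.ext_iff]
  constructor
  · intro h
    have a1 := abs_nonneg ((x.1 : ℤ) - (y.1 : ℤ))
    have a2 := abs_nonneg ((x.2 : ℤ) - (y.2 : ℤ))
    rcases a1.eq_or_lt with h1 | h1
    · have := abs_eq_zero.1 h1.symm
      exact Or.inl ⟨by omega, by omega⟩
    · have h2 : |(x.2 : ℤ) - (y.2 : ℤ)| = 0 := by omega
      have := abs_eq_zero.1 h2
      exact Or.inr ⟨by omega, by omega⟩
  · rintro (⟨h1, h2⟩ | ⟨h1, h2⟩)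
    · rw [h1, h2]; simp
    · rw [h1, h2]; simp

lemma energy_eq (σ : Config K L) : energy σ = (en K L (arr σ) : ℝ) := by
  classical
  set a := arr σ
  have h1 : ∀ x y : Site K L, (if Adj x y then ((σ x : ℝ) - (σ y : ℝ)) ^ 2 else 0)
      = (((if x.1 = y.1 then (if |(x.2 : ℤ) - (y.2 : ℤ)| = 1 then (a x.1 x.2 - a x.1 y.2) ^ 2 else 0)
          else 0) +
        (if x.2 = y.2 then (if |(x.1 : ℤ) - (y.1 : ℤ)| = 1 then (a x.1 x.2 - a y.1 x.2) ^ 2 else 0)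
          else 0) : ℤ) : ℝ) := by
    rintro ⟨i, j⟩ ⟨k, l⟩
    simp only [adj_iff]
    by_cases c1 : i = k
    · subst c1
      by_cases c2 : j = l
      · subst c2; simp
      · simp only [c2, a, arr_apply]; simp
    · by_cases c2 : j = l
      · subst c2
        simp only [c1, a, arr_apply]; simp
      · simp [c1, c2]
  unfold energy
  have h2 : ∑ x : Site K L, ∑ y : Site K L, (if Adj x y then ((σ x : ℝ) - (σ y : ℝ)) ^ 2 else 0)
      = ((2 * en K L a : ℤ) : ℝ) := by
    simp only [h1, ← Int.cast_sum]
    congr 1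
    simp only [Finset.sum_add_distrib, Fintype.sum_prod_type]
    rw [en, mul_add, Finset.mul_sum, Finset.mul_sum,
      ← Fin.sum_univ_eq_sum_range (fun i => 2 * cost L (a i)) K,
      ← Fin.sum_univ_eq_sum_range (fun j => 2 * cost K fun i => a i j) L]
    congr 1
    · refine Finset.sum_congr rfl fun i _ => ?_
      rw [← sum_adj_line]
      refine Finset.sum_congr rfl fun j _ => ?_
      rw [Finset.sum_comm]
      simp
    · rw [Finset.sum_comm]
      refine Finset.sum_congr rfl fun j _ => ?_
      rw [← sum_adj_line]
      refine Finset.sum_congr rfl fun i _ => ?_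
      simp
  rw [h2]
  push_cast
  ring

/-! #### The energy landscape -/

lemma arr_mono (a : SignType) {i j : ℕ} (hi : i < K) (hj : j < L) : arr (mono K L a) i j = a :=
  arr_eq _ hi hj

/-- `ζ ≠ σ` is obtained from `σ` by updating one spin. -/
def Step (σ ζ : Config K L) : Prop :=
  ζ ≠ σ ∧ ∃ (x : Site K L) (a : SignType), ζ = Function.update σ x a

lemma Step.flip {σ ζ : Config K L} (h : Step σ ζ) :
    ∃ i j, Flip K L (arr σ) (arr ζ) i j := by
  obtain ⟨hne, ⟨i, j⟩, a, rfl⟩ := h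
  refine ⟨i, j, i.2, j.2, fun h => hne ?_, fun k hk l hl hkl => ?_⟩
  · rw [arr_apply, arr_apply, Function.update_self] at h
    rw [cast_inj h, Function.update_eq_self]
  · rw [arr_eq _ hk hl, arr_eq _ hk hl, Function.update_of_ne]
    intro h
    rw [Prod.ext_iff, Fin.ext_iff, Fin.ext_iff] at h
    simp only at h
    omega

lemma step_of_flip {σ ζ : Config K L} {i j : ℕ} (h : Flip K L (arr σ) (arr ζ) i j) : Step σ ζ := by
  obtain ⟨h1, h2, h3, h4⟩ := h
  refine ⟨fun he => h3 (by rw [he]), (⟨i, h1⟩, ⟨j, h2⟩), ζ (⟨i, h1⟩, ⟨j, h2⟩), ?_⟩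
  refine eq_of_arr_eq fun k hk l hl => ?_
  by_cases hkl : k = i ∧ l = j
  · obtain ⟨rfl, rfl⟩ := hkl
    rw [arr_eq _ hk hl, arr_eq _ hk hl, Function.update_self]
  · rw [h4 k hk l hl (by omega), arr_eq _ hk hl, arr_eq _ hk hl, Function.update_of_ne]
    intro h
    rw [Prod.ext_iff, Fin.ext_iff, Fin.ext_iff] at h
    exact hkl h

lemma step_symm {σ ζ : Config K L} (h : Step σ ζ) : Step ζ σ := by
  obtain ⟨i, j, h⟩ := h.flip
  exact step_of_flip h.symm

lemma step_conn (σ ζ : Config K L) : Relation.ReflTransGen Step σ ζ := by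
  classical
  have key : ∀ A : Finset (Site K L),
      Relation.ReflTransGen Step σ (fun x => if x ∈ A then ζ x else σ x) := by
    intro A
    induction A using Finset.induction_on with
    | empty => simpa using Relation.ReflTransGen.refl
    | insert x A hx ih =>
      set ξ : Config K L := fun x => if x ∈ A then ζ x else σ x with hξ
      have e : (fun y => if y ∈ insert x A then ζ y else σ y) = Function.update ξ x (ζ x) := by
        funext y
        by_cases hy : y = x
        · subst hy; simp
        · simp [hy, hξ]
      rw [e]
      by_cases h : Function.update ξ x (ζ x) = ξ
      · rwa [h]
      · exact ih.tail ⟨h, x, ζ x, rfl⟩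
  simpa using key Finset.univ

lemma arr_neg (σ : Config K L) (i j : ℕ) : arr (fun x => -σ x) i j = - arr σ i j := by
  unfold arr
  beta_reduce
  split_ifs with h
  · generalize σ (⟨i, h.1⟩, ⟨j, h.2⟩) = a
    cases a <;> simp
  · simp

lemma cost_neg (N : ℕ) (a : ℕ → ℤ) : cost N (fun j => - a j) = cost N a :=
  Finset.sum_congr rfl fun _ _ => by ring

lemma en_neg (σ : Config K L) : en K L (arr fun x => -σ x) = en K L (arr σ) := by
  have h : (arr fun x => -σ x) = fun i j => - arr σ i j := by
    funext i j; exact arr_neg σ i j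
  rw [h]
  unfold en
  simp only [cost_neg]

lemma en_mono (a : SignType) : en K L (arr (mono K L a)) = 0 := by
  rw [en_congr (t := fun _ _ => (a : ℤ)) fun i hi j hj => arr_mono a hi hj]
  simp [en, cost]

lemma eq_mono_of_en_le (hK : 0 < K) (hL : 0 < L) {σ : Config K L} (h : en K L (arr σ) ≤ 0) :
    ∃ a, σ = mono K L a := by
  have h1 : 0 ≤ ∑ i ∈ Finset.range K, cost L (arr σ i) :=
    Finset.sum_nonneg fun _ _ => cost_nonneg _ _
  have h2 : 0 ≤ ∑ j ∈ Finset.range L, cost K (fun i => arr σ i j) :=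
    Finset.sum_nonneg fun _ _ => cost_nonneg _ _
  unfold en at h
  refine ⟨σ (⟨0, hK⟩, ⟨0, hL⟩), eq_of_arr_eq fun i hi j hj => ?_⟩
  rw [arr_mono _ hi hj, ← arr_eq σ hK hL]
  have h3 : cost L (arr σ i) ≤ 0 := by
    have := Finset.single_le_sum (f := fun i => cost L (arr σ i)) (fun _ _ => cost_nonneg _ _)
      (Finset.mem_range.2 hi)
    beta_reduce at this
    omega
  have h4 : cost K (fun i => arr σ i 0) ≤ 0 := by
    have := col_le_sum (M := K) (arr σ) hL
    omega
  rw [eq_of_cost_le_zero h3 hj hL]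
  exact eq_of_cost_le_zero (a := fun i => arr σ i 0) h4 hi hK

/-- The energy landscape of the Blume-Capel model. -/
def landscape (K L : ℕ) (hK : 0 < K) (hL : 0 < L) : Landscape (Config K L) where
  adj := Step
  adj_symm _ _ := step_symm
  conn := step_conn
  H σ := en K L (arr σ)
  barrier := K + 1
  neg σ x := -σ x
  neg_neg σ := by funext x; simp
  adj_neg σ ζ h := by
    obtain ⟨i, j, h1, h2, h3, h4⟩ := h.flip
    refine step_of_flip (i := i) (j := j) ⟨h1, h2, ?_, fun k hk l hl hkl => ?_⟩
    · rw [arr_neg, arr_neg]; omega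
    · rw [arr_neg, arr_neg, h4 k hk l hl hkl]
  H_neg := en_neg
  lo := mono K L (-1)
  mid := mono K L 0
  hi := mono K L 1
  neg_lo := by funext x; simp [mono]
  neg_mid := by funext x; simp [mono]
  lo_ne_mid h := by simpa [mono] using congrFun h (⟨0, hK⟩, ⟨0, hL⟩)
  lo_ne_hi h := by
    have : (-1 : SignType) = 1 := congrFun h (⟨0, hK⟩, ⟨0, hL⟩)
    exact absurd this (by decide)
  H_lo := en_mono _
  H_mid := en_mono _
  H_pos σ h1 h2 h3 := by
    by_contra! h
    obtain ⟨a, rfl⟩ := eq_mono_of_en_le hK hL h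
    cases a
    · exact h2 rfl
    · exact h1 rfl
    · exact h3 rfl

/-- Detailed balance: times `exp (β * barrier)`, the rate out of σ is `exp (β H(σ))` times the
rescaled conductance. The Poisson equation with Gibbs right-hand side thus becomes the hitting time
equation of the chain. -/
lemma meanTransitionTime_eq (hK : 0 < K) (hL : 0 < L) {β : ℝ} (a : SignType) {B : Set SignType}
    (hB : B.Nonempty) {h : Config K L → ℝ}
    (hh : (landscape K L hK hL).IsMeanTime β (mono K L '' B) h) :
    meanTransitionTime K L β a B
      = ENNReal.ofReal (Real.exp (β * barrier K) * h (mono K L a)) := by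
  classical
  refine MarkovChain.meanHittingTime_eq (rate β) (mono K L '' B)
    (fun σ => Real.exp (β * barrier K) * h σ)
    (fun σ => mul_nonneg (Real.exp_pos _).le (hh.nonneg (hB.image _) σ))
    (fun σ hσ => by rw [hh.1 σ hσ, mul_zero]) (fun σ hσ => ?_) (mono K L a)
  have h1 := hh.2 σ hσ
  have key : ∀ ζ, (rate β σ ζ : ℝ) * (Real.exp (β * barrier K) * h σ
      - Real.exp (β * barrier K) * h ζ)
      = Real.exp (β * en K L (arr σ)) * ((landscape K L hK hL).W β σ ζ * (h σ - h ζ)) := by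
    intro ζ
    by_cases hs : Step σ ζ
    · have e1 : rate β σ ζ = Real.toNNReal (Real.exp (-β * max (energy ζ - energy σ) 0)) :=
        if_pos hs
      have e2 : (landscape K L hK hL).W β σ ζ = _ := if_pos hs
      rw [e1, e2, Real.coe_toNNReal _ (Real.exp_pos _).le, ← mul_sub, ← mul_assoc,
        ← mul_assoc, ← Real.exp_add, ← Real.exp_add, energy_eq, energy_eq]
      congr 2
      have e : ((landscape K L hK hL).lev σ ζ : ℝ) =
          max (en K L (arr ζ) - en K L (arr σ) : ℝ) 0 + en K L (arr σ) := by
        rw [← max_add_add_right, sub_add_cancel, zero_add, max_comm]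
        exact Int.cast_max
      rw [e]
      simp only [landscape, barrier]
      push_cast
      ring
    · have e1 : rate β σ ζ = 0 := if_neg hs
      have e2 : (landscape K L hK hL).W β σ ζ = 0 := if_neg hs
      rw [e1, e2]; simp
  simp only [key, ← Finset.mul_sum]
  change _ * Network.lap _ _ _ = 1
  rw [h1, Landscape.gibbs, ← Real.exp_add]
  simp [landscape]

end BlumeCapel

/-! ### Shrinking a boundary column. -/

namespace Grid

lemma Spins.swap {M N : ℕ} {s : ℕ → ℕ → ℤ} (h : Spins M N s) : Spins N M (fun i j => s j i) :=
  fun i hi j hj => h j hj i hi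

lemma Cross.congr {M N : ℕ} {s t : ℕ → ℕ → ℤ} {a : ℤ} (h : Cross M N s a)
    (hst : ∀ i < M, ∀ j < N, t i j = s i j) : Cross M N t a := by
  obtain ⟨⟨i, hi, h1⟩, j, hj, h2⟩ := h
  exact ⟨⟨i, hi, fun k hk => by rw [hst i hi k hk, h1 k hk]⟩,
    j, hj, fun k hk => by rw [hst k hk j hj, h2 k hk]⟩

lemma Flip.congr {M N i j : ℕ} {s t u : ℕ → ℕ → ℤ} (h : Flip M N s t i j)
    (hu : ∀ i < M, ∀ j < N, u i j = t i j) : Flip M N s u i j :=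
  ⟨h.1, h.2.1, by rw [hu i h.1 j h.2.1]; exact h.2.2.1,
    fun k hk l hl hkl => (hu k hk l hl).trans (h.2.2.2 k hk l hl hkl)⟩

/-- A single column minus one of its extremities. -/
lemma Thin.exists_flip {M N : ℕ} {s : ℕ → ℕ → ℤ} (hs : Thin M N s) (hM : 2 ≤ M) (hN : 2 ≤ N) :
    en M N s ≤ M ∧
      ∃ t i j, Flip M N s t i j ∧ Spins M N t ∧ Cross M N t 0 ∧ en M N t ≤ M := by
  classical
  obtain ⟨r, c, hs⟩ := hs
  refine ⟨(hs.en_le (by decide) (by omega)).2 (by omega), ?_⟩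
  set t : ℕ → ℕ → ℤ := fun i j => if Cell M N r c 0 (M - 1) i j then -1 else 0 with ht
  have hts : IsStrip M N t (-1) 0 r c 0 (M - 1) := fun i hi j hj => by
    rw [ht]
    exact ⟨fun h => if_pos h, fun h => if_neg h⟩
  have hrow : ∀ j < N, t (if r then 0 else M - 1) j = 0 := fun j hj => by
    refine (hts _ (by split_ifs <;> omega) j hj).2 ?_
    cases r <;> simp [Cell]
  have hcol : ∀ i < M, t i (if c then 0 else N - 1) = 0 := fun i hi => by
    refine (hts i hi _ (by split_ifs <;> omega)).2 ?_
    cases c <;> simp [Cell] <;> omega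
  have hlt : (if r then 0 else M - 1) < M := by split_ifs <;> omega
  have hlt' : (if c then N - 1 else 0) < N := by split_ifs <;> omega
  refine ⟨t, if r then 0 else M - 1, if c then N - 1 else 0, ⟨hlt, hlt', ?_, ?_⟩, ?_, ⟨⟨_, hlt, hrow⟩,
    if c then 0 else N - 1, by split_ifs <;> omega, hcol⟩, ?_⟩
  · rw [hrow _ hlt', (hs _ hlt _ hlt').1]
    · decide
    · cases c <;> simp [Cell]
  · intro i hi j hj hij
    have h1 := hs i hi j hj
    have h2 := hts i hi j hj
    by_cases hc : Cell M N r c 1 0 i j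
    · rw [h1.1 hc, h2.1]
      simp only [Cell] at hc ⊢
      cases r <;> cases c <;> simp at hc hij ⊢ <;> omega
    · rw [h1.2 hc, h2.2]
      simp only [Cell] at hc ⊢
      cases r <;> cases c <;> simp at hc ⊢ <;> omega
  · intro i hi j hj
    rw [ht]
    beta_reduce
    split_ifs <;> decide
  · exact (hts.en_le (by decide) (by omega)).2 (by omega)

end Grid

/-! ### Separation of -1 from +1 outside the well of 0. -/

namespace BlumeCapel

open Grid

variable {K L : ℕ}

/-- The configuration with given spins. -/
def ofArr (K L : ℕ) (s : ℕ → ℕ → ℤ) : Config K L := fun x => SignType.sign (s x.1 x.2)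

lemma arr_ofArr {s : ℕ → ℕ → ℤ} (hs : Spins K L s) {i j : ℕ} (hi : i < K) (hj : j < L) :
    arr (ofArr K L s) i j = s i j := by
  rw [arr_eq _ hi hj, ofArr]
  simp only
  obtain ⟨h1, h2⟩ := hs i hi j hj
  generalize s i j = a at h1 h2
  interval_cases a <;> decide

variable (hK : 0 < K) (hL : 0 < L)

lemma lowAdj_of_flip {σ ζ : Config K L} {i j : ℕ} (h : Flip K L (arr σ) (arr ζ) i j)
    (hσ : en K L (arr σ) ≤ K) (hζ : en K L (arr ζ) ≤ K) : (landscape K L hK hL).lowAdj σ ζ :=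
  ⟨step_of_flip h, max_lt (Int.lt_add_one_of_le hσ) (Int.lt_add_one_of_le hζ)⟩

/-- Erase nonzero spins one at a time with `Cross.exists_erase`. The zero cross survives and the
energy never rises, so the path to the zero configuration stays below the barrier. -/
lemma mem_well_of_cross {σ : Config K L} (hσ : Cross K L (arr σ) 0) (he : en K L (arr σ) ≤ K) :
    σ ∈ (landscape K L hK hL).well := by
  classical
  induction hn : (Finset.univ.filter fun x => σ x ≠ 0).card using Nat.strong_induction_on
    generalizing σ with
  | _ n ih =>
  by_cases hne : ∃ i < K, ∃ j < L, arr σ i j ≠ 0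
  · obtain ⟨i, hi, j, hj, hij, hle⟩ := hσ.exists_erase (arr_spins σ) hne
    set ζ : Config K L := Function.update σ (⟨i, hi⟩, ⟨j, hj⟩) 0 with hζ
    have harr : ∀ k < K, ∀ l < L, arr ζ k l = if k = i ∧ l = j then 0 else arr σ k l := by
      intro k hk l hl
      rw [arr_eq _ hk hl, arr_eq _ hk hl, hζ, Function.update_apply]
      simp only [Prod.ext_iff, Fin.ext_iff]
      split_ifs <;> simp
    have hen : en K L (arr ζ) ≤ en K L (arr σ) := by rwa [en_congr harr]
    have hflip : Flip K L (arr ζ) (arr σ) i j := by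
      refine ⟨hi, hj, ?_, fun k hk l hl hkl => ?_⟩
      · rwa [harr i hi j hj, if_pos ⟨rfl, rfl⟩]
      · rw [harr k hk l hl, if_neg (by omega)]
    have hcross : Cross K L (arr ζ) 0 := by
      obtain ⟨⟨p, hp, h1⟩, q, hq, h2⟩ := hσ
      refine ⟨⟨p, hp, fun l hl => ?_⟩, q, hq, fun k hk => ?_⟩
      · rw [harr p hp l hl, h1 l hl, ite_self]
      · rw [harr k hk q hq, h2 k hk, ite_self]
    have hlt : (Finset.univ.filter fun x => ζ x ≠ 0).card < n := by
      rw [← hn]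
      refine Finset.card_lt_card (Finset.ssubset_iff_subset_ne.2 ⟨fun x hx => ?_, fun h => ?_⟩)
      · simp only [Finset.mem_filter, Finset.mem_univ, true_and] at hx ⊢
        intro h
        apply hx
        rw [hζ, Function.update_apply, h, ite_self]
      · have h1 : (⟨i, hi⟩, ⟨j, hj⟩) ∈ Finset.univ.filter fun x => σ x ≠ 0 := by
          simp only [Finset.mem_filter, Finset.mem_univ, true_and]
          intro h
          rw [arr_eq _ hi hj, h] at hij
          simp at hij
        rw [← h] at h1
        simp [hζ] at h1
    exact Relation.ReflTransGen.tail (ih _ hlt hcross (hen.trans he) rfl)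
      (lowAdj_of_flip hK hL hflip (hen.trans he) he)
  · push Not at hne
    have : σ = mono K L 0 := eq_of_arr_eq fun i hi j hj => by
      rw [hne i hi j hj, arr_mono _ hi hj]; simp
    rw [this]
    exact Relation.ReflTransGen.refl

lemma mem_well_of_flip {σ : Config K L} {t : ℕ → ℕ → ℤ} {i j : ℕ}
    (h : Flip K L (arr σ) t i j) (hsp : Spins K L t) (ht : Cross K L t 0) (het : en K L t ≤ K)
    (he : en K L (arr σ) ≤ K) : σ ∈ (landscape K L hK hL).well := by
  have e : ∀ i < K, ∀ j < L, arr (ofArr K L t) i j = t i j := fun i hi j hj => arr_ofArr hsp hi hj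
  have hle : en K L (arr (ofArr K L t)) ≤ K := by rwa [en_congr e]
  exact Relation.ReflTransGen.tail (mem_well_of_cross hK hL (ht.congr e) hle)
    (lowAdj_of_flip hK hL (h.congr e).symm hle he)

/-- What `mono (-1)` is connected to up to the barrier, outside of the well of `mono 0`. -/
def LoSide (σ : Config K L) : Prop :=
  en K L (arr σ) ≤ K + 1 ∧ (Cross K L (arr σ) (-1) ∨ Side K L (arr σ) ∨
    Side L K fun i j => arr σ j i)

/-- The set is closed under permitted steps because each other outcome of `Flip.side_step` lies in
the well of 0. A single column of length K is there too: removing an end leaves a cross of zeros of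
energy at most K. -/
lemma loSide_step (h5 : 5 ≤ K) (hKL : K ≤ L) {σ ζ : Config K L} (hσ : LoSide σ)
    (h : (landscape K L hK hL).sideAdj σ ζ) : LoSide ζ := by
  obtain ⟨⟨hstep, hlev⟩, -, hw⟩ := h
  obtain ⟨hes, hσ⟩ := hσ
  obtain ⟨i, j, hf⟩ := Step.flip hstep
  have het : en K L (arr ζ) ≤ K + 1 := (le_max_right _ _).trans hlev
  have hsp := arr_spins ζ
  refine ⟨het, ?_⟩
  rcases hσ with hσ | hσ | hσ
  · exact hf.cross_neg_step le_rfl hKL (by omega) hsp hσ het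
  · rcases hf.side_step le_rfl (by omega) (by omega) hsp hσ hes het with h1 | h1 | ⟨-, h1⟩ | h1
    · exact Or.inl h1
    · exact Or.inr (Or.inl h1)
    · obtain ⟨h2, t, i, j, h3, h4, h5, h6⟩ := h1.exists_flip (by omega) (by omega)
      exact (hw (mem_well_of_flip hK hL h3 h4 h5 h6 h2)).elim
    · exact (hw (mem_well_of_cross hK hL h1.1 h1.2)).elim
  · rcases hf.swap.side_step hKL (by omega) (by omega) hsp.swap hσ (by rwa [en_swap])
      (by rwa [en_swap]) with h1 | h1 | ⟨h0, h1⟩ | h1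
    · exact Or.inl h1.swap
    · exact Or.inr (Or.inr h1)
    · subst h0
      obtain ⟨h2, t, i, j, h3, h4, h5, h6⟩ := h1.exists_flip (by omega) (by omega)
      rw [en_swap] at h2
      exact (hw (mem_well_of_flip hK hL h3.swap h4.swap h5.swap (by rwa [en_swap]) h2)).elim
    · rw [en_swap] at h1
      exact (hw (mem_well_of_cross hK hL h1.1.swap h1.2)).elim

lemma cross_mono (hK : 0 < K) (hL : 0 < L) (a : SignType) : Cross K L (arr (mono K L a)) a :=
  ⟨⟨0, hK, fun _ hj => arr_mono a hK hj⟩, 0, hL, fun _ hi => arr_mono a hi hL⟩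

lemma Side.not_one {M N : ℕ} (hM : 0 < M) (hN : 0 < N) {s : ℕ → ℕ → ℤ} (hs : Side M N s)
    (h : ∀ i < M, ∀ j < N, s i j = 1) : False := by
  rcases hs with hs | ⟨r, c, k, -, -, hs⟩
  · have := hs.eq_or_eq hM hN
    have := h 0 hM 0 hN
    omega
  · have h1 := hs 0 hM 0 hN
    have h2 : Grid.refl M N r c s 0 0 = 1 := h _ (cond_lt r hM) _ (cond_lt c hN)
    rw [h2] at h1
    split_ifs at h1
    all_goals omega

lemma hi_notMem_side (h5 : 5 ≤ K) (hKL : K ≤ L) :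
    (landscape K L hK hL).hi ∉ (landscape K L hK hL).side := by
  intro h
  have key : ∀ σ, Relation.ReflTransGen (landscape K L hK hL).sideAdj (mono K L (-1)) σ →
      LoSide σ := by
    intro σ hσ
    induction hσ with
    | refl =>
      refine ⟨?_, Or.inl (cross_mono hK hL (-1))⟩
      rw [en_mono]
      omega
    | tail _ hbc ih => exact loSide_step hK hL h5 hKL ih hbc
  have hone : ∀ i < K, ∀ j < L, arr (landscape K L hK hL).hi i j = 1 := fun i hi j hj =>
    (arr_mono 1 hi hj).trans (by simp)
  rcases (key _ h).2 with h1 | h1 | h1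
  · have := h1.unique (cross_mono hK hL 1)
    simp at this
  · exact Side.not_one hK hL h1 hone
  · exact Side.not_one hL hK h1 fun i hi j hj => hone j hj i hi

end BlumeCapel

/-! ### Counting zeros next to crosses, and explicit strips. -/

namespace Grid

/-- The array contains a spin `-1`. -/
def HasNeg (M N : ℕ) (s : ℕ → ℕ → ℤ) : Prop := ∃ i < M, ∃ j < N, s i j = -1

lemma HasNeg.swap {M N : ℕ} {s : ℕ → ℕ → ℤ} (h : HasNeg M N s) : HasNeg N M fun i j => s j i := by
  obtain ⟨i, hi, j, hj, h⟩ := h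
  exact ⟨j, hj, i, hi, h⟩

lemma IsStrip.size_le {M N K : ℕ} (hK : 2 ≤ K) {s : ℕ → ℕ → ℤ} {a b : ℤ} {r c : Bool}
    {v h : ℕ} (hs : IsStrip M N s a b r c v h) (hab : a ≠ b) (hsz : Size M N v h)
    (he : en M N s ≤ K + 1) : M + h ≤ 2 * K := by
  have h1 := (hs.rowsNC hab ⟨hsz.1, hsz.2.1, hsz.2.2.2⟩).le_sum
  have h2 : (0 : ℤ) ≤ ∑ j ∈ Finset.range N, cost M (fun i => s i j) :=
    Finset.sum_nonneg fun _ _ => cost_nonneg _ _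
  have h3 := hsz.2.2.1
  rcases Nat.eq_zero_or_pos h with rfl | hh
  · unfold en at he
    omega
  · have := hs.lt_en hab hsz hh
    omega

section

variable {M N K i₀ j₀ : ℕ} {s t : ℕ → ℕ → ℤ}

/-- Next to a cross of -1 the strip of zeros has a single complete column. By `IsStrip.size_le` it
has at most 2K cells, the range where the ramp still equals one. -/
lemma Flip.cnt_of_cross_neg (h : Flip M N s t i₀ j₀) (hK : 2 ≤ K) (hKM : K ≤ M) (hN : 2 ≤ N)
    (hs : Cross M N s (-1)) (ht : RowsNC M N t) (hsp : Spins M N t) (he : en M N t ≤ K + 1) :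
    HasNeg M N t ∧ cnt M N t 0 ≤ 2 * K := by
  have hrow := h.symm.cross_row_eq ht hs
  obtain ⟨j, hj, hne⟩ := exists_ne hN j₀
  have e1 := (h.2.2.2 i₀ h.1 j hj (Or.inr hne)).trans (hrow j hj)
  obtain ⟨r, c, v, k, hsz, hst⟩ := ht.exists_strip_zero (by omega) hN hsp (by omega) h.1 hj e1
  have hv := h.symm.strip_of_cross' ht hs (by decide) hsz hst
  subst hv
  refine ⟨⟨i₀, h.1, j, hj, e1⟩, ?_⟩
  rw [hst.cnt_eq (by decide) hsz.2.1 hsz.2.2.1.le, one_mul]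
  exact hst.size_le hK (by decide) hsz he

/-- Next to another cross, whose spin must be 0, the strip of spins -1 has one complete column and
hence at most 2K cells; all other sites are zeros. -/
lemma Flip.cnt_of_cross_ne (h : Flip M N s t i₀ j₀) (hK : 2 ≤ K) (hKM : K ≤ M) (hN : 2 ≤ N)
    {a : ℤ} (ha : a ≠ -1) (hs : Cross M N s a) (ht : RowsNC M N t) (hsp : Spins M N t)
    (he : en M N t ≤ K + 1) (hneg : HasNeg M N t) : M * N ≤ cnt M N t 0 + 2 * K := by
  have hrow := h.symm.cross_row_eq ht hs
  obtain ⟨j, hj, hne⟩ := exists_ne hN j₀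
  have e1 := (h.2.2.2 i₀ h.1 j hj (Or.inr hne)).trans (hrow j hj)
  obtain ⟨i, hi, j', hj', e2⟩ := hneg
  obtain ⟨r, c, v, k, hsz, hst⟩ := ht.exists_strip_neg (by omega) hN hsp (by omega) hi hj' e2
  have ha0 : a = 0 := by
    have := hst.eq_or_eq h.1 hj
    omega
  subst ha0
  have hv := h.symm.strip_of_cross' ht hs (by decide) hsz hst
  subst hv
  obtain ⟨v', k', hsz', hst', hsum⟩ := hst.swap hsz
  rw [hst'.cnt_eq (by decide) hsz'.2.1 hsz'.2.2.1.le, ← hsum]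
  have := hst.size_le hK (by decide) hsz he
  omega

/-- Neighbouring low-energy arrays with nonconstant rows and spins `-1`. -/
lemma Flip.rows_pair (h : Flip M N s t i₀ j₀) (hK : 2 ≤ K) (hKM : K ≤ M) (hN : 2 ≤ N)
    (hs : RowsNC M N s) (ht : RowsNC M N t) (hsp : Spins M N s) (hes : en M N s ≤ K + 1)
    (het : en M N t ≤ K + 1) (hneg : HasNeg M N s) :
    M = K ∧ (K : ℤ) + 1 ≤ max (en M N s) (en M N t) ∧ ∃ r c v k, 1 ≤ v ∧ v + 2 ≤ N ∧ k < M ∧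
      ((IsStrip M N s 0 (-1) r c v k ∧ IsStrip M N t 0 (-1) r c v (k + 1)) ∨
        (IsStrip M N t 0 (-1) r c v k ∧ IsStrip M N s 0 (-1) r c v (k + 1))) := by
  obtain ⟨i, hi, j, hj, e⟩ := hneg
  obtain ⟨r, c, v, k, hsz, hst⟩ := hs.exists_strip_zero (by omega) hN hsp (by omega) hi hj e
  obtain ⟨r, c, v, k, h1, h2, h3, h4⟩ :=
    h.strip_pair (by omega) hN (by decide) hsz hst hs (by omega) ht (by omega)
  have key : (M : ℤ) + 1 ≤ max (en M N s) (en M N t) := by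
    have aux : ∀ {u w : ℕ → ℕ → ℤ}, IsStrip M N u 0 (-1) r c v k →
        IsStrip M N w 0 (-1) r c v (k + 1) → (M : ℤ) + 1 ≤ max (en M N u) (en M N w) := by
      intro u w hu hw
      rcases Nat.eq_zero_or_pos k with rfl | hk
      · exact (hw.lt_en (by decide) ⟨h1, by omega, by omega, fun _ => h2⟩ (by omega)).trans
          (le_max_right _ _)
      · exact (hu.lt_en (by decide) ⟨h1, by omega, by omega, fun _ => h2⟩ hk).trans
          (le_max_left _ _)
    rcases h4 with ⟨h5, h6⟩ | ⟨h5, h6⟩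
    · exact aux h5 h6
    · rw [max_comm]; exact aux h5 h6
  have hMK : M = K := by
    have := key.trans (max_le hes het)
    omega
  subst hMK
  exact ⟨rfl, key, r, c, v, k, h1, h2, h3, h4⟩

lemma IsStrip.hasNeg {r c : Bool} {v k : ℕ} (hs : IsStrip M N s 0 (-1) r c v k) (hM : 0 < M)
    (hv : v + 2 ≤ N) : HasNeg M N s := by
  cases c
  · exact ⟨0, hM, N - 1, by omega, (hs 0 hM (N - 1) (by omega)).2 (by simp [Cell]; omega)⟩
  · exact ⟨0, hM, 0, by omega, (hs 0 hM 0 (by omega)).2 (by simp [Cell]; omega)⟩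

end

/-- The strip with `n` spins `0` and all other spins `-1`. -/
def strip (M N : ℕ) (r c : Bool) (n i j : ℕ) : ℤ :=
  if (if c then N - 1 - j else j) * M + (if r then M - 1 - i else i) < n then 0 else -1

lemma lex_lt {M v h i j : ℕ} (hh : h ≤ M) (hi : i < M) :
    j * M + i < v * M + h ↔ (j < v ∨ (j = v ∧ i < h)) := by
  constructor
  · intro hlt
    rcases lt_trichotomy j v with h1 | h1 | h1
    · exact Or.inl h1
    · subst h1
      exact Or.inr ⟨rfl, by omega⟩
    · have := Nat.mul_le_mul_right M (Nat.succ_le_of_lt h1)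
      rw [Nat.succ_mul] at this
      omega
  · rintro (h1 | ⟨rfl, h1⟩)
    · have := Nat.mul_le_mul_right M (Nat.succ_le_of_lt h1)
      rw [Nat.succ_mul] at this
      omega
    · omega

lemma strip_isStrip {M N : ℕ} (r c : Bool) {v h : ℕ} (hh : h ≤ M) :
    IsStrip M N (strip M N r c (v * M + h)) 0 (-1) r c v h := by
  intro i hi j hj
  have e := lex_lt (v := v) (j := if c then N - 1 - j else j) hh (cond_lt r hi)
  exact ⟨fun h => if_pos (e.2 h), fun h => if_neg fun h' => h (e.1 h')⟩

lemma IsStrip.eq_strip {M N : ℕ} {s : ℕ → ℕ → ℤ} {r c : Bool} {v h : ℕ}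
    (hs : IsStrip M N s 0 (-1) r c v h) (hh : h ≤ M) {i j : ℕ} (hi : i < M) (hj : j < N) :
    s i j = strip M N r c (v * M + h) i j := by
  classical
  have h1 := hs i hi j hj
  have h2 := strip_isStrip (N := N) r c (v := v) hh i hi j hj
  by_cases hc : Cell M N r c v h i j
  · rw [h1.1 hc, h2.1 hc]
  · rw [h1.2 hc, h2.2 hc]

lemma strip_spins (M N : ℕ) (r c : Bool) (n : ℕ) : Spins M N (strip M N r c n) := by
  intro i hi j hj
  unfold strip
  split_ifs <;> decide

end Grid

/-! ### The test function and its gradient. -/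

namespace BlumeCapel

open Grid

variable {K L : ℕ}

/-- Linear interpolation from `1` at `2 * K` to `0` at `(L - 2) * K`. -/
def ramp (K L : ℕ) (n : ℕ) : ℝ :=
  max 0 (min 1 (((K * L : ℝ) - 2 * K - n) / (K * (L - 4 : ℝ))))

lemma ramp_eq_one (hK : 0 < K) (hL : 5 ≤ L) {n : ℕ} (hn : n ≤ 2 * K) : ramp K L n = 1 := by
  have h1 : (0 : ℝ) < K := by exact_mod_cast hK
  have h2 : (5 : ℝ) ≤ L := by exact_mod_cast hL
  have h3 : (n : ℝ) ≤ 2 * K := by exact_mod_cast hn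
  have h4 : 0 < (K : ℝ) * (L - 4) := by apply mul_pos h1; linarith
  unfold ramp
  rw [min_eq_left, max_eq_right zero_le_one]
  rw [one_le_div h4]
  linarith

lemma ramp_eq_zero (hK : 0 < K) (hL : 5 ≤ L) {n : ℕ} (hn : K * L ≤ n + 2 * K) :
    ramp K L n = 0 := by
  have h1 : (0 : ℝ) < K := by exact_mod_cast hK
  have h2 : (5 : ℝ) ≤ L := by exact_mod_cast hL
  have h3 : (K * L : ℝ) ≤ n + 2 * K := by exact_mod_cast hn
  have h4 : 0 < (K : ℝ) * (L - 4) := by apply mul_pos h1; linarith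
  unfold ramp
  rw [max_eq_left]
  exact (min_le_right _ _).trans (div_nonpos_of_nonpos_of_nonneg (by linarith) h4.le)

lemma abs_ramp_sub_le (hK : 0 < K) (hL : 5 ≤ L) (n : ℕ) :
    |ramp K L n - ramp K L (n + 1)| ≤ 1 / (K * (L - 4 : ℝ)) := by
  have h1 : (0 : ℝ) < K := by exact_mod_cast hK
  have h2 : (5 : ℝ) ≤ L := by exact_mod_cast hL
  have h4 : 0 < (K : ℝ) * (L - 4) := by apply mul_pos h1; linarith
  unfold ramp
  calc _ ≤ |min 1 (((K * L : ℝ) - 2 * K - n) / (K * (L - 4 : ℝ)))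
        - min 1 (((K * L : ℝ) - 2 * K - (n + 1 : ℕ)) / (K * (L - 4 : ℝ)))| := by
        rw [max_comm 0, max_comm 0]; exact abs_max_sub_max_le_abs _ _ _
    _ ≤ |((K * L : ℝ) - 2 * K - n) / (K * (L - 4 : ℝ))
        - ((K * L : ℝ) - 2 * K - (n + 1 : ℕ)) / (K * (L - 4 : ℝ))| := by
        rw [min_comm 1, min_comm 1]
        refine (abs_min_sub_min_le_max _ _ _ _).trans ?_
        simp
    _ = 1 / (K * (L - 4 : ℝ)) := by
        rw [← sub_div]
        push_cast
        rw [show ((K * L : ℝ) - 2 * K - n) - ((K * L : ℝ) - 2 * K - (n + 1)) = 1 by ring]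
        exact abs_of_pos (by positivity)

open Classical in
/-- Test function for the capacity of `mono (-1)`. -/
def testFun (σ : Config K L) : ℝ :=
  if Cross K L (arr σ) (-1) then 1
  else if (∃ a, Cross K L (arr σ) a) ∨ ¬ HasNeg K L (arr σ) then 0
  else ramp K L (cnt K L (arr σ) 0)

lemma testFun_cross_neg {σ : Config K L} (h : Cross K L (arr σ) (-1)) : testFun σ = 1 := if_pos h

lemma testFun_cross {σ : Config K L} {a : ℤ} (h : Cross K L (arr σ) a) (ha : a ≠ -1) :
    testFun σ = 0 := by
  unfold testFun
  rw [if_neg fun h' => ha (h.unique h'), if_pos (Or.inl ⟨a, h⟩)]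

/-- All rows, or all columns, are nonconstant. -/
def Striped (s : ℕ → ℕ → ℤ) (K L : ℕ) : Prop := RowsNC K L s ∨ RowsNC L K fun i j => s j i

lemma Striped.not_cross {s : ℕ → ℕ → ℤ} (h : Striped s K L) {a : ℤ} : ¬ Cross K L s a := by
  rintro hc
  rcases h with h | h
  · exact hc.not_rowsNC h
  · exact hc.swap.not_rowsNC h

lemma testFun_not_hasNeg {σ : Config K L} (h : Striped (arr σ) K L) (hn : ¬ HasNeg K L (arr σ)) :
    testFun σ = 0 := by
  unfold testFun
  rw [if_neg h.not_cross, if_pos (Or.inr hn)]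

lemma testFun_hasNeg {σ : Config K L} (h : Striped (arr σ) K L) (hn : HasNeg K L (arr σ)) :
    testFun σ = ramp K L (cnt K L (arr σ) 0) := by
  unfold testFun
  rw [if_neg h.not_cross, if_neg]
  rintro (⟨a, ha⟩ | h')
  · exact h.not_cross ha
  · exact h' hn

/-- The flat pieces of the ramp match the values on crosses: strips adjacent to one are within 2K
cells of either end of the chain. -/
lemma testFun_eq_of_cross (h5 : 5 ≤ K) (hKL : K ≤ L) {σ ζ : Config K L} {i j : ℕ}
    (hf : Flip K L (arr σ) (arr ζ) i j) {a : ℤ} (hσ : Cross K L (arr σ) a)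
    (hζ : Striped (arr ζ) K L) (he : en K L (arr ζ) ≤ K + 1) : testFun σ = testFun ζ := by
  by_cases ha : a = -1
  · subst ha
    have key : HasNeg K L (arr ζ) ∧ cnt K L (arr ζ) 0 ≤ 2 * K := by
      rcases hζ with h | h
      · exact hf.cnt_of_cross_neg (by omega) le_rfl (by omega) hσ h (arr_spins ζ) he
      · obtain ⟨h1, h2⟩ := hf.swap.cnt_of_cross_neg (by omega) hKL (by omega) hσ.swap h
          (arr_spins ζ).swap (by rwa [en_swap])
        exact ⟨h1.swap, by rwa [cnt_swap] at h2⟩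
    rw [testFun_cross_neg hσ, testFun_hasNeg hζ key.1, ramp_eq_one (by omega) (by omega) key.2]
  · rw [testFun_cross hσ ha]
    by_cases hn : HasNeg K L (arr ζ)
    · have key : K * L ≤ cnt K L (arr ζ) 0 + 2 * K := by
        rcases hζ with h | h
        · exact hf.cnt_of_cross_ne (by omega) le_rfl (by omega) ha hσ h (arr_spins ζ) he hn
        · have := hf.swap.cnt_of_cross_ne (by omega) hKL (by omega) ha hσ.swap h
            (arr_spins ζ).swap (by rwa [en_swap]) hn.swap
          rwa [cnt_swap, mul_comm] at this
      rw [testFun_hasNeg hζ hn, ramp_eq_zero (by omega) (by omega) key]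
    · rw [testFun_not_hasNeg hζ hn]

/-- The orientations of the strips that are relevant at the energy barrier. -/
abbrev Orient (K L : ℕ) : Type := {o : Bool // o = true → K = L}

/-- Arrays, transposed or not. -/
def tr (o : Bool) (s : ℕ → ℕ → ℤ) : ℕ → ℕ → ℤ := if o then fun i j => s j i else s

/-- The strip with `n` spins `0` and all other spins `-1`, as a configuration. -/
def stripConfig (o : Orient K L) (r c : Bool) (n : ℕ) : Config K L :=
  ofArr K L (tr o.1 (strip K L r c n))

lemma Orient.spins_tr (o : Orient K L) {s : ℕ → ℕ → ℤ} (h : Spins K L s) :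
    Spins K L (tr o.1 s) := by
  obtain ⟨o, ho⟩ := o
  cases o
  · exact h
  · have := ho rfl
    subst this
    exact h.swap

lemma Orient.en_tr (o : Orient K L) (s : ℕ → ℕ → ℤ) : en K L (tr o.1 s) = en K L s := by
  obtain ⟨o, ho⟩ := o
  cases o
  · rfl
  · have := ho rfl
    subst this
    exact en_swap _ _ _

lemma arr_stripConfig (o : Orient K L) (r c : Bool) (n : ℕ) {i j : ℕ} (hi : i < K) (hj : j < L) :
    arr (stripConfig o r c n) i j = tr o.1 (strip K L r c n) i j :=
  arr_ofArr (o.spins_tr (strip_spins _ _ _ _ _)) hi hj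

/-- Relation between consecutive strips that are seen by the test function. -/
def StripEdge (σ ζ : Config K L) : Prop :=
  ∃ (o : Orient K L) (r c : Bool) (n : ℕ), σ = stripConfig o r c n ∧ ζ = stripConfig o r c (n + 1) ∧
    cnt K L (arr σ) 0 = n ∧ cnt K L (arr ζ) 0 = n + 1

lemma stripEdge_of_isStrip {σ ζ : Config K L} {r c : Bool} {v k : ℕ} (hv : v + 2 ≤ L) (hk : k < K)
    (hσ : IsStrip K L (arr σ) 0 (-1) r c v k) (hζ : IsStrip K L (arr ζ) 0 (-1) r c v (k + 1)) :
    StripEdge σ ζ := by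
  refine ⟨⟨false, by simp⟩, r, c, v * K + k, ?_, ?_, ?_, ?_⟩
  · refine eq_of_arr_eq fun i hi j hj => ?_
    rw [arr_stripConfig _ _ _ _ hi hj]
    exact hσ.eq_strip hk.le hi hj
  · refine eq_of_arr_eq fun i hi j hj => ?_
    rw [arr_stripConfig _ _ _ _ hi hj]
    exact hζ.eq_strip hk hi hj
  · exact hσ.cnt_eq (by decide) (by omega) hk.le
  · exact hζ.cnt_eq (by decide) (by omega) hk

lemma stripEdge_of_isStrip_swap (hKL : L = K) {σ ζ : Config K L} {r c : Bool} {v k : ℕ}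
    (hv : v + 2 ≤ K) (hk : k < L) (hσ : IsStrip L K (fun i j => arr σ j i) 0 (-1) r c v k)
    (hζ : IsStrip L K (fun i j => arr ζ j i) 0 (-1) r c v (k + 1)) : StripEdge σ ζ := by
  subst hKL
  refine ⟨⟨true, by simp⟩, r, c, v * L + k, ?_, ?_, ?_, ?_⟩
  · refine eq_of_arr_eq fun i hi j hj => ?_
    rw [arr_stripConfig _ _ _ _ hi hj]
    exact hσ.eq_strip hk.le hj hi
  · refine eq_of_arr_eq fun i hi j hj => ?_
    rw [arr_stripConfig _ _ _ _ hi hj]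
    exact hζ.eq_strip hk hj hi
  · rw [← cnt_swap]
    exact hσ.cnt_eq (by decide) (by omega) hk.le
  · rw [← cnt_swap]
    exact hζ.cnt_eq (by decide) (by omega) hk

/-- The test function varies only along consecutive strips. -/
lemma testFun_gradient (h5 : 5 ≤ K) (hKL : K ≤ L) {σ ζ : Config K L} {i j : ℕ}
    (hf : Flip K L (arr σ) (arr ζ) i j) (hσ : en K L (arr σ) ≤ K + 1)
    (hζ : en K L (arr ζ) ≤ K + 1) (hne : testFun σ ≠ testFun ζ) :
    Striped (arr σ) K L ∧ Striped (arr ζ) K L ∧ HasNeg K L (arr σ) ∧ HasNeg K L (arr ζ) ∧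
      (K : ℤ) + 1 ≤ max (en K L (arr σ)) (en K L (arr ζ)) ∧ (StripEdge σ ζ ∨ StripEdge ζ σ) := by
  have key : ∀ {σ ζ : Config K L}, Flip K L (arr σ) (arr ζ) i j → en K L (arr σ) ≤ K + 1 →
      en K L (arr ζ) ≤ K + 1 → Striped (arr σ) K L → Striped (arr ζ) K L → HasNeg K L (arr σ) →
      HasNeg K L (arr ζ) ∧ (K : ℤ) + 1 ≤ max (en K L (arr σ)) (en K L (arr ζ)) ∧
        (StripEdge σ ζ ∨ StripEdge ζ σ) := by
    intro σ ζ hf hσ hζ sσ sζ hn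
    rcases sσ with s1 | s1
    · rcases sζ with s2 | s2
      · obtain ⟨-, h1, r, c, v, k, h2, h3, h4, h5⟩ := hf.rows_pair (by omega) le_rfl (by omega) s1 s2
          (arr_spins σ) hσ hζ hn
        refine ⟨?_, h1, h5.imp (fun h => stripEdge_of_isStrip h3 h4 h.1 h.2)
          fun h => stripEdge_of_isStrip h3 h4 h.1 h.2⟩
        rcases h5 with h5 | h5
        · exact h5.2.hasNeg (by omega) h3
        · exact h5.1.hasNeg (by omega) h3
      · exact (hf.not_rowsNC_colsNC (by omega) s1 hσ s2).elim
    · rcases sζ with s2 | s2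
      · exact (hf.symm.not_rowsNC_colsNC (by omega) s2 hζ s1).elim
      · obtain ⟨h0, h1, r, c, v, k, h2, h3, h4, h5⟩ := hf.swap.rows_pair (by omega) hKL (by omega)
          s1 s2 (arr_spins σ).swap (by rwa [en_swap]) (by rwa [en_swap]) hn.swap
        rw [en_swap K L (arr σ), en_swap K L (arr ζ)] at h1
        refine ⟨?_, h1, h5.imp (fun h => stripEdge_of_isStrip_swap h0 h3 h4 h.1 h.2)
          fun h => stripEdge_of_isStrip_swap h0 h3 h4 h.1 h.2⟩
        rcases h5 with h5 | h5
        · exact (h5.2.hasNeg (by omega) h3).swap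
        · exact (h5.1.hasNeg (by omega) h3).swap
  rcases cross_or_nonconst K L (arr σ) with ⟨a, ha⟩ | hS
  · exfalso
    rcases cross_or_nonconst K L (arr ζ) with ⟨b, hb⟩ | hS'
    · have := hf.cross_unique (by omega) ha hb
      subst this
      by_cases ha1 : a = -1
      · subst ha1
        exact hne (by rw [testFun_cross_neg ha, testFun_cross_neg hb])
      · exact hne (by rw [testFun_cross ha ha1, testFun_cross hb ha1])
    · exact hne (testFun_eq_of_cross h5 hKL hf ha hS' hζ)
  · rcases cross_or_nonconst K L (arr ζ) with ⟨b, hb⟩ | hS'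
    · exact (hne (testFun_eq_of_cross h5 hKL hf.symm hb hS hσ).symm).elim
    · refine ⟨hS, hS', ?_⟩
      by_cases hn : HasNeg K L (arr σ)
      · exact ⟨hn, key hf hσ hζ hS hS' hn⟩
      · by_cases hn' : HasNeg K L (arr ζ)
        · exact (hn (key hf.symm hζ hσ hS' hS hn').1).elim
        · exact (hne (by rw [testFun_not_hasNeg hS hn, testFun_not_hasNeg hS' hn'])).elim

end BlumeCapel

/-! ### Strips as cell-by-cell chains. -/

namespace Grid

variable {M N : ℕ}

lemma strip_isStrip' (r c : Bool) (n : ℕ) (hM : 0 < M) :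
    IsStrip M N (strip M N r c n) 0 (-1) r c (n / M) (n % M) := by
  have := strip_isStrip (N := N) r c (v := n / M) (h := n % M) (Nat.mod_lt n hM).le
  rwa [Nat.div_add_mod'] at this

lemma strip_flip (r c : Bool) {n : ℕ} (hn : n < M * N) :
    ∃ i j, Flip M N (strip M N r c n) (strip M N r c (n + 1)) i j := by
  have hM : 0 < M := Nat.pos_of_ne_zero fun h => by simp [h] at hn
  have h1 : n % M < M := Nat.mod_lt n hM
  have h2 : n / M < N := Nat.div_lt_of_lt_mul hn
  have h3 := Nat.div_add_mod' n M
  refine ⟨_, _, cond_lt r h1, cond_lt c h2, ?_, fun i hi j hj hij => ?_⟩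
  · unfold strip
    rw [cond_cond r h1, cond_cond c h2, h3, if_neg (lt_irrefl _), if_pos (Nat.lt_succ_self n)]
    decide
  · unfold strip
    have hne : (if c then N - 1 - j else j) * M + (if r then M - 1 - i else i) ≠ n := by
      intro h
      have e1 : (if r then M - 1 - i else i) = n % M := by
        rw [← h, Nat.mul_add_mod', Nat.mod_eq_of_lt (cond_lt r hi)]
      have e2 : (if c then N - 1 - j else j) = n / M := by
        rw [← h, mul_comm, Nat.mul_add_div hM, Nat.div_eq_of_lt (cond_lt r hi), add_zero]
      rw [← e1, ← e2, cond_cond r hi, cond_cond c hj] at hij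
      omega
    by_cases hlt : (if c then N - 1 - j else j) * M + (if r then M - 1 - i else i) < n
    · rw [if_pos hlt, if_pos (by omega)]
    · rw [if_neg hlt, if_neg (by omega)]

lemma strip_en_le (r c : Bool) (n : ℕ) (hM : 0 < M) : en M N (strip M N r c n) ≤ M + 1 :=
  ((strip_isStrip' r c n hM).en_le (by decide) (Nat.mod_lt n hM).le).1

lemma strip_en_le_of_le (r c : Bool) {n : ℕ} (hn : n ≤ M) : en M N (strip M N r c n) ≤ M := by
  have := strip_isStrip (N := N) r c (v := 0) hn
  rw [zero_mul, zero_add] at this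
  exact (this.en_le (by decide) hn).2 (by omega)

lemma strip_en_le_of_ge (r c : Bool) {n : ℕ} (hn : (N - 1) * M ≤ n) (hn' : n ≤ M * N)
    (hN : 0 < N) : en M N (strip M N r c n) ≤ M := by
  obtain ⟨h, rfl⟩ := Nat.exists_eq_add_of_le hn
  have e : (N - 1) * M + M = M * N := by
    obtain ⟨m, rfl⟩ := Nat.exists_eq_succ_of_ne_zero hN.ne'
    simp; ring
  have hh : h ≤ M := by omega
  exact ((strip_isStrip (N := N) r c (v := N - 1) hh).en_le (by decide) hh).2 (by omega)

lemma strip_cnt (r c : Bool) {n : ℕ} (hn : n < M * N) : cnt M N (strip M N r c n) 0 = n := by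
  have hM : 0 < M := Nat.pos_of_ne_zero fun h => by simp [h] at hn
  rw [(strip_isStrip' r c n hM).cnt_eq (by decide) (Nat.div_lt_of_lt_mul hn) (Nat.mod_lt n hM).le,
    Nat.div_add_mod']

lemma strip_first (r c : Bool) {n : ℕ} (hn : M ≤ n)
    (hn' : n ≤ (N - 1) * M) {i : ℕ} (hi : i < M) :
    strip M N r c n i 0 = (if c then -1 else 0) ∧
      strip M N r c n i (N - 1) = (if c then 0 else -1) := by
  have hi' := cond_lt r hi
  unfold strip
  cases c
  · simp only [Bool.false_eq_true, if_false]
    exact ⟨if_pos (by omega), if_neg (by omega)⟩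
  · simp only [if_true, Nat.sub_self]
    exact ⟨if_neg (by simp; omega), if_pos (by omega)⟩

/-- The orientation of the rows is determined by two consecutive strips. -/
lemma strip_row_eq {r r' c : Bool} {n : ℕ} (hM : 2 ≤ M) (hn : n + 1 < M * N)
    (h1 : ∀ i < M, ∀ j < N, strip M N r c n i j = strip M N r' c n i j)
    (h2 : ∀ i < M, ∀ j < N, strip M N r c (n + 1) i j = strip M N r' c (n + 1) i j) : r = r' := by
  have key : ∀ {r r' : Bool}, (∀ i < M, ∀ j < N, strip M N r c n i j = strip M N r' c n i j) →
      (∀ i < M, ∀ j < N, strip M N r c (n + 1) i j = strip M N r' c (n + 1) i j) →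
      r = false → r' = true → False := by
    rintro r r' h1 h2 rfl rfl
    have hv : n / M < N := Nat.div_lt_of_lt_mul (by omega)
    have hk : n % M < M := Nat.mod_lt n (by omega)
    have e1 := h1 0 (by omega) _ (cond_lt c hv)
    have e2 := h2 0 (by omega) _ (cond_lt c hv)
    have hd := Nat.div_add_mod' n M
    unfold strip at e1 e2
    rw [cond_cond c hv] at e1 e2
    simp only [Bool.false_eq_true, if_false, if_true] at e1 e2
    -- At `n + 1` cells the first site of the current column is filled for one row orientation. The
    -- other one fills it only when the column becomes complete, but then at `n` cells the two
    -- already differ there.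
    rw [if_pos (by omega), eq_comm] at e2
    have e3 : n / M * M + (M - 1 - 0) < n + 1 := by
      by_contra h
      rw [if_neg h] at e2
      omega
    rw [if_pos (by omega), if_neg (by omega)] at e1
    omega
  cases r <;> cases r'
  · rfl
  · exact (key h1 h2 rfl rfl).elim
  · exact (key (fun i hi j hj => (h1 i hi j hj).symm) (fun i hi j hj => (h2 i hi j hj).symm)
      rfl rfl).elim
  · rfl

end Grid

/-! ### Chains of strips in configuration space. -/

namespace BlumeCapel

open Grid

variable {K L : ℕ}

lemma Orient.cnt_tr (o : Orient K L) (s : ℕ → ℕ → ℤ) (x : ℤ) :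
    cnt K L (tr o.1 s) x = cnt K L s x := by
  obtain ⟨o, ho⟩ := o
  cases o
  · rfl
  · have := ho rfl
    subst this
    exact cnt_swap _ _ _ _

lemma Orient.flip_tr (o : Orient K L) {s t : ℕ → ℕ → ℤ} (h : ∃ i j, Flip K L s t i j) :
    ∃ i j, Flip K L (tr o.1 s) (tr o.1 t) i j := by
  obtain ⟨o, ho⟩ := o
  cases o
  · exact h
  · have := ho rfl
    subst this
    obtain ⟨i, j, h⟩ := h
    exact ⟨j, i, h.swap⟩

lemma en_stripConfig (o : Orient K L) (r c : Bool) (n : ℕ) :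
    en K L (arr (stripConfig o r c n)) = en K L (strip K L r c n) := by
  rw [en_congr fun i hi j hj => arr_stripConfig o r c n hi hj, o.en_tr]

lemma cnt_congr {M N : ℕ} {s t : ℕ → ℕ → ℤ} (h : ∀ i < M, ∀ j < N, s i j = t i j) (x : ℤ) :
    cnt M N s x = cnt M N t x := by
  refine Finset.sum_congr rfl fun i hi => Finset.sum_congr rfl fun j hj => ?_
  rw [h i (Finset.mem_range.1 hi) j (Finset.mem_range.1 hj)]

lemma cnt_stripConfig (o : Orient K L) (r c : Bool) {n : ℕ} (hn : n < K * L) :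
    cnt K L (arr (stripConfig o r c n)) 0 = n := by
  rw [cnt_congr fun i hi j hj => arr_stripConfig o r c n hi hj, o.cnt_tr, strip_cnt r c hn]

lemma step_stripConfig (o : Orient K L) (r c : Bool) {n : ℕ} (hn : n < K * L) :
    Step (stripConfig o r c n) (stripConfig o r c (n + 1)) := by
  obtain ⟨i, j, h1, h2, h3, h4⟩ := o.flip_tr (strip_flip r c hn)
  refine step_of_flip (i := i) (j := j) ⟨h1, h2, ?_, fun k hk l hl hkl => ?_⟩
  · rwa [arr_stripConfig _ _ _ _ h1 h2, arr_stripConfig _ _ _ _ h1 h2]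
  · rw [arr_stripConfig _ _ _ _ hk hl, arr_stripConfig _ _ _ _ hk hl, h4 k hk l hl hkl]

lemma stripConfig_zero (o : Orient K L) (r c : Bool) : stripConfig o r c 0 = mono K L (-1) := by
  refine eq_of_arr_eq fun i hi j hj => ?_
  rw [arr_stripConfig _ _ _ _ hi hj, arr_mono _ hi hj]
  obtain ⟨o, ho⟩ := o
  cases o <;> simp [tr, strip]

lemma stripConfig_last (o : Orient K L) (r c : Bool) : stripConfig o r c (K * L) = mono K L 0 := by
  have key : ∀ i < K, ∀ j < L, strip K L r c (K * L) i j = 0 := by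
    intro i hi j hj
    refine if_pos ?_
    have h1 := cond_lt c hj
    have h2 := cond_lt r hi
    have := Nat.mul_le_mul_left K (Nat.succ_le_of_lt h1)
    rw [Nat.mul_succ, mul_comm] at this
    omega
  refine eq_of_arr_eq fun i hi j hj => ?_
  rw [arr_stripConfig _ _ _ _ hi hj, arr_mono _ hi hj]
  obtain ⟨o, ho⟩ := o
  cases o
  · exact (key i hi j hj).trans (by simp)
  · have := ho rfl
    subst this
    exact (key j hj i hi).trans (by simp)

lemma lowConn_stripConfig (hK : 0 < K) (hL : 0 < L) (o : Orient K L) (r c : Bool) {m n : ℕ}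
    (hmn : m ≤ n) (hn : n ≤ K * L)
    (h : ∀ k, m ≤ k → k ≤ n → en K L (strip K L r c k) ≤ K) :
    Relation.ReflTransGen (landscape K L hK hL).lowAdj (stripConfig o r c m)
      (stripConfig o r c n) := by
  induction n, hmn using Nat.le_induction with
  | base => exact Relation.ReflTransGen.refl
  | succ n hmn ih =>
    refine (ih (by omega) fun k h1 h2 => h k h1 (by omega)).tail
      ⟨step_stripConfig o r c (by omega), max_lt ?_ ?_⟩
    · have := h n hmn (by omega)
      rw [← en_stripConfig o] at this
      exact Int.lt_add_one_of_le this
    · have := h (n + 1) (by omega) le_rfl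
      rw [← en_stripConfig o] at this
      exact Int.lt_add_one_of_le this

/-- Consecutive pairs of strips are distinct. -/
lemma stripConfig_injective (h2 : 2 ≤ K) (hL : 2 ≤ L) {o o' : Orient K L} {r r' c c' : Bool}
    {n n' : ℕ} (hn : K ≤ n) (hnL : n < (L - 1) * K) (hnL' : n' < (L - 1) * K)
    (e1 : stripConfig o r c n = stripConfig o' r' c' n')
    (e2 : stripConfig o r c (n + 1) = stripConfig o' r' c' (n' + 1)) :
    o = o' ∧ r = r' ∧ c = c' ∧ n = n' := by
  have hlast : (L - 1) * K + K = K * L := by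
    obtain ⟨m, rfl⟩ := Nat.exists_eq_add_of_le hL
    rw [show 2 + m - 1 = m + 1 by omega]; ring
  have hnn : n = n' := by
    have := cnt_stripConfig o r c (n := n) (by omega)
    rw [e1, cnt_stripConfig o' r' c' (by omega)] at this
    exact this.symm
  subst hnn
  -- Since `K ≤ n < (L - 1) * K`, the first line is complete and the last untouched, so a corner
  -- spin tells from which side the strip grows.
  have hc : c = c' := by
    have a1 := arr_stripConfig o r c n (i := 0) (j := 0) (by omega) (by omega)
    rw [e1, arr_stripConfig _ _ _ _ (by omega) (by omega)] at a1
    have b1 := (strip_first (N := L) r c (M := K) hn hnL.le (i := 0) (by omega)).1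
    have b2 := (strip_first (N := L) r' c' (M := K) hn hnL.le (i := 0) (by omega)).1
    have t : ∀ (o : Orient K L) (s : ℕ → ℕ → ℤ), tr o.1 s 0 0 = s 0 0 := by
      rintro ⟨o, ho⟩ s
      cases o <;> rfl
    rw [t, t, b1, b2] at a1
    cases c <;> cases c' <;> simp_all
  subst hc
  -- On a square, the corner `(0, K - 1)` lies in the last line of the upright strip and the first
  -- line of the transposed one, whose spins differ.
  have ho : o = o' := by
    have key : ∀ {o o' : Orient K L} {r r' : Bool},
        stripConfig o r c n = stripConfig o' r' c n → o.1 = false → o'.1 = true → False := by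
      rintro ⟨o, ho⟩ ⟨o', ho'⟩ r r' e1 h h'
      simp only at h h'
      subst h h'
      have hKL := ho' rfl
      subst hKL
      have a1 := arr_stripConfig ⟨false, ho⟩ r c n (i := 0) (j := K - 1) (by omega) (by omega)
      have a2 := arr_stripConfig ⟨false, ho⟩ r c n (i := 0) (j := 0) (by omega) (by omega)
      rw [e1, arr_stripConfig _ _ _ _ (by omega) (by omega)] at a1 a2
      simp only [tr, Bool.false_eq_true, if_false, if_true] at a1 a2
      have b1 := strip_first (N := K) r c (M := K) hn hnL.le (i := 0) (by omega)
      have b2 := strip_first (N := K) r' c (M := K) hn hnL.le (i := 0) (by omega)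
      have b3 := strip_first (N := K) r' c (M := K) hn hnL.le (i := K - 1) (by omega)
      rw [b1.2, b3.1] at a1
      cases c <;> simp at a1
    rcases hb : o.1 with _ | _ <;> rcases hb' : o'.1 with _ | _
    · exact Subtype.ext (hb.trans hb'.symm)
    · exact (key e1 hb hb').elim
    · exact (key e1.symm hb' hb).elim
    · exact Subtype.ext (hb.trans hb'.symm)
  subst ho
  refine ⟨rfl, ?_, rfl, rfl⟩
  have T : ∀ m, stripConfig o r c m = stripConfig o r' c m →
      ∀ i < K, ∀ j < L, strip K L r c m i j = strip K L r' c m i j := by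
    intro m e i hi j hj
    obtain ⟨o, ho⟩ := o
    cases o
    · have := arr_stripConfig ⟨false, ho⟩ r c m hi hj
      rw [e, arr_stripConfig _ _ _ _ hi hj] at this
      exact this.symm
    · have hKL := ho rfl
      subst hKL
      have := arr_stripConfig ⟨true, ho⟩ r c m hj hi
      rw [e, arr_stripConfig _ _ _ _ hj hi] at this
      exact this.symm
  -- One strip may be made of complete columns and forget the row orientation; two consecutive
  -- strips cannot both be, which is why edges, not configurations, are compared.
  exact strip_row_eq h2 (by omega) (T n e1) (T (n + 1) e2)

end BlumeCapel

/-! ### Two-sided bounds for the capacity. -/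

namespace BlumeCapel

open Grid

variable {K L : ℕ} (hK : 0 < K) (hL : 0 < L)

lemma testFun_isPot : (landscape K L hK hL).IsPot testFun := by
  refine ⟨testFun_cross_neg (cross_mono hK hL (-1)), testFun_cross (cross_mono hK hL 0) ?_,
    testFun_cross (cross_mono hK hL 1) ?_⟩ <;> simp

lemma testFun_eq_of_low (h5 : 5 ≤ K) (hKL : K ≤ L) (σ ζ : Config K L)
    (h : (landscape K L hK hL).adj σ ζ)
    (hlev : (landscape K L hK hL).lev σ ζ < (landscape K L hK hL).barrier) :
    testFun σ = testFun ζ := by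
  by_contra hne
  obtain ⟨i, j, hf⟩ := Step.flip h
  have h1 := (max_lt_iff.1 hlev).1.le
  have h2 := (max_lt_iff.1 hlev).2.le
  have := (testFun_gradient h5 hKL hf h1 h2 hne).2.2.2.2.1
  exact absurd hlev (not_lt.2 this)

/-- The test function is constant along edges strictly below the barrier, but takes different values
at -1 and 0. -/
lemma lo_notMem_well (h5 : 5 ≤ K) (hKL : K ≤ L) :
    (landscape K L hK hL).lo ∉ (landscape K L hK hL).well := by
  intro h
  have key : ∀ σ, Relation.ReflTransGen (landscape K L hK hL).lowAdj (landscape K L hK hL).mid σ →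
      testFun σ = 0 := by
    intro σ hσ
    induction hσ with
    | refl => exact (testFun_isPot hK hL).2.1
    | tail _ hbc ih => rw [← testFun_eq_of_low hK hL h5 hKL _ _ hbc.1 hbc.2, ih]
  have := key _ h
  rw [(testFun_isPot hK hL).1] at this
  exact one_ne_zero this

lemma testFun_sub_le (h5 : 5 ≤ K) (hKL : K ≤ L) {σ ζ : Config K L}
    (sσ : Striped (arr σ) K L) (sζ : Striped (arr ζ) K L) (nσ : HasNeg K L (arr σ))
    (nζ : HasNeg K L (arr ζ)) (he : StripEdge σ ζ) (hne : testFun σ ≠ testFun ζ) :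
    |testFun σ - testFun ζ| ≤ 1 / (K * (L - 4 : ℝ)) ∧
      ∃ (o : Orient K L) (r c : Bool) (m : Fin (K * (L - 4))),
        σ = stripConfig o r c (2 * K + m) ∧ ζ = stripConfig o r c (2 * K + m + 1) := by
  obtain ⟨o, r, c, n, h1, h2, h3, h4⟩ := he
  rw [testFun_hasNeg sσ nσ, testFun_hasNeg sζ nζ, h3, h4] at hne ⊢
  refine ⟨abs_ramp_sub_le (by omega) (by omega) n, ?_⟩
  have hlo : 2 * K ≤ n := by
    by_contra h
    exact hne (by rw [ramp_eq_one (by omega) (by omega) (by omega),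
      ramp_eq_one (by omega) (by omega) (by omega)])
  have hhi : n + 2 * K < K * L := by
    by_contra h
    exact hne (by rw [ramp_eq_zero (by omega) (by omega) (by omega),
      ramp_eq_zero (by omega) (by omega) (by omega)])
  obtain ⟨m, rfl⟩ := Nat.exists_eq_add_of_le hlo
  refine ⟨o, r, c, ⟨m, ?_⟩, h1, h2⟩
  rw [Nat.mul_sub]
  omega

/-- Number of the relevant orientations of strips. -/
def orients (K L : ℕ) : ℝ := Fintype.card (Orient K L)

/-- There are at most `4 * orients K L * K * (L - 4)` edges with nonzero gradient: two cells per
row, at either end, fall in the flat pieces of the ramp. Each contributes at most the squared slope.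
-/
lemma form_testFun_le (h5 : 5 ≤ K) (hKL : K ≤ L) :
    Network.form (landscape K L hK hL).flatW testFun testFun
      ≤ 4 * orients K L / (K * (L - 4 : ℝ)) := by
  have hL4 : (0 : ℝ) < (L : ℝ) - 4 := by
    have : (5 : ℝ) ≤ L := by exact_mod_cast h5.trans hKL
    linarith
  have hK0 : (0 : ℝ) < K := by exact_mod_cast hK
  refine ((landscape K L hK hL).form_flatW_le
    (ι := Orient K L × Bool × Bool × Fin (K * (L - 4)))
    (fun k => (stripConfig k.1 k.2.1 k.2.2.1 (2 * K + k.2.2.2),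
      stripConfig k.1 k.2.1 k.2.2.1 (2 * K + k.2.2.2 + 1)))
    (δ := 1 / (K * (L - 4 : ℝ))) fun σ ζ hadj hlev hne => ?_).trans_eq ?_
  · obtain ⟨i, j, hf⟩ := Step.flip hadj
    obtain ⟨sσ, sζ, nσ, nζ, -, he⟩ := testFun_gradient h5 hKL hf ((le_max_left _ _).trans hlev)
      ((le_max_right _ _).trans hlev) hne
    rcases he with he | he
    · obtain ⟨h1, o, r, c, m, h2, h3⟩ := testFun_sub_le h5 hKL sσ sζ nσ nζ he hne
      exact ⟨h1, (o, r, c, m), Or.inl (by rw [h2, h3])⟩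
    · obtain ⟨h1, o, r, c, m, h2, h3⟩ := testFun_sub_le h5 hKL sζ sσ nζ nσ he hne.symm
      exact ⟨by rwa [abs_sub_comm], (o, r, c, m), Or.inr (by rw [h2, h3])⟩
  · rw [Fintype.card_prod, Fintype.card_prod, Fintype.card_prod, Fintype.card_bool, Fintype.card_fin,
      orients]
    push_cast [Nat.cast_sub (show 4 ≤ L by omega)]
    field_simp
    ring

lemma sum_sq_le_cap (h5 : 5 ≤ K) (hKL : K ≤ L) {β : ℝ} (hβ : 0 ≤ β) (f : Config K L → ℝ) :
    ∑ k : Orient K L × Bool × Bool × Fin (K * (L - 2)),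
      (f (stripConfig k.1 k.2.1 k.2.2.1 (K + k.2.2.2))
        - f (stripConfig k.1 k.2.1 k.2.2.1 (K + k.2.2.2 + 1))) ^ 2
      ≤ Network.form ((landscape K L hK hL).W β) f f := by
  have hlast : (L - 1) * K = K + K * (L - 2) := by
    obtain ⟨m, rfl⟩ := Nat.exists_eq_add_of_le (show 2 ≤ L by omega)
    rw [show 2 + m - 1 = m + 1 by omega, show 2 + m - 2 = m by omega]; ring
  have hlast' : (L - 1) * K + K = K * L := by
    obtain ⟨m, rfl⟩ := Nat.exists_eq_add_of_le (show 2 ≤ L by omega)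
    rw [show 2 + m - 1 = m + 1 by omega]; ring
  refine (landscape K L hK hL).sum_sq_le_form
    (e := fun k : Orient K L × Bool × Bool × Fin (K * (L - 2)) =>
      (stripConfig k.1 k.2.1 k.2.2.1 (K + k.2.2.2),
        stripConfig k.1 k.2.1 k.2.2.1 (K + k.2.2.2 + 1))) ?_ ?_ ?_ hβ f
  · rintro ⟨o, r, c, m, hm⟩ ⟨o', r', c', m', hm'⟩ h
    simp only [Prod.mk.injEq] at h
    obtain ⟨rfl, rfl, rfl, h4⟩ := stripConfig_injective (by omega) (by omega) (by omega) (by omega)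
      (by omega) h.1 h.2
    have : m = m' := by omega
    subst this
    rfl
  · rintro ⟨o, r, c, m, hm⟩ ⟨o', r', c', m', hm'⟩ h
    simp only [Prod.swap_prod_mk, Prod.mk.injEq] at h
    have e1 := cnt_stripConfig o r c (n := K + m) (by omega)
    have e2 := cnt_stripConfig o r c (n := K + m + 1) (by omega)
    rw [h.1, cnt_stripConfig _ _ _ (by omega)] at e1
    rw [h.2, cnt_stripConfig _ _ _ (by omega)] at e2
    omega
  · rintro ⟨o, r, c, m, hm⟩
    refine ⟨step_stripConfig o r c (by simp only; omega), max_le ?_ ?_⟩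
    · exact (en_stripConfig o r c _).trans_le (strip_en_le r c _ hK)
    · exact (en_stripConfig o r c _).trans_le (strip_en_le r c _ hK)

/-- Series law: Cauchy–Schwarz on the telescoping sum of differences. -/
lemma sum_sq_ge (g : ℕ → ℝ) {m : ℕ} (hm : 0 < m) :
    (g 0 - g m) ^ 2 / m ≤ ∑ k : Fin m, (g k - g (k + 1)) ^ 2 := by
  rw [Fin.sum_univ_eq_sum_range (fun k => (g k - g (k + 1)) ^ 2) m, div_le_iff₀ (by exact_mod_cast hm),
    ← Finset.sum_range_sub' g m, mul_comm]
  simpa using sq_sum_le_card_mul_sum_sq (s := Finset.range m) (f := fun k => g k - g (k + 1))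

/-- Parallel chains add up because their edges are distinct, and each one acts as `K * (L - 2)` unit
resistors in series. -/
lemma le_cap (h5 : 5 ≤ K) (hKL : K ≤ L) {β : ℝ} (hβ : 0 ≤ β) (f : Config K L → ℝ) :
    ∑ k : Orient K L × Bool × Bool,
      (f (stripConfig k.1 k.2.1 k.2.2 K) - f (stripConfig k.1 k.2.1 k.2.2 ((L - 1) * K))) ^ 2
        / ((K * (L - 2) : ℕ) : ℝ)
      ≤ Network.form ((landscape K L hK hL).W β) f f := by
  have hlast : (L - 1) * K = K + K * (L - 2) := by
    obtain ⟨m, rfl⟩ := Nat.exists_eq_add_of_le (show 2 ≤ L by omega)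
    rw [show 2 + m - 1 = m + 1 by omega, show 2 + m - 2 = m by omega]; ring
  refine le_trans ?_ (sum_sq_le_cap hK hL h5 hKL hβ f)
  simp only [Fintype.sum_prod_type]
  refine Finset.sum_le_sum fun o _ => Finset.sum_le_sum fun r _ => Finset.sum_le_sum fun c _ => ?_
  have := sum_sq_ge (fun k => f (stripConfig o r c (K + k))) (m := K * (L - 2))
    (Nat.mul_pos hK (by omega))
  rw [hlast]
  exact this

/-- Bounds for the limit of the capacity. -/
lemma exists_capacity (h5 : 5 ≤ K) (hKL : K ≤ L) :
    ∃ C, Tendsto (landscape K L hK hL).cap atTop (𝓝 C) ∧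
      4 * orients K L / (K * (L - 2 : ℝ)) ≤ C ∧ C ≤ 4 * orients K L / (K * (L - 4 : ℝ)) := by
  obtain ⟨C, hC, hle⟩ := (landscape K L hK hL).exists_tendsto_cap (testFun_isPot hK hL)
    (testFun_eq_of_low hK hL h5 hKL)
  refine ⟨C, hC, ?_, hle.trans (form_testFun_le hK hL h5 hKL)⟩
  set S := landscape K L hK hL with hS
  have hlast : (L - 1) * K ≤ K * L := by rw [mul_comm]; exact Nat.mul_le_mul_left _ (by omega)
  -- Strips of at most one line stay below the barrier, so the chain starts with the potential of
  -- -1. Symmetrically its end, in `h0`, has the potential of 0.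
  have h1 : ∀ (o : Orient K L) (r c : Bool),
      Tendsto (fun β => S.pot β (stripConfig o r c K)) atTop (𝓝 1) := by
    intro o r c
    have := S.tendsto_pot_sub_of_lowConn hC (lowConn_stripConfig hK hL o r c (m := 0) (n := K)
      (by omega) (Nat.le_mul_of_pos_right _ hL) fun k _ hk => strip_en_le_of_le r c hk)
    rw [stripConfig_zero] at this
    have h2 : ∀ β, S.pot β (mono K L (-1)) = 1 := fun β => (S.pot_isPot β).1
    simp only [h2] at this
    simpa using this.const_sub 1
  have h0 : ∀ (o : Orient K L) (r c : Bool),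
      Tendsto (fun β => S.pot β (stripConfig o r c ((L - 1) * K))) atTop (𝓝 0) := by
    intro o r c
    have := S.tendsto_pot_sub_of_lowConn hC (lowConn_stripConfig hK hL o r c (m := (L - 1) * K)
      (n := K * L) hlast le_rfl fun k hk hk' => strip_en_le_of_ge r c hk hk' hL)
    rw [stripConfig_last] at this
    have h2 : ∀ β, S.pot β (mono K L 0) = 0 := fun β => (S.pot_isPot β).2.1
    simpa only [h2, sub_zero] using this
  have h2 : Tendsto (fun β => ∑ k : Orient K L × Bool × Bool,
      (S.pot β (stripConfig k.1 k.2.1 k.2.2 K)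
        - S.pot β (stripConfig k.1 k.2.1 k.2.2 ((L - 1) * K))) ^ 2
        / ((K * (L - 2) : ℕ) : ℝ)) atTop (𝓝 (∑ _k : Orient K L × Bool × Bool,
          ((1 : ℝ) - 0) ^ 2 / ((K * (L - 2) : ℕ) : ℝ))) :=
    tendsto_finsetSum _ fun k _ => (((h1 _ _ _).sub (h0 _ _ _)).pow 2).div_const _
  have h3 := le_of_tendsto_of_tendsto h2 hC (by
    filter_upwards [eventually_ge_atTop 0] with β hβ
    exact le_cap hK hL h5 hKL hβ (S.pot β))
  refine le_trans (le_of_eq ?_) h3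
  rw [Finset.sum_const, Finset.card_univ, Fintype.card_prod, Fintype.card_prod, Fintype.card_bool,
    orients]
  push_cast [Nat.cast_sub (show 2 ≤ L by omega)]
  simp only [nsmul_eq_mul]
  push_cast
  ring

end BlumeCapel

/-! ### The prefactor and the final statement. -/

namespace BlumeCapel

variable {K L : ℕ}

lemma orients_of_lt (h : K < L) : orients K L = 1 := by
  have : Fintype.card (Orient K L) = 1 := by
    rw [Fintype.card_eq_one_iff]
    refine ⟨⟨false, by simp⟩, ?_⟩
    rintro ⟨o, ho⟩
    cases o
    · rfl
    · exact absurd (ho rfl) h.ne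
  rw [orients, this, Nat.cast_one]

lemma orients_self : orients K K = 2 := by
  have : Fintype.card (Orient K K) = 2 := by
    rw [← Fintype.card_bool]
    exact Fintype.card_congr (Equiv.subtypeUnivEquiv fun _ _ => rfl)
  rw [orients, this, Nat.cast_ofNat]

lemma orients_pos : 0 < orients K L := by
  have : Nonempty (Orient K L) := ⟨⟨false, by simp⟩⟩
  unfold orients
  exact_mod_cast Fintype.card_pos

/-- Composing with the global spin flip turns a solution of the Poisson equation for `B` into one
for `B'`. -/
lemma meanTransitionTime_neg (hK : 0 < K) (hL : 0 < L) (β : ℝ) (a : SignType) {B B' : Set SignType}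
    (hB : B.Nonempty) (hBB : ∀ b, b ∈ B' ↔ -b ∈ B) :
    meanTransitionTime K L β (-a) B = meanTransitionTime K L β a B' := by
  obtain ⟨h, hh⟩ := (landscape K L hK hL).exists_isMeanTime β (hB.image (mono K L))
  have hB' : B'.Nonempty := by
    obtain ⟨b, hb⟩ := hB
    exact ⟨-b, (hBB _).2 (by rwa [neg_neg])⟩
  have hh' := hh.neg (B := mono K L '' B') fun σ => by
    constructor
    · rintro ⟨b, hb, rfl⟩
      exact ⟨-b, (hBB b).1 hb, rfl⟩
    · rintro ⟨b, hb, h⟩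
      refine ⟨-b, (hBB _).2 (by rwa [neg_neg]), ?_⟩
      rw [← (landscape K L hK hL).neg_neg σ, ← h]
      rfl
  rw [meanTransitionTime_eq hK hL _ hB hh, meanTransitionTime_eq hK hL _ hB' hh']
  rfl

lemma asympEK_of_tendsto (hK : 0 < K) (hL : 0 < L) {a : SignType} {B : Set SignType}
    (hB : B.Nonempty) {p : ℝ} (hp : 0 < p) {h : ℝ → Config K L → ℝ}
    (hh : ∀ β, (landscape K L hK hL).IsMeanTime β (mono K L '' B) (h β))
    (hlim : Tendsto (fun β => h β (mono K L a)) atTop (𝓝 p)) :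
    AsympEK K p (fun β => meanTransitionTime K L β a B) := by
  have h1 : Tendsto (fun β => ENNReal.ofReal (h β (mono K L a) / p)) atTop (𝓝 1) := by
    have := ENNReal.tendsto_ofReal (hlim.div_const p)
    rwa [div_self hp.ne', ENNReal.ofReal_one] at this
  refine h1.congr fun β => ?_
  beta_reduce
  rw [meanTransitionTime_eq hK hL a hB (hh β), ← ENNReal.ofReal_div_of_pos (by positivity)]
  congr 1
  have := (Real.exp_pos (β * barrier K)).ne'
  field_simp

/-- The statements at fixed `K` and `L`, with a bound for the prefactor. -/
lemma eyring_kramers (h5 : 5 ≤ K) (hKL : K ≤ L) : ∃ κ : ℝ, 0 < κ ∧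
    AsympEK K κ (fun β => meanTransitionTime K L β (-1) {0, 1}) ∧
    AsympEK K (κ / 2) (fun β => meanTransitionTime K L β 0 {-1, 1}) ∧
    AsympEK K κ (fun β => meanTransitionTime K L β (-1) {0}) ∧
    AsympEK K (2 * κ) (fun β => meanTransitionTime K L β 0 {-1}) ∧
    AsympEK K (3 * κ) (fun β => meanTransitionTime K L β (-1) {1}) ∧
    |κ / (K * L : ℝ) - 1 / (4 * orients K L)| ≤ 1 / (L * orients K L) := by
  have hK : 0 < K := by omega
  have hL : 0 < L := by omega
  set S := landscape K L hK hL with hS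
  obtain ⟨C, hcap, hlo, hhi⟩ := exists_capacity hK hL h5 hKL
  have hcross := S.tendsto_cross hcap (lo_notMem_well hK hL h5 hKL) (hi_notMem_side hK hL h5 hKL)
  have hK0 : (0 : ℝ) < K := by exact_mod_cast hK
  have hL5 : (5 : ℝ) ≤ L := by exact_mod_cast h5.trans hKL
  have ho := orients_pos (K := K) (L := L)
  have hL2 : (0 : ℝ) < (L : ℝ) - 2 := by linarith
  have hL4 : (0 : ℝ) < (L : ℝ) - 4 := by linarith
  have hC : 0 < C := lt_of_lt_of_le (by positivity) hlo
  have hκ : 0 < C⁻¹ := inv_pos.2 hC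
  have hT : ∀ (A : Set SignType), A.Nonempty → ∃ h : ℝ → Config K L → ℝ,
      ∀ β, S.IsMeanTime β (mono K L '' A) (h β) := fun A hA => by
    choose h hh using fun β => S.exists_isMeanTime β (hA.image (mono K L))
    exact ⟨h, hh⟩
  refine ⟨C⁻¹, hκ, ?_, ?_, ?_, ?_, ?_, ?_⟩
  · obtain ⟨h, hh⟩ := hT {0, 1} (by simp)
    refine asympEK_of_tendsto hK hL (by simp) hκ hh ?_
    exact S.tendsto_time_lo_mid_hi hC hcap hcross fun β => by
      have := hh β
      rwa [Set.image_pair] at this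
  · obtain ⟨h, hh⟩ := hT {-1, 1} (by simp)
    refine asympEK_of_tendsto hK hL (by simp) (half_pos hκ) hh ?_
    exact S.tendsto_time_mid_lo_hi hC hcap hcross fun β => by
      have := hh β
      rwa [Set.image_pair] at this
  · obtain ⟨h, hh⟩ := hT {0} (by simp)
    refine asympEK_of_tendsto hK hL (by simp) hκ hh ?_
    exact S.tendsto_time_lo_mid hC hcap hcross fun β => by
      have := hh β
      rwa [Set.image_singleton] at this
  · obtain ⟨h, hh⟩ := hT {-1} (by simp)
    refine asympEK_of_tendsto hK hL (by simp) (by positivity) hh ?_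
    exact (S.tendsto_time_mid_lo hC hcap hcross fun β => by
      have := hh β
      rwa [Set.image_singleton] at this).1
  · obtain ⟨h, hh⟩ := hT {-1} (by simp)
    -- The three-state computation treats the target `lo`, so the start and target are exchanged by
    -- spin flip.
    have e : ∀ β, meanTransitionTime K L β (-1) {1} = meanTransitionTime K L β 1 {-1} := fun β =>
      meanTransitionTime_neg hK hL β 1 (by simp) fun b => by
        cases b <;> simp
    simp only [e]
    refine asympEK_of_tendsto hK hL (by simp) (by positivity) hh ?_
    exact (S.tendsto_time_mid_lo hC hcap hcross fun β => by
      have := hh β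
      rwa [Set.image_singleton] at this).2
  · have hlo' : K * (L - 4) / (4 * orients K L) ≤ C⁻¹ := by
      rw [← inv_div]
      exact inv_anti₀ hC hhi
    have hhi' : C⁻¹ ≤ K * (L - 2) / (4 * orients K L) := by
      rw [← inv_div]
      exact inv_anti₀ (by positivity) hlo
    have hKL0 : (0 : ℝ) < K * L := by positivity
    have hL0 : (0 : ℝ) < L := by linarith
    -- The deficit L - 4 gives exactly the claimed error 1/(Lo), with o the number of orientations;
    -- L - 2 gives half of it.
    have e1 : ((K : ℝ) * (L - 4) / (4 * orients K L)) / (K * L) - 1 / (4 * orients K L)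
        = - (1 / (L * orients K L)) := by
      field_simp; ring
    have e2 : ((K : ℝ) * (L - 2) / (4 * orients K L)) / (K * L) - 1 / (4 * orients K L)
        = - (1 / 2 * (1 / (L * orients K L))) := by
      field_simp; ring
    have h1 := div_le_div_of_nonneg_right hlo' hKL0.le
    have h2 := div_le_div_of_nonneg_right hhi' hKL0.le
    have h3 : 0 < 1 / (L * orients K L) := by positivity
    rw [abs_le]
    constructor <;> linarith

end BlumeCapel
end

open BlumeCapel in
theorem theorem2p4 :
    ∃ κ : ℕ → ℕ → ℝ,
      (∀ K L : ℕ, 5 ≤ K → K ≤ L →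
        0 < κ K L ∧
        -- (1)
        ((∀ β : ℝ, 0 < β →
            meanTransitionTime K L β (-1) {0, 1} = meanTransitionTime K L β 1 {-1, 0}) ∧
          AsympEK K (κ K L) (fun β => meanTransitionTime K L β (-1) {0, 1}) ∧
          AsympEK K (κ K L / 2) (fun β => meanTransitionTime K L β 0 {-1, 1})) ∧
        -- (2)
        ((∀ β : ℝ, 0 < β →
            meanTransitionTime K L β (-1) {0} = meanTransitionTime K L β 1 {0}) ∧
          AsympEK K (κ K L) (fun β => meanTransitionTime K L β (-1) {0})) ∧
        -- (3)
        ((∀ β : ℝ, 0 < β →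
            meanTransitionTime K L β 0 {-1} = meanTransitionTime K L β 0 {1}) ∧
          AsympEK K (2 * κ K L) (fun β => meanTransitionTime K L β 0 {-1})) ∧
        -- (4)
        ((∀ β : ℝ, 0 < β →
            meanTransitionTime K L β (-1) {1} = meanTransitionTime K L β 1 {-1}) ∧
          AsympEK K (3 * κ K L) (fun β => meanTransitionTime K L β (-1) {1}))) ∧
      -- the limit as `K → ∞` over pairs `K < L`, uniformly in `L`
      (∀ ε : ℝ, 0 < ε → ∃ K₀ : ℕ, ∀ K L : ℕ, 5 ≤ K → K₀ ≤ K → K < L →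
        |κ K L / ((K : ℝ) * (L : ℝ)) - 1 / 4| < ε) ∧
      -- the limit as `K → ∞` over pairs `K = L`
      (∀ ε : ℝ, 0 < ε → ∃ K₀ : ℕ, ∀ K : ℕ, 5 ≤ K → K₀ ≤ K →
        |κ K K / ((K : ℝ) * (K : ℝ)) - 1 / 8| < ε) := by
  choose κ hκ using fun (K L : ℕ) (h5 : 5 ≤ K) (hKL : K ≤ L) => eyring_kramers h5 hKL
  classical
  have hlim : ∀ ε : ℝ, 0 < ε → ∃ K₀ : ℕ, ∀ L : ℕ, K₀ ≤ L → 1 ≤ L → 1 / (L : ℝ) < ε := by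
    intro ε hε
    obtain ⟨n, hn⟩ := exists_nat_gt (1 / ε)
    refine ⟨n, fun L hL h1 => ?_⟩
    have h2 : (0 : ℝ) < L := by exact_mod_cast h1
    have h3 : (n : ℝ) ≤ L := by exact_mod_cast hL
    rw [div_lt_iff₀ h2]
    rw [div_lt_iff₀ hε] at hn
    nlinarith
  -- Outside the admissible pairs the value 0 is arbitrary.
  refine ⟨fun K L => if h : 5 ≤ K ∧ K ≤ L then κ K L h.1 h.2 else 0, fun K L h5 hKL => ?_,
    fun ε hε => ?_, fun ε hε => ?_⟩
  · have hK : 0 < K := by omega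
    have hL : 0 < L := by omega
    beta_reduce
    rw [dif_pos ⟨h5, hKL⟩]
    obtain ⟨h0, h1, h2, h3, h4, h6, -⟩ := hκ K L h5 hKL
    refine ⟨h0, ⟨fun β _ => ?_, h1, h2⟩, ⟨fun β _ => ?_, h3⟩, ⟨fun β _ => ?_, h4⟩,
      ⟨fun β _ => ?_, h6⟩⟩
    · exact meanTransitionTime_neg hK hL β 1 (by simp) fun b => by cases b <;> simp
    · exact meanTransitionTime_neg hK hL β 1 (by simp) fun b => by cases b <;> simp
    · exact meanTransitionTime_neg hK hL β 0 (by simp) fun b => by cases b <;> simp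
    · exact meanTransitionTime_neg hK hL β 1 (by simp) fun b => by cases b <;> simp
  · obtain ⟨K₀, hK₀⟩ := hlim ε hε
    refine ⟨K₀, fun K L h5 hK hKL => ?_⟩
    have h := (hκ K L h5 hKL.le).2.2.2.2.2.2
    beta_reduce
    rw [dif_pos ⟨h5, hKL.le⟩]
    rw [orients_of_lt hKL, mul_one, mul_one] at h
    -- The error 1/L is small as soon as K is, because L > K ≥ K₀; this is the uniformity in L.
    exact h.trans_lt (hK₀ L (by omega) (by omega))
  · obtain ⟨K₀, hK₀⟩ := hlim ε hε
    refine ⟨K₀, fun K h5 hK => ?_⟩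
    have h := (hκ K K h5 le_rfl).2.2.2.2.2.2
    beta_reduce
    rw [dif_pos ⟨h5, le_rfl⟩]
    rw [orients_self, show (4 : ℝ) * 2 = 8 by norm_num] at h
    refine h.trans_lt (lt_of_le_of_lt ?_ (hK₀ K hK (by omega)))
    have : (0 : ℝ) < K := by exact_mod_cast (by omega : 0 < K)
    exact one_div_le_one_div_of_le this (by linarith)
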